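/- Let $p$ be a prime number. For a commutative ring, a $\delta$-structure means a $\delta$-structure relative to $p$ (a map $\delta$ with $\delta(0)=\delta(1)=0$, $\delta(ab)=a^p\delta(b)+b^p\delta(a)+p\,\delta(a)\delta(b)$ and $\delta(a+b)=\delta(a)+\delta(b)-\sum_{0<i<p}\frac1p\binom pi a^{p-i}b^i$). Write $(n)_u=1+u+\dots+u^{n-1}$, and let $\binom nk_u\in\mathbb Z[u]$ be the Gaussian binomial coefficients. Let $R$ be a commutative $\mathbb Z_p[[q-1]]$-algebra with a $\delta$-structure such that $\delta(q)=0$ (where $q$ also denotes the image of $q$ in $R$). Let $A$ be a $\delta$-$R$-algebra (a commutative $R$-algebra with a $\delta$-structure for which $R\to A$ commutes with $\delta$), let $x\in A$ satisfy $\delta(x)=0$, and put $y=(1-q)x$. Extend the $\delta$-structure of $A$ to the polynomial ring $A[\xi]$ by $$\delta(\xi)=\sum_{1\le i\le p-1}\frac1p\binom pi x^{p-i}\xi^i .$$ Let $A\langle\omega\rangle_{q^p,y}$, with $\omega=\xi/(p)_q$, also written $A\langle\frac{\xi}{(p)_q}\rangle_{q^p,y}$, be the ring of $q^p$-deformed divided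 power polynomials: the free $A$-module on symbols $\omega^{[n]}$, $n\in\mathbb N$, with $\omega^{[0]}=1$, $\omega^{[1]}=\omega$ and the multiplication $$\omega^{[m]}\omega^{[n]}=\sum_{i=0}^{\min(m,n)}(-1)^i (q^p)^{\frac{i(i-1)}2}\binom{m+n-i}{m}_{q^p}\binom mi_{q^p}y^i\,\omega^{[m+n-i]},$$ and let $\iota:A[\xi]\to A\langle\omega\rangle_{q^p,y}$ be the morphism of $A$-algebras with $\iota(\xi)=(p)_q\,\omega$. Suppose that $A$ has no $(p)_q$-torsion. Then there is a $\delta$-structure on $E=A\langle\frac{\xi}{(p)_q}\rangle_{q^p,y}$ such that $(E,(p)_qE)$, with $\iota$, is the prismatic envelope (without completions) of the $\delta$-pair $(A[\xi],(\xi))$ relative to $(R,((p)_q))$, in the following sense: 1. $E$ is a $\delta$-$R$-algebra without $(p)_q$-torsion; 2. $\iota$ commutes with $\delta$ and maps $(\xi)$ into $(p)_qE$; 3. for every $\delta$-$R$-algebra $B$ without $(p)_q$-torsion and every morphism of $R$-algebras $u:A[\xi]\to B$ which commutes with $\delta$ and maps $(\xi)$ into $(p)_qB$, there is a unique morphism of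 $R$-algebras $g:E\to B$ which commutes with $\delta$ (and maps $(p)_qE$ into $(p)_qB$) such that $g\circ\iota=u$. -/

import Mathlib

open scoped Polynomial

/-! ### `q`-analogues -/

section QAnalogues

variable {A : Type*} [CommRing A]

/-- The `q`-analogue `(n)_q = 1 + q + ⋯ + q ^ (n - 1)` of the natural number `n`. -/
def qNum (q : A) (n : ℕ) : A := ∑ i ∈ Finset.range n, q ^ i

/-- The `q`-factorial `(n)_q! = (1)_q (2)_q ⋯ (n)_q`. -/
def qFact (q : A) (n : ℕ) : A := ∏ i ∈ Finset.range n, qNum q (i + 1)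

/-- The `q`-binomial coefficient: the value at `u = q` of the polynomial
`(n)_u! / ((k)_u! (n - k)_u!)` of `ℤ[u]`, computed by the `q`-Pascal rule
(see `qBinom_mul_qFact` for the defining identity). -/
def qBinom (q : A) : ℕ → ℕ → A
  | _, 0 => 1
  | 0, _ + 1 => 0
  | n + 1, k + 1 => q ^ (n - k) * qBinom q n k + qBinom q n (k + 1)

theorem qNum_add (q : A) (m n : ℕ) : qNum q (m + n) = qNum q m + q ^ m * qNum q n := by
  simp only [qNum, Finset.sum_range_add, pow_add, Finset.mul_sum]

theorem qFact_succ (q : A) (n : ℕ) : qFact q (n + 1) = qFact q n * qNum q (n + 1) := by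
  simp only [qFact, Finset.prod_range_succ]

theorem qBinom_zero_right (q : A) (n : ℕ) : qBinom q n 0 = 1 := by
  cases n <;> rfl

theorem qBinom_eq_zero (q : A) {n k : ℕ} (h : n < k) : qBinom q n k = 0 := by
  induction n generalizing k with
  | zero => obtain ⟨k, rfl⟩ : ∃ j, k = j + 1 := ⟨k - 1, by omega⟩; rfl
  | succ n ih =>
    obtain ⟨k, rfl⟩ : ∃ j, k = j + 1 := ⟨k - 1, by omega⟩
    rw [qBinom, ih (by omega), ih (by omega)]; ring

theorem qBinom_self (q : A) (n : ℕ) : qBinom q n n = 1 := by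
  induction n with
  | zero => rfl
  | succ n ih => rw [qBinom, ih, qBinom_eq_zero q (by omega)]; simp

/-- The defining identity `(n choose k)_q (k)_q! (n - k)_q! = (n)_q!`, with `n = k + l`. -/
theorem qBinom_mul_qFact (q : A) (k l : ℕ) :
    qBinom q (k + l) k * (qFact q k * qFact q l) = qFact q (k + l) := by
  suffices H : ∀ n k l, k + l = n → qBinom q n k * (qFact q k * qFact q l) = qFact q n from
    H _ k l rfl
  intro n
  induction n with
  | zero =>
    intro k l h
    obtain ⟨rfl, rfl⟩ : k = 0 ∧ l = 0 := by omega
    simp [qBinom, qFact]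
  | succ n ih =>
    intro k l h
    rcases k with _ | k
    · obtain rfl : l = n + 1 := by omega
      simp [qBinom_zero_right, qFact]
    rcases l with _ | l
    · obtain rfl : k = n := by omega
      simp [qBinom_self, qFact]
    have h1 := ih k (l + 1) (by omega)
    have h2 := ih (k + 1) l (by omega)
    have h3 : n - k = l + 1 := by omega
    have h4 : qNum q (n + 1) = qNum q (l + 1) + q ^ (l + 1) * qNum q (k + 1) := by
      rw [← qNum_add]; congr 1; omega
    rw [qBinom, h3, qFact_succ q n, h4]
    rw [qFact_succ q l] at h1 ⊢
    rw [qFact_succ q k] at h2 ⊢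
    linear_combination q ^ (l + 1) * qNum q (k + 1) * h1 + qNum q (l + 1) * h2

variable {B : Type*} [CommRing B]

theorem map_qNum (f : A →+* B) (q : A) (n : ℕ) : f (qNum q n) = qNum (f q) n := by
  simp [qNum]

theorem map_qBinom (f : A →+* B) (q : A) (n k : ℕ) : f (qBinom q n k) = qBinom (f q) n k := by
  induction n generalizing k with
  | zero => cases k <;> simp [qBinom]
  | succ n ih => cases k <;> simp [qBinom, ih]

end QAnalogues

/-! ### The ring of `q`-deformed divided power polynomials -/

section QDivPow

/-- The ring `A⟨ω⟩_{q,y}` of `q`-deformed divided power polynomials in one variable `ω`: as a module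
it is the free `A`-module with basis `ω^[n]`, `n ∈ ℕ`. -/
def QDivPow (A : Type*) [CommRing A] (_q _y : A) : Type _ := ℕ →₀ A

namespace QDivPow

variable {A : Type*} [CommRing A]

noncomputable instance (q y : A) : AddCommGroup (QDivPow A q y) :=
  inferInstanceAs (AddCommGroup (ℕ →₀ A))

noncomputable instance {S : Type*} [Semiring S] [Module S A] (q y : A) :
    Module S (QDivPow A q y) :=
  inferInstanceAs (Module S (ℕ →₀ A))

instance {S T : Type*} [Semiring S] [Semiring T] [Module S A] [Module T A] [SMul S T]
    [IsScalarTower S T A] (q y : A) : IsScalarTower S T (QDivPow A q y) :=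
  inferInstanceAs (IsScalarTower S T (ℕ →₀ A))

/-- The `A`-basis of `A⟨ω⟩_{q,y}` given by the `q`-deformed divided powers. -/
noncomputable def basis (q y : A) : Module.Basis ℕ A (QDivPow A q y) :=
  Module.Basis.ofRepr (LinearEquiv.refl A (ℕ →₀ A))

/-- The `n`-th `q`-deformed divided power `ω^[n]` of the variable. -/
noncomputable def dp (q y : A) (n : ℕ) : QDivPow A q y := basis q y n

/-- The coefficient of `ω^[m + n - i]` in the product of `ω^[m]` and `ω^[n]`. -/
def mulCoeff (q y : A) (m n i : ℕ) : A :=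
  (-1) ^ i * q ^ (i * (i - 1) / 2) * qBinom q (m + n - i) m * qBinom q m i * y ^ i

/-- The product of `ω^[m]` and `ω^[n]`. -/
noncomputable def dpMul (q y : A) (m n : ℕ) : QDivPow A q y :=
  ∑ i ∈ Finset.range (min m n + 1), mulCoeff q y m n i • dp q y (m + n - i)

/-- The multiplication of `A⟨ω⟩_{q,y}`: the `A`-bilinear extension of `dpMul`. -/
noncomputable def mulHom (q y : A) :
    QDivPow A q y →ₗ[A] QDivPow A q y →ₗ[A] QDivPow A q y :=
  (basis q y).constr A fun m => (basis q y).constr A fun n => dpMul q y m n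

theorem mulHom_dp (q y : A) (m n : ℕ) : mulHom q y (dp q y m) (dp q y n) = dpMul q y m n := by
  simp [mulHom, dp]

/-! #### Comparison with polynomials when the `q`-integers are invertible -/

/-- The twisted power `∏_{i < n} (T + (i)_q y)`. -/
noncomputable def twPow (q y : A) (n : ℕ) : A[X] :=
  ∏ i ∈ Finset.range n, (Polynomial.X + Polynomial.C (qNum q i * y))

theorem twPow_succ (q y : A) (n : ℕ) :
    twPow q y (n + 1) = twPow q y n * (Polynomial.X + Polynomial.C (qNum q n * y)) := by
  simp only [twPow, Finset.prod_range_succ]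

theorem half_succ (i : ℕ) : (i + 1) * (i + 1 - 1) / 2 = i + i * (i - 1) / 2 := by
  rcases i with _ | i
  · rfl
  · have : (i + 1 + 1) * (i + 1 + 1 - 1) = (i + 1) * (i + 1 - 1) + 2 * (i + 1) := by
      simp only [Nat.add_sub_cancel]; ring
    rw [this, Nat.add_mul_div_left _ _ (by norm_num), add_comm]

/-- The descending `q`-factorial `(m)_q (m - 1)_q ⋯ (m - i + 1)_q`. -/
def qDesc (q : A) (m i : ℕ) : A := ∏ j ∈ Finset.range i, qNum q (m - j)

theorem qDesc_succ (q : A) (m i : ℕ) : qDesc q m (i + 1) = qDesc q m i * qNum q (m - i) := by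
  simp only [qDesc, Finset.prod_range_succ]

theorem qDesc_eq_zero (q : A) {m i : ℕ} (h : m < i) : qDesc q m i = 0 :=
  Finset.prod_eq_zero (Finset.mem_range.2 h) (by simp [qNum])

theorem qDesc_mul_qFact (q : A) (i l : ℕ) : qDesc q (i + l) i * qFact q l = qFact q (i + l) := by
  induction i generalizing l with
  | zero => simp [qDesc]
  | succ i ih =>
    have h := ih (l + 1)
    rw [qDesc_succ]
    have e : i + 1 + l = i + (l + 1) := by omega
    rw [e, show i + (l + 1) - i = l + 1 by omega, ← h, qFact_succ]; ring

/-- The coefficient of `twPow (m + n - i)` in `twPow m * twPow n`. -/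
def twCoeff (q y : A) (m n i : ℕ) : A :=
  (-1) ^ i * q ^ (i * (i - 1) / 2) * qBinom q n i * qDesc q m i * y ^ i

theorem twPow_mul (q y : A) (m n : ℕ) :
    twPow q y m * twPow q y n =
      ∑ i ∈ Finset.range (n + 1), Polynomial.C (twCoeff q y m n i) * twPow q y (m + n - i) := by
  induction n with
  | zero => simp [twCoeff, qBinom, qDesc, twPow]
  | succ n ih =>
    have step : ∀ i ∈ Finset.range (n + 1),
        Polynomial.C (twCoeff q y m n i) * twPow q y (m + n - i) *
            (Polynomial.X + Polynomial.C (qNum q n * y)) =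
          Polynomial.C (twCoeff q y m n i) * twPow q y (m + (n + 1) - i) -
            Polynomial.C (twCoeff q y m n i * q ^ n * qNum q (m - i) * y) *
              twPow q y (m + n - i) := by
      intro i _
      rcases le_or_gt i m with h | h
      · have e1 : m + (n + 1) - i = m + n - i + 1 := by omega
        have e2 : qNum q (m + n - i) = qNum q n + q ^ n * qNum q (m - i) := by
          rw [← qNum_add]; congr 1; omega
        rw [e1, twPow_succ, e2]
        simp only [map_mul, map_add]
        ring
      · simp [twCoeff, qDesc_eq_zero q h]
    rw [twPow_succ, ← mul_assoc, ih, Finset.sum_mul, Finset.sum_congr rfl step,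
      Finset.sum_sub_distrib, Finset.sum_range_succ' _ (n + 1)]
    have e0 : ∑ i ∈ Finset.range (n + 1),
        Polynomial.C (twCoeff q y m n i) * twPow q y (m + (n + 1) - i) =
        ∑ i ∈ Finset.range (n + 1),
          Polynomial.C (twCoeff q y m n (i + 1)) * twPow q y (m + n - i) +
          Polynomial.C (twCoeff q y m n 0) * twPow q y (m + (n + 1) - 0) := by
      have := Finset.sum_range_succ (fun i =>
        Polynomial.C (twCoeff q y m n i) * twPow q y (m + (n + 1) - i)) (n + 1)
      rw [show twCoeff q y m n (n + 1) = 0 by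
        simp [twCoeff, qBinom_eq_zero q (Nat.lt_succ_self n)]] at this
      rw [map_zero, zero_mul, add_zero] at this
      rw [← this, Finset.sum_range_succ' _ (n + 1)]
      congr 1
      refine Finset.sum_congr rfl fun i _ => ?_
      rw [show m + (n + 1) - (i + 1) = m + n - i by omega]
    rw [e0, add_sub_right_comm, ← Finset.sum_sub_distrib]
    congr 1
    · refine Finset.sum_congr rfl fun i hi => ?_
      rw [show m + (n + 1) - (i + 1) = m + n - i by omega, ← sub_mul, ← map_sub]
      congr 2
      have hi' : i ≤ n := by simpa [Nat.lt_succ_iff] using hi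
      have hq : q ^ n = q ^ i * q ^ (n - i) := by rw [← pow_add]; congr 1; omega
      simp only [twCoeff]
      rw [half_succ, qBinom, qDesc_succ, hq]
      ring
    · simp [twCoeff, qBinom_zero_right, qDesc]

section Field

variable {K : Type*} [Field K] (q y : K) (hq : ∀ n, qNum q (n + 1) ≠ 0)

theorem qFact_ne_zero (hq : ∀ n, qNum q (n + 1) ≠ 0) (n : ℕ) : qFact q n ≠ 0 :=
  Finset.prod_ne_zero_iff.2 fun i _ => hq i

theorem mulCoeff_qFact (hq : ∀ n, qNum q (n + 1) ≠ 0) {m n i : ℕ} (hm : i ≤ m) (hn : i ≤ n) :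
    mulCoeff q y m n i * (qFact q m * qFact q n) =
      twCoeff q y m n i * qFact q (m + n - i) := by
  obtain ⟨a, rfl⟩ := Nat.exists_eq_add_of_le hm
  obtain ⟨b, rfl⟩ := Nat.exists_eq_add_of_le hn
  have e : i + a + (i + b) - i = i + a + b := by omega
  have h1 := qBinom_mul_qFact q (i + a) b
  have h2 := qBinom_mul_qFact q i a
  have h3 := qBinom_mul_qFact q i b
  have h4 := qDesc_mul_qFact q i a
  have key : qBinom q (i + a) i * qFact q i = qDesc q (i + a) i :=
    mul_right_cancel₀ (qFact_ne_zero q hq a) (by rw [h4, ← h2]; ring)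
  simp only [mulCoeff, twCoeff]
  rw [e, ← h1, ← h3, ← key]
  ring

/-- The `q`-deformed divided powers as honest polynomials, when the `q`-integers are invertible. -/
noncomputable def toPoly : QDivPow K q y →ₗ[K] K[X] :=
  (basis q y).constr K fun n => Polynomial.C (qFact q n)⁻¹ * twPow q y n

theorem toPoly_dp (n : ℕ) :
    toPoly q y (dp q y n) = Polynomial.C (qFact q n)⁻¹ * twPow q y n := by
  simp [toPoly, dp]

theorem twPow_degree (n : ℕ) : (twPow q y n).degree = n := by
  rw [twPow, Polynomial.degree_prod]
  simp only [Polynomial.degree_X_add_C, Finset.sum_const, Finset.card_range, nsmul_eq_mul, mul_one]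

theorem toPoly_injective (hq : ∀ n, qNum q (n + 1) ≠ 0) :
    Function.Injective (toPoly q y) := by
  let S : Polynomial.Sequence K :=
    ⟨fun n => Polynomial.C (qFact q n)⁻¹ * twPow q y n, fun n => by
      rw [Polynomial.degree_C_mul (inv_ne_zero (qFact_ne_zero q hq n)), twPow_degree]⟩
  have hS : LinearIndependent K fun n => Polynomial.C (qFact q n)⁻¹ * twPow q y n :=
    S.linearIndependent
  intro a b h
  refine (basis q y).repr.injective (hS ?_)
  simpa only [toPoly, Module.Basis.constr_apply, Finsupp.linearCombination_apply] using h

theorem toPoly_mulHom_dp (hq : ∀ n, qNum q (n + 1) ≠ 0) (m n : ℕ) :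
    toPoly q y (mulHom q y (dp q y m) (dp q y n)) =
      toPoly q y (dp q y m) * toPoly q y (dp q y n) := by
  have h0 := qFact_ne_zero q hq
  have e : ∑ i ∈ Finset.range (min m n + 1),
      Polynomial.C (twCoeff q y m n i) * twPow q y (m + n - i) =
      twPow q y m * twPow q y n := by
    rw [twPow_mul]
    refine Finset.sum_subset ?_ ?_
    · intro i; simp only [Finset.mem_range]; omega
    · intro i h h'
      simp only [Finset.mem_range] at h h'
      rw [twCoeff, qDesc_eq_zero q (show m < i by omega)]
      simp
  rw [mulHom_dp, dpMul, map_sum, toPoly_dp, toPoly_dp, mul_mul_mul_comm, ← map_mul, ← e,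
    Finset.mul_sum]
  refine Finset.sum_congr rfl fun i hi => ?_
  simp only [Finset.mem_range] at hi
  have h := mulCoeff_qFact q y hq (m := m) (n := n) (i := i) (by omega) (by omega)
  rw [map_smul, toPoly_dp, Polynomial.smul_eq_C_mul, ← mul_assoc, ← mul_assoc, ← map_mul,
    ← map_mul]
  congr 2
  have := h0 m
  have := h0 n
  have := h0 (m + n - i)
  field_simp
  linear_combination h

theorem toPoly_mulHom (hq : ∀ n, qNum q (n + 1) ≠ 0) (a b : QDivPow K q y) :
    toPoly q y (mulHom q y a b) = toPoly q y a * toPoly q y b := by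
  have : (mulHom q y).compr₂ (toPoly q y) =
      (LinearMap.mul K K[X]).compl₁₂ (toPoly q y) (toPoly q y) := by
    refine (basis q y).ext fun m => (basis q y).ext fun n => ?_
    exact toPoly_mulHom_dp q y hq m n
  exact LinearMap.congr_fun₂ this a b

end Field

/-! #### Change of coefficients -/

section Map

variable {B : Type*} [CommRing B]

/-- The additive map `A⟨ω⟩_{q,y} → B⟨ω⟩_{f q,f y}` applying `f : A → B` to the coefficients. -/
noncomputable def mapCoeff (f : A →+* B) (q y : A) :
    QDivPow A q y →+ QDivPow B (f q) (f y) :=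
  (Finsupp.mapRange.addMonoidHom f.toAddMonoidHom : (ℕ →₀ A) →+ (ℕ →₀ B))

theorem mapCoeff_injective (f : A →+* B) (hf : Function.Injective f) (q y : A) :
    Function.Injective (mapCoeff f q y) :=
  Finsupp.mapRange_injective f (map_zero f) hf

theorem mapCoeff_smul (f : A →+* B) (q y : A) (a : A) (v : QDivPow A q y) :
    mapCoeff f q y (a • v) = f a • mapCoeff f q y v :=
  Finsupp.mapRange_smul' (M := A) (N := B) (hf := map_zero f) a (f a) v (fun x => by simp)

theorem mapCoeff_dp (f : A →+* B) (q y : A) (n : ℕ) :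
    mapCoeff f q y (dp q y n) = dp (f q) (f y) n := by
  have h : mapCoeff f q y (dp q y n) = Finsupp.mapRange f (map_zero f) (Finsupp.single n 1) := rfl
  rw [h, Finsupp.mapRange_single, map_one]
  rfl

theorem map_mulCoeff (f : A →+* B) (q y : A) (m n i : ℕ) :
    f (mulCoeff q y m n i) = mulCoeff (f q) (f y) m n i := by
  simp [mulCoeff, map_qBinom]

theorem dp_induction (q y : A) {P : QDivPow A q y → Prop} (v : QDivPow A q y)
    (h0 : P 0) (hadd : ∀ v w, P v → P w → P (v + w)) (hdp : ∀ (a : A) n, P (a • dp q y n)) :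
    P v := by
  rw [← (basis q y).linearCombination_repr v, Finsupp.linearCombination_apply]
  exact Finset.sum_induction _ P hadd h0 fun n _ => hdp _ n

theorem mapCoeff_mulHom (f : A →+* B) (q y : A) (v w : QDivPow A q y) :
    mapCoeff f q y (mulHom q y v w) =
      mulHom (f q) (f y) (mapCoeff f q y v) (mapCoeff f q y w) := by
  induction v using dp_induction with
  | h0 => simp
  | hadd v v' h h' => simp [h, h']
  | hdp a m =>
    induction w using dp_induction with
    | h0 => simp
    | hadd w w' h h' => simp only [map_add, h, h']
    | hdp b n =>
      simp only [map_smul, LinearMap.smul_apply, mapCoeff_smul, mapCoeff_dp, mulHom_dp, dpMul,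
        map_sum, map_mulCoeff]

end Map

/-! #### The ring structure -/

/-- The universal coefficient ring for `q` and `y`. -/
abbrev Univ : Type := MvPolynomial (Fin 2) ℤ

theorem univ_qNum_ne_zero (n : ℕ) :
    qNum (algebraMap Univ (FractionRing Univ) (MvPolynomial.X 0)) (n + 1) ≠ 0 := by
  rw [← map_qNum]
  intro h
  have h1 : qNum (MvPolynomial.X 0 : Univ) (n + 1) = 0 :=
    IsFractionRing.injective Univ (FractionRing Univ) (by rw [h, map_zero])
  have h2 := congrArg (MvPolynomial.eval (fun _ => (1 : ℤ))) h1
  rw [map_qNum, MvPolynomial.eval_X, map_zero] at h2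
  simp only [qNum, one_pow, Finset.sum_const, Finset.card_range, nsmul_eq_mul, mul_one] at h2
  omega

theorem univ_mulHom_comm (v w : QDivPow Univ (MvPolynomial.X 0) (MvPolynomial.X 1)) :
    mulHom _ _ v w = mulHom _ _ w v := by
  apply mapCoeff_injective (algebraMap Univ (FractionRing Univ)) (IsFractionRing.injective _ _)
  apply toPoly_injective _ _ univ_qNum_ne_zero
  simp only [mapCoeff_mulHom, toPoly_mulHom _ _ univ_qNum_ne_zero]
  ring

theorem univ_mulHom_assoc (u v w : QDivPow Univ (MvPolynomial.X 0) (MvPolynomial.X 1)) :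
    mulHom _ _ (mulHom _ _ u v) w = mulHom _ _ u (mulHom _ _ v w) := by
  apply mapCoeff_injective (algebraMap Univ (FractionRing Univ)) (IsFractionRing.injective _ _)
  apply toPoly_injective _ _ univ_qNum_ne_zero
  simp only [mapCoeff_mulHom, toPoly_mulHom _ _ univ_qNum_ne_zero]
  ring

theorem mulHom_dp_comm (q y : A) (m n : ℕ) :
    mulHom q y (dp q y m) (dp q y n) = mulHom q y (dp q y n) (dp q y m) := by
  obtain ⟨f, rfl, rfl⟩ : ∃ f : Univ →+* A, f (MvPolynomial.X 0) = q ∧ f (MvPolynomial.X 1) = y :=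
    ⟨MvPolynomial.eval₂Hom (Int.castRingHom A) ![q, y], by simp, by simp⟩
  simp only [← mapCoeff_dp, ← mapCoeff_mulHom]
  rw [univ_mulHom_comm]

theorem mulHom_dp_assoc (q y : A) (l m n : ℕ) :
    mulHom q y (mulHom q y (dp q y l) (dp q y m)) (dp q y n) =
      mulHom q y (dp q y l) (mulHom q y (dp q y m) (dp q y n)) := by
  obtain ⟨f, rfl, rfl⟩ : ∃ f : Univ →+* A, f (MvPolynomial.X 0) = q ∧ f (MvPolynomial.X 1) = y :=
    ⟨MvPolynomial.eval₂Hom (Int.castRingHom A) ![q, y], by simp, by simp⟩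
  simp only [← mapCoeff_dp, ← mapCoeff_mulHom]
  rw [univ_mulHom_assoc]

theorem mulHom_comm (q y : A) (v w : QDivPow A q y) : mulHom q y v w = mulHom q y w v := by
  induction v using dp_induction with
  | h0 => simp
  | hadd v v' h h' => simp [h, h']
  | hdp a m =>
    induction w using dp_induction with
    | h0 => simp
    | hadd w w' h h' => simp only [map_add, LinearMap.add_apply, h, h']
    | hdp b n =>
      simp only [map_smul, LinearMap.smul_apply]
      rw [mulHom_dp_comm, smul_comm]

theorem mulHom_assoc (q y : A) (u v w : QDivPow A q y) :
    mulHom q y (mulHom q y u v) w = mulHom q y u (mulHom q y v w) := by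
  induction u using dp_induction with
  | h0 => simp
  | hadd u u' h h' => simp only [map_add, LinearMap.add_apply, h, h']
  | hdp a l =>
    induction v using dp_induction with
    | h0 => simp
    | hadd v v' h h' => simp only [map_add, LinearMap.add_apply, h, h']
    | hdp b m =>
      induction w using dp_induction with
      | h0 => simp
      | hadd w w' h h' => simp only [map_add, h, h']
      | hdp c n =>
        simp only [map_smul, LinearMap.smul_apply]
        rw [mulHom_dp_assoc]

theorem mulHom_one (q y : A) (v : QDivPow A q y) : mulHom q y (dp q y 0) v = v := by
  induction v using dp_induction with
  | h0 => simp
  | hadd v v' h h' => simp [h, h']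
  | hdp a m =>
    rw [map_smul, mulHom_dp]
    simp [dpMul, mulCoeff, qBinom_zero_right]

noncomputable instance (q y : A) : CommRing (QDivPow A q y) where
  __ := (inferInstance : AddCommGroup (QDivPow A q y))
  mul v w := mulHom q y v w
  one := dp q y 0
  mul_assoc := mulHom_assoc q y
  mul_comm := mulHom_comm q y
  one_mul := mulHom_one q y
  mul_one v := (mulHom_comm q y v (dp q y 0)).trans (mulHom_one q y v)
  left_distrib u v w := map_add (mulHom q y u) v w
  right_distrib u v w := LinearMap.map_add₂ (mulHom q y) u v w
  zero_mul v := LinearMap.map_zero₂ (mulHom q y) v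
  mul_zero v := map_zero (mulHom q y v)

theorem mul_def (q y : A) (v w : QDivPow A q y) : v * w = mulHom q y v w := rfl

theorem one_def (q y : A) : (1 : QDivPow A q y) = dp q y 0 := rfl

/-- The multiplication rule of the `q`-deformed divided powers. -/
theorem dp_mul_dp (q y : A) (m n : ℕ) :
    dp q y m * dp q y n = ∑ i ∈ Finset.range (min m n + 1),
      ((-1) ^ i * q ^ (i * (i - 1) / 2) * qBinom q (m + n - i) m * qBinom q m i * y ^ i) •
        dp q y (m + n - i) :=
  mulHom_dp q y m n

/-- `A⟨ω⟩_{q,y}` is an `A`-algebra, hence an `S`-algebra whenever `A` is one. -/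
noncomputable instance {S : Type*} [CommSemiring S] [Algebra S A] (q y : A) :
    Algebra S (QDivPow A q y) :=
  Algebra.ofModule
    (fun s v w => by
      rw [← algebraMap_smul A s v, ← algebraMap_smul A s (v * w)]
      exact LinearMap.map_smul₂ (mulHom q y) _ v w)
    (fun s v w => by
      rw [← algebraMap_smul A s w, ← algebraMap_smul A s (v * w)]
      exact map_smul (mulHom q y v) _ w)

end QDivPow

end QDivPow

/-! ### `δ`-rings -/

section Delta

/-- The polynomial `∑_{0 < i < p} (1/p) (p choose i) a ^ (p - i) b ^ i`, that is
`((a + b) ^ p - a ^ p - b ^ p) / p`. -/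
def deltaPoly (p : ℕ) {R : Type*} [CommRing R] (a b : R) : R :=
  ∑ i ∈ Finset.Ico 1 p, ((p.choose i / p : ℕ) : R) * a ^ (p - i) * b ^ i

/-- A `δ`-structure (relative to the prime `p`) on a commutative ring. -/
@[ext]
structure DeltaStructure (p : ℕ) (R : Type*) [CommRing R] where
  /-- The underlying map of sets. -/
  δ : R → R
  map_zero : δ 0 = 0
  map_one : δ 1 = 0
  map_mul : ∀ a b, δ (a * b) = a ^ p * δ b + b ^ p * δ a + p * δ a * δ b
  map_add : ∀ a b, δ (a + b) = δ a + δ b - deltaPoly p a b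

/-- A ring homomorphism compatible with given `δ`-structures. -/
def IsDeltaHom {p : ℕ} {R S : Type*} [CommRing R] [CommRing S] (δR : DeltaStructure p R)
    (δS : DeltaStructure p S) (f : R →+* S) : Prop :=
  ∀ r, δS.δ (f r) = f (δR.δ r)

theorem mul_deltaPoly (p : ℕ) [hp : Fact p.Prime] {R : Type*} [CommRing R] (a b : R) :
    (p : R) * deltaPoly p a b = (a + b) ^ p - a ^ p - b ^ p := by
  have h0 := hp.out.pos
  have e : ∑ i ∈ Finset.Ico 1 p, a ^ (p - i) * b ^ i * (p.choose i : R) =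
      (p : R) * deltaPoly p a b := by
    rw [deltaPoly, Finset.mul_sum]
    refine Finset.sum_congr rfl fun i hi => ?_
    rw [Finset.mem_Ico] at hi
    obtain ⟨c, hc⟩ := hp.out.dvd_choose_self (k := i) (by omega) hi.2
    rw [hc, Nat.mul_div_cancel_left _ h0]
    push_cast
    ring
  have e' : ∑ i ∈ Finset.Ico 1 p, b ^ i * a ^ (p - i) * (p.choose i : R) =
      (p : R) * deltaPoly p a b := by
    rw [← e]
    exact Finset.sum_congr rfl fun i _ => by rw [mul_comm (b ^ i)]
  rw [add_comm a b, add_pow, Finset.sum_range_succ, Finset.range_eq_Ico,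
    Finset.sum_eq_sum_Ico_succ_bot h0]
  simp only [pow_zero, Nat.sub_zero, Nat.choose_zero_right, Nat.sub_self, Nat.choose_self,
    Nat.cast_one, one_mul, mul_one, zero_add]
  rw [e']
  ring

theorem map_deltaPoly (p : ℕ) {R S : Type*} [CommRing R] [CommRing S] (f : R →+* S) (a b : R) :
    f (deltaPoly p a b) = deltaPoly p (f a) (f b) := by
  simp [deltaPoly]

theorem deltaPoly_cocycle (p : ℕ) [hp : Fact p.Prime] {R : Type*} [CommRing R] (a b c : R) :
    deltaPoly p a b + deltaPoly p (a + b) c = deltaPoly p b c + deltaPoly p a (b + c) := by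
  have key : ∀ x y z : MvPolynomial (Fin 3) ℤ,
      deltaPoly p x y + deltaPoly p (x + y) z = deltaPoly p y z + deltaPoly p x (y + z) := by
    intro x y z
    have h0 : (p : MvPolynomial (Fin 3) ℤ) ≠ 0 := Nat.cast_ne_zero.2 hp.out.ne_zero
    apply mul_left_cancel₀ h0
    simp only [mul_add, mul_deltaPoly]
    rw [add_assoc x y z]
    ring
  have h := congrArg (MvPolynomial.eval₂Hom (Int.castRingHom R) ![a, b, c])
    (key (MvPolynomial.X 0) (MvPolynomial.X 1) (MvPolynomial.X 2))
  simpa only [map_deltaPoly, map_add, MvPolynomial.coe_eval₂Hom, MvPolynomial.eval₂_X,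
    Matrix.cons_val] using h

theorem deltaPoly_comm (p : ℕ) [hp : Fact p.Prime] {R : Type*} [CommRing R] (a b : R) :
    deltaPoly p a b = deltaPoly p b a := by
  have key : ∀ x y : MvPolynomial (Fin 2) ℤ, deltaPoly p x y = deltaPoly p y x := by
    intro x y
    have h0 : (p : MvPolynomial (Fin 2) ℤ) ≠ 0 := Nat.cast_ne_zero.2 hp.out.ne_zero
    apply mul_left_cancel₀ h0
    simp only [mul_deltaPoly]
    rw [add_comm x y]
    ring
  have h := congrArg (MvPolynomial.eval₂Hom (Int.castRingHom R) ![a, b])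
    (key (MvPolynomial.X 0) (MvPolynomial.X 1))
  simpa only [map_deltaPoly, map_add, MvPolynomial.coe_eval₂Hom, MvPolynomial.eval₂_X,
    Matrix.cons_val] using h

theorem deltaPoly_zero_left (p : ℕ) {R : Type*} [CommRing R] (b : R) : deltaPoly p 0 b = 0 := by
  refine Finset.sum_eq_zero fun i hi => ?_
  rw [Finset.mem_Ico] at hi
  rw [zero_pow (by omega)]
  simp

theorem deltaPoly_mul_mul (p : ℕ) {R : Type*} [CommRing R] (a b c : R) :
    deltaPoly p (a * b) (a * c) = a ^ p * deltaPoly p b c := by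
  rw [deltaPoly, deltaPoly, Finset.mul_sum]
  refine Finset.sum_congr rfl fun i hi => ?_
  rw [Finset.mem_Ico] at hi
  have : a ^ p = a ^ (p - i) * a ^ i := by rw [← pow_add]; congr 1; omega
  rw [mul_pow, mul_pow, this]
  ring

/-- The ring of `p`-typical Witt vectors of length two over `R`, in Witt coordinates. -/
@[ext]
structure WittTwo (p : ℕ) (R : Type*) where
  /-- The first Witt coordinate. -/
  fst : R
  /-- The second Witt coordinate. -/
  snd : R

instance (p : ℕ) (R : Type*) [CommRing R] : Zero (WittTwo p R) := ⟨⟨0, 0⟩⟩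

instance (p : ℕ) (R : Type*) [CommRing R] : Add (WittTwo p R) :=
  ⟨fun a b => ⟨a.fst + b.fst, a.snd + b.snd - deltaPoly p a.fst b.fst⟩⟩

instance (p : ℕ) (R : Type*) [CommRing R] : Neg (WittTwo p R) :=
  ⟨fun a => ⟨-a.fst, deltaPoly p (-a.fst) a.fst - a.snd⟩⟩

instance (p : ℕ) [Fact p.Prime] (R : Type*) [CommRing R] : CommRing (WittTwo p R) where
  one := ⟨1, 0⟩
  mul a b := ⟨a.fst * b.fst, a.fst ^ p * b.snd + b.fst ^ p * a.snd + p * a.snd * b.snd⟩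
  nsmul := nsmulRec
  zsmul := zsmulRec
  add_assoc a b c := by
    refine WittTwo.ext (add_assoc a.fst b.fst c.fst) ?_
    change a.snd + b.snd - deltaPoly p a.fst b.fst + c.snd - deltaPoly p (a.fst + b.fst) c.fst =
      a.snd + (b.snd + c.snd - deltaPoly p b.fst c.fst) - deltaPoly p a.fst (b.fst + c.fst)
    linear_combination -deltaPoly_cocycle p a.fst b.fst c.fst
  zero_add a := by
    refine WittTwo.ext (zero_add a.fst) ?_
    change 0 + a.snd - deltaPoly p 0 a.fst = a.snd
    rw [deltaPoly_zero_left]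
    ring
  add_zero a := by
    refine WittTwo.ext (add_zero a.fst) ?_
    change a.snd + 0 - deltaPoly p a.fst 0 = a.snd
    rw [deltaPoly_comm, deltaPoly_zero_left]
    ring
  neg_add_cancel a := by
    refine WittTwo.ext (neg_add_cancel a.fst) ?_
    change deltaPoly p (-a.fst) a.fst - a.snd + a.snd - deltaPoly p (-a.fst) a.fst = 0
    ring
  add_comm a b := by
    refine WittTwo.ext (add_comm a.fst b.fst) ?_
    change a.snd + b.snd - deltaPoly p a.fst b.fst = b.snd + a.snd - deltaPoly p b.fst a.fst
    rw [deltaPoly_comm]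
    ring
  mul_assoc a b c := by
    refine WittTwo.ext (mul_assoc a.fst b.fst c.fst) ?_
    change (a.fst * b.fst) ^ p * c.snd +
        c.fst ^ p * (a.fst ^ p * b.snd + b.fst ^ p * a.snd + p * a.snd * b.snd) +
        p * (a.fst ^ p * b.snd + b.fst ^ p * a.snd + p * a.snd * b.snd) * c.snd =
      a.fst ^ p * (b.fst ^ p * c.snd + c.fst ^ p * b.snd + p * b.snd * c.snd) +
        (b.fst * c.fst) ^ p * a.snd +
        p * a.snd * (b.fst ^ p * c.snd + c.fst ^ p * b.snd + p * b.snd * c.snd)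
    rw [mul_pow, mul_pow]
    ring
  mul_comm a b := by
    refine WittTwo.ext (mul_comm a.fst b.fst) ?_
    change a.fst ^ p * b.snd + b.fst ^ p * a.snd + p * a.snd * b.snd =
      b.fst ^ p * a.snd + a.fst ^ p * b.snd + p * b.snd * a.snd
    ring
  one_mul a := by
    refine WittTwo.ext (one_mul a.fst) ?_
    change 1 ^ p * a.snd + a.fst ^ p * 0 + p * 0 * a.snd = a.snd
    rw [one_pow]
    ring
  mul_one a := by
    refine WittTwo.ext (mul_one a.fst) ?_
    change a.fst ^ p * 0 + 1 ^ p * a.snd + p * a.snd * 0 = a.snd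
    rw [one_pow]
    ring
  left_distrib a b c := by
    refine WittTwo.ext (mul_add a.fst b.fst c.fst) ?_
    change a.fst ^ p * (b.snd + c.snd - deltaPoly p b.fst c.fst) + (b.fst + c.fst) ^ p * a.snd +
        p * a.snd * (b.snd + c.snd - deltaPoly p b.fst c.fst) =
      (a.fst ^ p * b.snd + b.fst ^ p * a.snd + p * a.snd * b.snd) +
        (a.fst ^ p * c.snd + c.fst ^ p * a.snd + p * a.snd * c.snd) -
        deltaPoly p (a.fst * b.fst) (a.fst * c.fst)
    rw [deltaPoly_mul_mul]
    linear_combination -a.snd * mul_deltaPoly p b.fst c.fst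
  right_distrib b c a := by
    refine WittTwo.ext (add_mul b.fst c.fst a.fst) ?_
    change (b.fst + c.fst) ^ p * a.snd + a.fst ^ p * (b.snd + c.snd - deltaPoly p b.fst c.fst) +
        p * (b.snd + c.snd - deltaPoly p b.fst c.fst) * a.snd =
      (b.fst ^ p * a.snd + a.fst ^ p * b.snd + p * b.snd * a.snd) +
        (c.fst ^ p * a.snd + a.fst ^ p * c.snd + p * c.snd * a.snd) -
        deltaPoly p (b.fst * a.fst) (c.fst * a.fst)
    rw [mul_comm b.fst, mul_comm c.fst, deltaPoly_mul_mul]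
    linear_combination -a.snd * mul_deltaPoly p b.fst c.fst
  zero_mul a := by
    refine WittTwo.ext (zero_mul a.fst) ?_
    change 0 ^ p * a.snd + a.fst ^ p * 0 + p * 0 * a.snd = 0
    rw [zero_pow (Fact.out : p.Prime).ne_zero]
    ring
  mul_zero a := by
    refine WittTwo.ext (mul_zero a.fst) ?_
    change a.fst ^ p * 0 + 0 ^ p * a.snd + p * a.snd * 0 = 0
    rw [zero_pow (Fact.out : p.Prime).ne_zero]
    ring

section Witt

variable {p : ℕ} [Fact p.Prime] {R S : Type*} [CommRing R] [CommRing S]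

/-- The first Witt coordinate is a ring homomorphism. -/
noncomputable def WittTwo.fstHom : WittTwo p R →+* R where
  toFun := WittTwo.fst
  map_zero' := rfl
  map_one' := rfl
  map_add' _ _ := rfl
  map_mul' _ _ := rfl

/-- The `δ`-structure attached to a section of the first Witt coordinate. -/
noncomputable def DeltaStructure.ofSection (s : R →+* WittTwo p R) (hs : ∀ r, (s r).fst = r) :
    DeltaStructure p R where
  δ r := (s r).snd
  map_zero := by rw [_root_.map_zero s]; rfl
  map_one := by rw [_root_.map_one s]; rfl
  map_mul a b := by
    have h : (s (a * b)).snd =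
        (s a).fst ^ p * (s b).snd + (s b).fst ^ p * (s a).snd + p * (s a).snd * (s b).snd := by
      rw [_root_.map_mul s]; rfl
    rw [h, hs, hs]
  map_add a b := by
    have h : (s (a + b)).snd = (s a).snd + (s b).snd - deltaPoly p (s a).fst (s b).fst := by
      rw [_root_.map_add s]; rfl
    rw [h, hs, hs]

/-- The homomorphism `r ↦ (f r, f (δ r))` to Witt vectors of length two. -/
noncomputable def DeltaStructure.toWitt (D : DeltaStructure p R) (f : R →+* S) : R →+* WittTwo p S where
  toFun r := ⟨f r, f (D.δ r)⟩
  map_zero' := by rw [D.map_zero, _root_.map_zero f]; rfl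
  map_one' := by rw [D.map_one, _root_.map_one f, _root_.map_zero f]; rfl
  map_add' a b := by
    rw [D.map_add, _root_.map_sub, _root_.map_add f, _root_.map_add f, map_deltaPoly]; rfl
  map_mul' a b := by
    rw [D.map_mul]
    simp only [_root_.map_add f, _root_.map_mul f, map_pow f, map_natCast f]
    rfl

/-- The ring homomorphism `R[X] → W₂(R[X])` extending `r ↦ (r, δ r)` and sending `X` to
`(X, v)`. -/
noncomputable def polyWitt (D : DeltaStructure p R) (v : R[X]) : R[X] →+* WittTwo p R[X] :=
  Polynomial.eval₂RingHom (D.toWitt Polynomial.C) ⟨Polynomial.X, v⟩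

theorem polyWitt_fst (D : DeltaStructure p R) (v f : R[X]) : (polyWitt D v f).fst = f := by
  have h : (WittTwo.fstHom).comp (polyWitt D v) = RingHom.id R[X] := by
    refine Polynomial.ringHom_ext (fun a => ?_) ?_
    · simp [polyWitt, DeltaStructure.toWitt, WittTwo.fstHom]
    · simp [polyWitt, WittTwo.fstHom]
  exact RingHom.congr_fun h f

/-- The `δ`-structure on the polynomial ring `R[X]` which extends the given one on `R` and
satisfies `δ X = v`. -/
noncomputable def polyDelta (D : DeltaStructure p R) (v : R[X]) : DeltaStructure p R[X] :=
  DeltaStructure.ofSection (polyWitt D v) (polyWitt_fst D v)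

theorem polyDelta_C (D : DeltaStructure p R) (v : R[X]) (r : R) :
    (polyDelta D v).δ (Polynomial.C r) = Polynomial.C (D.δ r) := by
  simp [polyDelta, DeltaStructure.ofSection, polyWitt, DeltaStructure.toWitt]

theorem polyDelta_X (D : DeltaStructure p R) (v : R[X]) :
    (polyDelta D v).δ Polynomial.X = v := by
  simp [polyDelta, DeltaStructure.ofSection, polyWitt]

end Witt

end Delta

/-! ### Prismatic envelopes -/

section Envelope

/-- A homomorphism of `δ`-pairs `(C, I) → (B, J)` over `R`: a homomorphism of `R`-algebras which is
compatible with the `δ`-structures and maps `I` into `J`. -/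
structure IsDeltaPairHom {p : ℕ} {R C B : Type*} [CommRing R] [CommRing C] [CommRing B]
    [Algebra R C] [Algebra R B] (δC : DeltaStructure p C) (I : Ideal C)
    (δB : DeltaStructure p B) (J : Ideal B) (f : C →ₐ[R] B) : Prop where
  isDeltaHom : IsDeltaHom δC δB (f : C →+* B)
  le_comap : I ≤ J.comap f

/-- `B` has no `d`-torsion, for an element `d` of the base ring `R`. -/
def NoTorsion {R : Type*} (B : Type*) [CommRing R] [CommRing B] [Algebra R B] (d : R) : Prop :=
  ∀ b : B, d • b = 0 → b = 0

/-- Let `(R, (d))` be a `δ`-pair and `(P, I)` a `δ`-pair whose underlying ring is a `δ`-`R`-algebra.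
The `δ`-pair `(E, dE)`, with the homomorphism `ι : P → E`, is the prismatic envelope of `(P, I)`
relative to `(R, (d))` (without completions): `E` is a `δ`-`R`-algebra without `d`-torsion, `ι` is a
homomorphism of `δ`-pairs `(P, I) → (E, dE)`, and every homomorphism of `δ`-pairs
`(P, I) → (B, dB)`, where `B` is a `δ`-`R`-algebra without `d`-torsion, factors uniquely
through `ι`. The test objects `B` run through the universe `w`. -/
structure IsPrismaticEnvelope.{w, w₁, w₂, w₃} {p : ℕ} {R : Type w₁} {P : Type w₂} {E : Type w₃}
    [CommRing R] [CommRing P] [CommRing E] [Algebra R P] [Algebra R E]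
    (δR : DeltaStructure p R) (d : R) (δP : DeltaStructure p P) (I : Ideal P)
    (δE : DeltaStructure p E) (ι : P →ₐ[R] E) : Prop where
  isDeltaAlgebra : IsDeltaHom δR δE (algebraMap R E)
  noTorsion : NoTorsion E d
  isDeltaPairHom : IsDeltaPairHom δP I δE (Ideal.span {algebraMap R E d}) ι
  existsUnique_lift : ∀ (B : Type w) [CommRing B] [Algebra R B] (δB : DeltaStructure p B),
    IsDeltaHom δR δB (algebraMap R B) → NoTorsion B d →
    ∀ u : P →ₐ[R] B, IsDeltaPairHom δP I δB (Ideal.span {algebraMap R B d}) u →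
      ∃! g : E →ₐ[R] B,
        IsDeltaPairHom δE (Ideal.span {algebraMap R E d}) δB (Ideal.span {algebraMap R B d}) g ∧
          g.comp ι = u

end Envelope

/-! ### The objects of the statement -/

section Objects

/-- The image in `R` of the element `q` of `ℤ_p⟦q - 1⟧`, the power series ring over `ℤ_p` in the
variable `q - 1`. -/
noncomputable def qElt (p : ℕ) [Fact p.Prime] (R : Type*) [CommRing R]
    [Algebra (PowerSeries ℤ_[p]) R] : R :=
  algebraMap (PowerSeries ℤ_[p]) R (1 + PowerSeries.X)

/-- The `δ`-structure on `A[ξ]` extending the one of `A`, with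
`δ ξ = ∑_{1 ≤ i ≤ p - 1} (1/p) (p choose i) x ^ (p - i) ξ ^ i`. -/
noncomputable def deltaXi {p : ℕ} [Fact p.Prime] {A : Type*} [CommRing A]
    (δA : DeltaStructure p A) (x : A) : DeltaStructure p A[X] :=
  polyDelta δA (deltaPoly p (Polynomial.C x) Polynomial.X)

/-- The ring `A⟨ξ/(p)_q⟩_{q^p,y}` with `y = (1 - q) x`: the ring of `q ^ p`-deformed divided power
polynomials in the variable `ω = ξ/(p)_q`. -/
abbrev LevelRing (p : ℕ) (A : Type*) [CommRing A] (q x : A) : Type _ :=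
  QDivPow A (q ^ p) ((1 - q) * x)

/-- The `R`-algebra homomorphism `A[ξ] → A⟨ξ/(p)_q⟩_{q^p,y}` which is the identity on `A` and
sends `ξ` to `(p)_q ω`. -/
noncomputable def xiMap (p : ℕ) (R : Type*) {A : Type*} [CommRing R] [CommRing A] [Algebra R A]
    (q x : A) : A[X] →ₐ[R] LevelRing p A q x :=
  (Polynomial.aeval (qNum q p • QDivPow.dp (q ^ p) ((1 - q) * x) 1)).restrictScalars R

end Objects

/-! Universe levels of the statement. -/

universe w u v

set_option linter.unusedSectionVars false

/-! Put `z = x + (p)_q ω`, the image of `x + ξ`. As `δ x = 0`, the formula for `δ ξ` says exactly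
that `δ (x + ξ) = 0`. So `E` needs a `δ`-structure with `δ z = 0`, whose Frobenius `φ` satisfies `φ
z = z ^ p`.

Existence. Over the universal coefficients `ℤ[q][x]`, with fraction field `K`, the ring `E` embeds
into `K[ω]`, where `φ` and `δ` are available; the point is that `E` is stable under `δ`. Let `σ` be
the `K`-automorphism `z ↦ q ^ p z` and `w = (q - 1) z`. The divided powers satisfy `σ ω^[n+1] =
ω^[n+1] + w ω^[n]`, and `σ` fixes only constants. Hence `f` lies in `E` as soon as `σ f = f + w g`
with `g` in `E` and the value of `f` at `ω = 0` is a coefficient. Since `σ` commutes with `δ`, the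
ring generated by `E` and `δ E` is closed under `f ↦ g` and its values at `ω = 0` are coefficients;
induction on the degree shows that it is `E` (`mem_deltaClosure`, `exists_toPoly_eq`). The structure
passes to any `A` as a section of the length two Witt vectors (`wittSection`), which requires
nothing about `p`-torsion.

Universal property. Write `u ξ = (p)_q β`, let `b` be `ω`, `β` or the pair `(ω, β)` in `E × B`, and
give `δ^k b` the weight `p ^ k`. Applying `δ` repeatedly to `δ (x + (p)_q b) = 0` yields relations
`κ (δ^k b) ^ p ≡ ℓ δ^(k+1) b` modulo lower weight, with `κ`, `ℓ` in `ℤ[q]`, `κ(1)` prime to `p` and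
`ℓ(1)` divisible by `p` exactly once (`WeightRel.succ`). Over `ℤ_p⟦q - 1⟧` the element `κ` is a
unit, so the `A`-algebra generated by the `δ^k b` is spanned by one monomial for each weight `n`,
read off from the digits of `n` in base `p` (`DeltaFilt.exists_digitMon`). In `E` this monomial has
degree `n` in `ω` and a unit as leading coefficient (`coeff_digitMon`). Therefore the subalgebra of
`E × B` generated by the iterates of `(ω, β)` projects bijectively onto `E`: it is the graph of the
required homomorphism. That `B` has no `(p)_q`-torsion is used for uniqueness only, to determine the
image of `ω`. -/

/-! ### Generalities on `δ`-structures -/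

section DeltaGeneral

variable {p : ℕ} {R S T : Type*} [CommRing R] [CommRing S] [CommRing T]

variable [hp : Fact p.Prime]

/-- The Frobenius lift `a ↦ a ^ p + p δ a` of a `δ`-ring. -/
def DeltaStructure.frob (D : DeltaStructure p R) : R →+* R where
  toFun a := a ^ p + p * D.δ a
  map_zero' := by simp [D.map_zero, hp.out.ne_zero]
  map_one' := by simp [D.map_one]
  map_add' a b := by
    rw [D.map_add]
    linear_combination -mul_deltaPoly p a b
  map_mul' a b := by
    rw [D.map_mul]
    ring

theorem DeltaStructure.frob_apply (D : DeltaStructure p R) (a : R) :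
    D.frob a = a ^ p + p * D.δ a := rfl

/-- A lift of Frobenius on a ring without `p`-torsion defines a `δ`-structure. -/
def DeltaStructure.ofFrob (h0 : ∀ a : R, (p : R) * a = 0 → a = 0) (φ : R →+* R)
    (δ : R → R) (h : ∀ a, φ a = a ^ p + p * δ a) : DeltaStructure p R where
  δ := δ
  map_zero := h0 _ <| by
    have e := h 0
    rw [_root_.map_zero, zero_pow hp.out.ne_zero, zero_add] at e
    exact e.symm
  map_one := h0 _ <| by
    have e := h 1
    rw [_root_.map_one, one_pow] at e
    linear_combination -e
  map_mul a b := by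
    have e := h (a * b)
    rw [_root_.map_mul, h a, h b] at e
    exact sub_eq_zero.1 <| h0 _ <| by linear_combination -e
  map_add a b := by
    have e := h (a + b)
    rw [_root_.map_add, h a, h b] at e
    exact sub_eq_zero.1 <| h0 _ <| by linear_combination -e + mul_deltaPoly p a b

/-- The `δ`-structure on a subring stable under `δ`. -/
def DeltaStructure.restrict (D : DeltaStructure p S) (f : R →+* S)
    (hf : Function.Injective f) (δ : R → R) (h : ∀ r, f (δ r) = D.δ (f r)) :
    DeltaStructure p R where
  δ := δ
  map_zero := hf <| by rw [h, _root_.map_zero, D.map_zero]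
  map_one := hf <| by rw [h, _root_.map_one, D.map_one, _root_.map_zero]
  map_mul a b := hf <| by
    simp only [h, _root_.map_mul, D.map_mul, _root_.map_add, map_pow, map_natCast]
  map_add a b := hf <| by
    simp only [h, D.map_add, _root_.map_add, _root_.map_sub, map_deltaPoly]

/-- The product of two `δ`-rings. -/
def DeltaStructure.prod (D : DeltaStructure p R) (D' : DeltaStructure p S) :
    DeltaStructure p (R × S) where
  δ a := (D.δ a.1, D'.δ a.2)
  map_zero := Prod.ext D.map_zero D'.map_zero
  map_one := Prod.ext D.map_one D'.map_one
  map_mul a b := Prod.ext (D.map_mul _ _) (D'.map_mul _ _)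
  map_add a b := by
    have h1 := map_deltaPoly p (RingHom.fst R S) a b
    have h2 := map_deltaPoly p (RingHom.snd R S) a b
    refine Prod.ext ?_ ?_
    · simp only [Prod.fst_add, Prod.fst_sub, D.map_add]; exact congrArg (_ - ·) h1.symm
    · simp only [Prod.snd_add, Prod.snd_sub, D'.map_add]; exact congrArg (_ - ·) h2.symm

/-- Turns compatibility with `δ` into an equality of ring homomorphisms, which can be checked on
generators. -/
theorem isDeltaHom_iff_toWitt {δR : DeltaStructure p R} {δS : DeltaStructure p S} {f : R →+* S} :
    IsDeltaHom δR δS f ↔ (δS.toWitt (RingHom.id S)).comp f = δR.toWitt f := by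
  constructor
  · intro h
    ext r
    · rfl
    · exact h r
  · intro h r
    exact congrArg WittTwo.snd (RingHom.congr_fun h r)

theorem IsDeltaHom.comp {δR : DeltaStructure p R} {δS : DeltaStructure p S}
    {δT : DeltaStructure p T} {g : S →+* T} {f : R →+* S} (hg : IsDeltaHom δS δT g)
    (hf : IsDeltaHom δR δS f) : IsDeltaHom δR δT (g.comp f) := fun r => by
  simp only [RingHom.comp_apply]
  rw [hg, hf]

theorem IsDeltaHom.map_frob {δR : DeltaStructure p R} {δS : DeltaStructure p S} {f : R →+* S}
    (hf : IsDeltaHom δR δS f) (r : R) : f (δR.frob r) = δS.frob (f r) := by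
  simp only [DeltaStructure.frob_apply, map_add, map_mul, map_pow, map_natCast, hf r]

theorem isDeltaHom_int (D : DeltaStructure p ℤ) (δS : DeltaStructure p S) (f : ℤ →+* S) :
    IsDeltaHom D δS f :=
  isDeltaHom_iff_toWitt.2 (RingHom.ext_int _ _)

theorem isDeltaHom_polyDelta {D : DeltaStructure p R} {δS : DeltaStructure p S} {v : R[X]}
    {f : R[X] →+* S} (hC : IsDeltaHom D δS (f.comp Polynomial.C))
    (hX : δS.δ (f Polynomial.X) = f v) : IsDeltaHom (polyDelta D v) δS f := by
  refine isDeltaHom_iff_toWitt.2 (Polynomial.ringHom_ext (fun a => ?_) ?_)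
  · refine WittTwo.ext rfl ?_
    change δS.δ (f (Polynomial.C a)) = f ((polyDelta D v).δ (Polynomial.C a))
    rw [polyDelta_C]
    exact hC a
  · refine WittTwo.ext rfl ?_
    change δS.δ (f Polynomial.X) = f ((polyDelta D v).δ Polynomial.X)
    rw [polyDelta_X, hX]

/-- The functoriality of Witt vectors of length two. -/
noncomputable def WittTwo.map (f : R →+* S) : WittTwo p R →+* WittTwo p S where
  toFun a := ⟨f a.fst, f a.snd⟩
  map_zero' := WittTwo.ext (map_zero f) (map_zero f)
  map_one' := WittTwo.ext (map_one f) (map_zero f)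
  map_add' a b := by
    refine WittTwo.ext (map_add f _ _) ?_
    change f (a.snd + b.snd - deltaPoly p a.fst b.fst) = _
    rw [map_sub, map_add, map_deltaPoly]
    rfl
  map_mul' a b := by
    refine WittTwo.ext (map_mul f _ _) ?_
    change f (a.fst ^ p * b.snd + b.fst ^ p * a.snd + p * a.snd * b.snd) = _
    simp only [map_add, map_mul, map_pow, map_natCast]
    rfl

variable (p) in
/-- The `δ`-structure of `ℤ`. -/
def intDelta : DeltaStructure p ℤ :=
  DeltaStructure.ofFrob (fun a h => by simpa [hp.out.ne_zero] using h) (RingHom.id ℤ)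
    (fun a => (a - a ^ p) / p) fun a => by
    -- Fermat's little theorem.
    have h : (p : ℤ) ∣ a - a ^ p := by
      rw [← ZMod.intCast_zmod_eq_zero_iff_dvd]
      push_cast
      rw [ZMod.pow_card, sub_self]
    rw [Int.mul_ediv_cancel' h, RingHom.id_apply]
    ring

/-- The Frobenius lift is the identity, the only ring endomorphism of `ℤ`. -/
theorem intDelta_spec (a : ℤ) : a = a ^ p + p * (intDelta p).δ a :=
  RingHom.congr_fun (RingHom.ext_int (RingHom.id ℤ) (intDelta p).frob) a

end DeltaGeneral

/-! ### Homomorphisms out of the ring of `q`-deformed divided power polynomials -/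

namespace QDivPow

section Lift

variable {A B : Type*} [CommRing A] [CommRing B] {q y : A}

theorem smul_dp_mul (a b : A) (m n : ℕ) :
    (a • dp q y m) * (b • dp q y n) = (a * b) • (dp q y m * dp q y n) := by
  rw [mul_def, mul_def]
  simp only [map_smul, LinearMap.smul_apply, smul_smul, mul_comm b a]

theorem dp_mul_dp' (m n : ℕ) : dp q y m * dp q y n =
    ∑ i ∈ Finset.range (min m n + 1), mulCoeff q y m n i • dp q y (m + n - i) :=
  mulHom_dp q y m n

theorem algebraMap_apply {S : Type*} [CommSemiring S] [Algebra S A] (s : S) :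
    algebraMap S (QDivPow A q y) s = algebraMap S A s • dp q y 0 := by
  rw [Algebra.algebraMap_eq_smul_one, one_def, algebraMap_smul]

/-- The homomorphism from `A⟨ω⟩_{q,y}` given by `f` on `A` and by the images `h n` of the
divided powers. -/
noncomputable def liftHom (f : A →+* B) (h : ℕ → B) (h0 : h 0 = 1)
    (hmul : ∀ m n, h m * h n =
      ∑ i ∈ Finset.range (min m n + 1), f (mulCoeff q y m n i) * h (m + n - i)) :
    QDivPow A q y →+* B :=
  let g : QDivPow A q y →+ B :=
    (Finsupp.liftAddHom fun n => (AddMonoidHom.mulRight (h n)).comp f.toAddMonoidHom :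
      (ℕ →₀ A) →+ B)
  have hg : ∀ a n, g (a • dp q y n) = f a * h n := fun a n => by
    have e : a • dp q y n = (Finsupp.single n a : ℕ →₀ A) := by
      change a • (Finsupp.single n 1 : ℕ →₀ A) = _
      simp
    rw [e]
    exact (Finsupp.liftAddHom_apply_single _ _ _)
  { g with
    map_one' := by
      have := hg 1 0
      rw [one_smul, map_one, h0, one_mul] at this
      exact this
    map_mul' := fun v w => by
      change g (v * w) = g v * g w
      induction v using dp_induction with
      | h0 => simp
      | hadd v v' h h' => rw [add_mul, map_add, map_add, h, h', add_mul]
      | hdp a m =>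
        induction w using dp_induction with
        | h0 => simp
        | hadd w w' h h' => rw [mul_add, map_add, map_add, h, h', mul_add]
        | hdp b n =>
          rw [smul_dp_mul, dp_mul_dp', hg, hg, Finset.smul_sum, map_sum, mul_mul_mul_comm, hmul,
            Finset.mul_sum]
          refine Finset.sum_congr rfl fun i _ => ?_
          rw [smul_smul, hg, map_mul, map_mul]
          ring }

theorem liftHom_smul_dp (f : A →+* B) (h : ℕ → B) (h0 : h 0 = 1)
    (hmul : ∀ m n, h m * h n =
      ∑ i ∈ Finset.range (min m n + 1), f (mulCoeff q y m n i) * h (m + n - i)) (a : A) (n : ℕ) :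
    liftHom f h h0 hmul (a • dp q y n) = f a * h n := by
  have e : a • dp q y n = (Finsupp.single n a : ℕ →₀ A) := by
    change a • (Finsupp.single n 1 : ℕ →₀ A) = _
    simp
  rw [e]
  exact (Finsupp.liftAddHom_apply_single
    (fun n => (AddMonoidHom.mulRight (h n)).comp f.toAddMonoidHom) _ _)

theorem smul_eq_algebraMap_mul (a : A) (v : QDivPow A q y) :
    a • v = algebraMap A (QDivPow A q y) a * v := Algebra.smul_def a v

theorem ringHom_ext {f g : QDivPow A q y →+* B}
    (hC : ∀ a : A, f (algebraMap A _ a) = g (algebraMap A _ a))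
    (hdp : ∀ n, f (dp q y n) = g (dp q y n)) : f = g := by
  ext v
  induction v using dp_induction with
  | h0 => simp
  | hadd v v' h h' => rw [map_add, map_add, h, h']
  | hdp a m => rw [smul_eq_algebraMap_mul, map_mul, map_mul, hC, hdp]

variable {q' y' : B}

/-- Change of coefficients. -/
noncomputable def mapHom (f : A →+* B) (hq : f q = q') (hy : f y = y') :
    QDivPow A q y →+* QDivPow B q' y' :=
  liftHom ((algebraMap B (QDivPow B q' y')).comp f) (dp q' y') rfl fun m n => by
    rw [dp_mul_dp']
    refine Finset.sum_congr rfl fun i _ => ?_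
    rw [RingHom.comp_apply, map_mulCoeff, hq, hy, smul_eq_algebraMap_mul]

theorem mapHom_smul_dp (f : A →+* B) (hq : f q = q') (hy : f y = y') (a : A) (n : ℕ) :
    mapHom f hq hy (a • dp q y n) = f a • dp q' y' n := by
  rw [mapHom, liftHom_smul_dp, RingHom.comp_apply, smul_eq_algebraMap_mul]

theorem mapHom_dp (f : A →+* B) (hq : f q = q') (hy : f y = y') (n : ℕ) :
    mapHom f hq hy (dp q y n) = dp q' y' n := by
  have := mapHom_smul_dp f hq hy 1 n
  rwa [one_smul, map_one, one_smul] at this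

theorem mapHom_algebraMap (f : A →+* B) (hq : f q = q') (hy : f y = y') (a : A) :
    mapHom f hq hy (algebraMap A _ a) = algebraMap B _ (f a) := by
  rw [algebraMap_apply, mapHom_smul_dp, algebraMap_apply]
  rfl

end Lift

/-! ### Degrees and leading coefficients -/

section Degree

variable {A B : Type*} [CommRing A] [CommRing B] {q y : A}

/-- The coefficient of `ω^[n]`. -/
noncomputable def coeff (n : ℕ) : QDivPow A q y →ₗ[A] A := (basis q y).coord n

theorem coeff_dp (m n : ℕ) : coeff n (dp q y m) = if m = n then 1 else 0 := by
  rw [coeff, Module.Basis.coord_apply, dp, Module.Basis.repr_self, Finsupp.single_apply]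

theorem ext_coeff {v w : QDivPow A q y} (h : ∀ n, coeff n v = coeff n w) : v = w :=
  (basis q y).ext_elem h

/-- Elements of degree at most `n`. -/
def DegLE (n : ℕ) (v : QDivPow A q y) : Prop := ∀ m, n < m → coeff m v = 0

theorem exists_degLE (v : QDivPow A q y) : ∃ n, DegLE n v := by
  refine ⟨((basis q y).repr v).support.sup id, fun m hm => ?_⟩
  by_contra h
  have h1 : m ∈ ((basis q y).repr v).support := Finsupp.mem_support_iff.2 h
  have h2 : m ≤ ((basis q y).repr v).support.sup id := Finset.le_sup (f := id) h1
  omega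

theorem DegLE.eq_sum {n : ℕ} {v : QDivPow A q y} (h : DegLE n v) :
    v = ∑ i ∈ Finset.range (n + 1), coeff i v • dp q y i := by
  refine ext_coeff fun m => ?_
  rw [map_sum]
  simp only [map_smul, coeff_dp, smul_eq_mul, mul_ite, mul_one, mul_zero, Finset.sum_ite_eq',
    Finset.mem_range]
  split_ifs with hm
  · rfl
  · exact h m (by omega)

theorem degLE_dp (n : ℕ) : DegLE n (dp q y n) := fun m hm => by
  rw [coeff_dp, if_neg (by omega)]

theorem DegLE.mono {m n : ℕ} (h : m ≤ n) {v : QDivPow A q y} (hv : DegLE m v) : DegLE n v :=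
  fun k hk => hv k (by omega)

/-- Only the summand of index `0` in the multiplication rule reaches the top degree. -/
theorem coeff_dp_mul_dp {i j m : ℕ} (h : i + j ≤ m) :
    coeff m (dp q y i * dp q y j) = if i + j = m then qBinom q (i + j) i else 0 := by
  rw [dp_mul_dp', map_sum, Finset.sum_range_succ']
  rw [Finset.sum_eq_zero]
  · simp only [map_smul, coeff_dp, smul_eq_mul, mul_ite, mul_one, mul_zero]
    simp [mulCoeff, qBinom_zero_right]
  · intro k hk
    rw [Finset.mem_range] at hk
    rw [map_smul, coeff_dp, if_neg (by omega), smul_zero]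

theorem DegLE.coeff_mul {m n : ℕ} {v w : QDivPow A q y} (hv : DegLE m v) (hw : DegLE n w) :
    coeff (m + n) (v * w) = qBinom q (m + n) m * coeff m v * coeff n w := by
  conv_lhs => rw [hv.eq_sum, hw.eq_sum]
  rw [Finset.sum_mul_sum, map_sum, Finset.sum_eq_single_of_mem m (by simp), map_sum,
    Finset.sum_eq_single_of_mem n (by simp)]
  · rw [smul_dp_mul, map_smul, coeff_dp_mul_dp le_rfl, if_pos rfl, smul_eq_mul]
    ring
  · intro j hj hj'
    rw [Finset.mem_range] at hj
    rw [smul_dp_mul, map_smul, coeff_dp_mul_dp (by omega), if_neg (by omega), smul_zero]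
  · intro i hi hi'
    rw [Finset.mem_range] at hi
    rw [map_sum]
    refine Finset.sum_eq_zero fun j hj => ?_
    rw [Finset.mem_range] at hj
    rw [smul_dp_mul, map_smul, coeff_dp_mul_dp (by omega), if_neg (by omega), smul_zero]

theorem DegLE.mul {m n : ℕ} {v w : QDivPow A q y} (hv : DegLE m v) (hw : DegLE n w) :
    DegLE (m + n) (v * w) := by
  intro k hk
  rw [hv.eq_sum, hw.eq_sum, Finset.sum_mul_sum, map_sum]
  refine Finset.sum_eq_zero fun i hi => ?_
  rw [map_sum]
  refine Finset.sum_eq_zero fun j hj => ?_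
  rw [Finset.mem_range] at hi hj
  rw [smul_dp_mul, map_smul, coeff_dp_mul_dp (by omega), if_neg (by omega), smul_zero]

theorem DegLE.add {n : ℕ} {v w : QDivPow A q y} (hv : DegLE n v) (hw : DegLE n w) :
    DegLE n (v + w) := fun m hm => by rw [map_add, hv m hm, hw m hm, add_zero]

theorem degLE_algebraMap (a : A) : DegLE 0 (algebraMap A (QDivPow A q y) a) := fun m hm => by
  rw [algebraMap_apply, map_smul, degLE_dp 0 m hm, smul_zero]

theorem coeff_mapHom {q' y' : B} (f : A →+* B) (hq : f q = q') (hy : f y = y') (n : ℕ)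
    (v : QDivPow A q y) : coeff n (mapHom f hq hy v) = f (coeff n v) := by
  induction v using dp_induction with
  | h0 => simp
  | hadd v v' h h' => simp only [map_add, h, h']
  | hdp a m =>
    rw [mapHom_smul_dp, map_smul, map_smul, coeff_dp, coeff_dp, smul_eq_mul, smul_eq_mul, map_mul]
    split_ifs <;> simp

end Degree

end QDivPow

/-! ### The `δ`-structure over a ring of coefficients contained in a field -/

section QNum

variable {A : Type*} [CommRing A]

theorem qNum_zero (q : A) : qNum q 0 = 0 := by simp [qNum]

theorem qNum_one (q : A) : qNum q 1 = 1 := by simp [qNum]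

theorem sub_one_mul_qNum (q : A) (n : ℕ) : (q - 1) * qNum q n = q ^ n - 1 := by
  rw [qNum, mul_comm, geom_sum_mul]

theorem qNum_succ' (q : A) (n : ℕ) : qNum q (n + 1) = 1 + q * qNum q n := by
  rw [add_comm n 1, qNum_add, qNum_one, pow_one]

theorem qNum_succ (q : A) (n : ℕ) : qNum q (n + 1) = qNum q n + q ^ n := by
  rw [qNum_add, qNum_one, mul_one]

/-- Every term of `deltaPoly` contains its second argument to a positive power, so one factor `b`
can be extracted without leaving the subring. -/
theorem deltaPoly_mul_mem (p : ℕ) (S : Subring A) {a b c : A} (ha : a ∈ S) (hb : b ∈ S)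
    (hc : c ∈ S) : ∃ g ∈ S, deltaPoly p a (b * c) = b * g := by
  refine ⟨∑ i ∈ Finset.Ico 1 p, ((p.choose i / p : ℕ) : A) * a ^ (p - i) * (b ^ (i - 1) * c ^ i),
    Subring.sum_mem _ fun i _ => S.mul_mem (S.mul_mem (natCast_mem S _) (S.pow_mem ha _))
      (S.mul_mem (S.pow_mem hb _) (S.pow_mem hc _)), ?_⟩
  rw [deltaPoly, Finset.mul_sum]
  refine Finset.sum_congr rfl fun i hi => ?_
  rw [Finset.mem_Ico] at hi
  obtain ⟨j, rfl⟩ : ∃ j, i = j + 1 := ⟨i - 1, by omega⟩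
  rw [mul_pow, Nat.add_sub_cancel, pow_succ b]
  ring

end QNum

namespace QDivPow

open Polynomial

/-! ### The twisted difference calculus of `σ : z ↦ q ^ p z` on `K[ω]` -/

section Model

variable {p : ℕ} [hp : Fact p.Prime] {L K : Type*} [CommRing L] [Field K]

variable (p) in
/-- The element `z = x + (p)_q ω`. -/
noncomputable def zPoly (q x : K) : K[X] := C x + C (qNum q p) * X

variable (p) in
/-- The element `(q - 1) z`. -/
noncomputable def wPoly (q x : K) : K[X] := C (q - 1) * zPoly p q x

variable (p) in
/-- The automorphism `z ↦ q ^ p z`. -/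
noncomputable def shiftHom (q x : K) : K[X] →+* K[X] :=
  eval₂RingHom C (X + wPoly p q x)

theorem shiftHom_C (q x a : K) : shiftHom p q x (C a) = C a := by simp [shiftHom]

theorem shiftHom_X (q x : K) : shiftHom p q x X = X + wPoly p q x := by simp [shiftHom]

theorem shiftHom_eq_comp (q x : K) (f : K[X]) :
    shiftHom p q x f = f.comp (X + wPoly p q x) := rfl

theorem shiftHom_z (q x : K) : shiftHom p q x (zPoly p q x) = C (q ^ p) * zPoly p q x := by
  have h : C (q ^ p) = C (q - 1) * C (qNum q p) + (1 : K[X]) := by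
    rw [← map_mul, sub_one_mul_qNum, map_sub, map_one, sub_add_cancel]
  rw [h]
  conv_lhs => rw [zPoly, map_add, map_mul, shiftHom_C, shiftHom_C, shiftHom_X, wPoly]
  rw [zPoly]
  ring

/-- The value `y = (1 - q) x` is what makes `σ` carry each factor of a twisted power to a multiple
of the preceding factor. -/
theorem shiftHom_linear (q x : K) (n : ℕ) :
    shiftHom p q x (X + C (qNum (q ^ p) (n + 1) * ((1 - q) * x))) =
      C (q ^ p) * (X + C (qNum (q ^ p) n * ((1 - q) * x))) := by
  have h : C (q ^ p) = C (q - 1) * C (qNum q p) + (1 : K[X]) := by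
    rw [← map_mul, sub_one_mul_qNum, map_sub, map_one, sub_add_cancel]
  rw [map_add, shiftHom_C, shiftHom_X, qNum_succ', wPoly, zPoly]
  simp only [map_mul, map_add, map_sub, map_one] at h ⊢
  linear_combination (-X) * h

/-- All factors move down by one index; only the factor `ω` of index `0` produces something new,
namely `ω + w`. -/
theorem shiftHom_twPow (q x : K) (n : ℕ) :
    shiftHom p q x (twPow (q ^ p) ((1 - q) * x) (n + 1)) =
      C (q ^ p) ^ n * (X + wPoly p q x) * twPow (q ^ p) ((1 - q) * x) n := by
  induction n with
  | zero => simp [twPow, qNum, shiftHom_X]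
  | succ n ih =>
    rw [twPow_succ, map_mul, ih, shiftHom_linear, twPow_succ]
    ring

/-- A twisted derivative rule: divided by the `q`-factorial, it makes `(σ - 1) / w` lower the index
of a divided power by one (`shiftHom_γ`). -/
theorem shiftHom_twPow' (q x : K) (n : ℕ) :
    shiftHom p q x (twPow (q ^ p) ((1 - q) * x) (n + 1)) =
      twPow (q ^ p) ((1 - q) * x) (n + 1) +
        wPoly p q x * (C (qNum (q ^ p) (n + 1)) * twPow (q ^ p) ((1 - q) * x) n) := by
  have h : C (q ^ p) = C (q - 1) * C (qNum q p) + (1 : K[X]) := by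
    rw [← map_mul, sub_one_mul_qNum, map_sub, map_one, sub_add_cancel]
  have h' : C (q ^ p) ^ n = (C (q ^ p) - 1) * C (qNum (q ^ p) n) + (1 : K[X]) := by
    rw [← map_one C, ← map_sub, ← map_mul, sub_one_mul_qNum, ← map_pow, map_sub, sub_add_cancel]
  rw [shiftHom_twPow, twPow_succ, qNum_succ, wPoly, zPoly]
  simp only [map_mul, map_add, map_sub, map_one] at h h' ⊢
  rw [map_pow C (q ^ p) n]
  linear_combination (twPow (q ^ p) ((1 - q) * x) n) * X * (h' + C (qNum (q ^ p) n) * h)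

/-- Coefficients in `L` and a Frobenius lift on the ambient field `K`. -/
structure ModelData (p : ℕ) (L K : Type*) [CommRing L] [Field K] [Fact p.Prime] where
  /-- The `δ`-structure of the coefficients. -/
  D : DeltaStructure p L
  /-- The embedding of the coefficients. -/
  i : L →+* K
  /-- The endomorphism of the field. -/
  φ : K →+* K
  /-- The element `q`. -/
  q : L
  /-- The element `x`. -/
  x : L
  i_injective : Function.Injective i
  comm : ∀ a, φ (i a) = i (D.frob a)
  δq : D.δ q = 0
  δx : D.δ x = 0
  qNum_ne_zero : ∀ n, qNum (i q) (n + 1) ≠ 0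
  q_ne_one : i q ≠ 1
  q_ne_zero : i q ≠ 0
  natCast_ne_zero : (p : K) ≠ 0

namespace ModelData

variable (M : ModelData p L K)

/-- The ring of divided powers over the coefficients. -/
abbrev E : Type _ := QDivPow L (M.q ^ p) ((1 - M.q) * M.x)

/-- The element `q` of the field. -/
def Q : K := M.i M.q

/-- The element `x` of the field. -/
def x' : K := M.i M.x

theorem φ_Q : M.φ M.Q = M.Q ^ p := by
  rw [Q, M.comm, DeltaStructure.frob_apply, M.δq, mul_zero, add_zero, map_pow]

theorem φ_x' : M.φ M.x' = M.x' ^ p := by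
  rw [x', M.comm, DeltaStructure.frob_apply, M.δx, mul_zero, add_zero, map_pow]

theorem qNum_Q_p_ne_zero : qNum M.Q p ≠ 0 := by
  have h := M.qNum_ne_zero (p - 1)
  rwa [Nat.sub_add_cancel hp.out.one_le] at h

theorem pow_ne_one {n : ℕ} (hn : n ≠ 0) : (M.Q ^ p) ^ n ≠ 1 := by
  rw [← pow_mul]
  obtain ⟨k, hk⟩ : ∃ k, p * n = k + 1 :=
    ⟨p * n - 1, by have := Nat.mul_pos hp.out.pos (Nat.pos_of_ne_zero hn); omega⟩
  rw [hk]
  intro h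
  have h1 := sub_one_mul_qNum M.Q (k + 1)
  rw [h, sub_self] at h1
  exact mul_ne_zero (sub_ne_zero.2 M.q_ne_one) (M.qNum_ne_zero k) h1

theorem qNum_pow_ne_zero (n : ℕ) : qNum (M.Q ^ p) (n + 1) ≠ 0 := by
  intro h
  have h1 := sub_one_mul_qNum (M.Q ^ p) (n + 1)
  rw [h, mul_zero] at h1
  exact M.pow_ne_one n.succ_ne_zero (sub_eq_zero.1 h1.symm)

/-- The Frobenius lift of `K[ω]`. -/
noncomputable def Φ : K[X] →+* K[X] :=
  -- The image of `ω` is forced by `φ z = z ^ p`, because `φ x = x ^ p` and `φ` sends `(p)_q` to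
  -- `(p)_{q^p}`.
  eval₂RingHom (C.comp M.φ) (C (qNum (M.Q ^ p) p)⁻¹ * (zPoly p M.Q M.x' ^ p - C M.x' ^ p))

theorem Φ_C (a : K) : M.Φ (C a) = C (M.φ a) := by simp [Φ]

theorem Φ_X : M.Φ X = C (qNum (M.Q ^ p) p)⁻¹ * (zPoly p M.Q M.x' ^ p - C M.x' ^ p) := by
  simp [Φ]

theorem qNum_Q_pow_p_ne_zero : qNum (M.Q ^ p) p ≠ 0 := by
  have h : M.φ (qNum M.Q p) = qNum (M.Q ^ p) p := by rw [map_qNum, φ_Q]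
  rw [← h]
  exact (map_ne_zero M.φ).2 M.qNum_Q_p_ne_zero

theorem Φ_z : M.Φ (zPoly p M.Q M.x') = zPoly p M.Q M.x' ^ p := by
  conv_lhs => rw [zPoly, map_add, map_mul, Φ_C, Φ_C, Φ_X, φ_x', map_qNum, φ_Q]
  rw [← mul_assoc, ← map_mul, mul_inv_cancel₀ M.qNum_Q_pow_p_ne_zero, map_one, one_mul, map_pow]
  ring

/-- Here `φ w = (q ^ p - 1) z ^ p`. That it is a multiple of `w`, with cofactor in the divided power
ring, is what keeps `δ (w e)` divisible by `w`. -/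
theorem Φ_w : M.Φ (wPoly p M.Q M.x') =
    wPoly p M.Q M.x' * (C (qNum M.Q p) * zPoly p M.Q M.x' ^ (p - 1)) := by
  have h : zPoly p M.Q M.x' ^ p = zPoly p M.Q M.x' * zPoly p M.Q M.x' ^ (p - 1) := by
    rw [← pow_succ', Nat.sub_add_cancel hp.out.one_le]
  conv_lhs => rw [wPoly, map_mul, Φ_z, Φ_C, map_sub, map_one, φ_Q, ← sub_one_mul_qNum, h]
  rw [wPoly, map_mul]
  ring

theorem X_eq : (X : K[X]) = C (qNum M.Q p)⁻¹ * (zPoly p M.Q M.x' - C M.x') := by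
  rw [zPoly, add_sub_cancel_left, ← mul_assoc, ← map_mul, inv_mul_cancel₀ M.qNum_Q_p_ne_zero,
    map_one, one_mul]

/-- As `(p)_q` is invertible in `K`, the element `z` generates `K[ω]`; on `z` both `φ` and `σ` have
monomial form. -/
theorem ringHom_ext_z {B : Type*} [CommRing B] {f g : K[X] →+* B} (hC : ∀ a, f (C a) = g (C a))
    (hz : f (zPoly p M.Q M.x') = g (zPoly p M.Q M.x')) : f = g := by
  refine Polynomial.ringHom_ext hC ?_
  rw [M.X_eq, map_mul, map_mul, map_sub, map_sub, hC, hC, hz]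

/-- Both composites send `z` to `q ^ (p ^ 2) z ^ p`. -/
theorem Φ_shiftHom (f : K[X]) :
    M.Φ (shiftHom p M.Q M.x' f) = shiftHom p M.Q M.x' (M.Φ f) := by
  refine RingHom.congr_fun (f := M.Φ.comp (shiftHom p M.Q M.x'))
    (g := (shiftHom p M.Q M.x').comp M.Φ) (M.ringHom_ext_z (fun a => ?_) ?_) f
  · simp only [RingHom.comp_apply, shiftHom_C, Φ_C]
  · simp only [RingHom.comp_apply, shiftHom_z, Φ_z, map_mul, map_pow, Φ_C, φ_Q]
    ring

/-- At `ω = 0` the element `z` becomes `x`, and `φ x = x ^ p`. -/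
theorem eval_Φ (f : K[X]) : (M.Φ f).eval 0 = M.φ (f.eval 0) := by
  refine RingHom.congr_fun (f := (evalRingHom 0).comp M.Φ)
    (g := M.φ.comp (evalRingHom 0)) (M.ringHom_ext_z (fun a => ?_) ?_) f
  · simp [Φ_C]
  · simp only [RingHom.comp_apply, Φ_z, coe_evalRingHom, eval_pow]
    simp [zPoly, φ_x']

/-- The `δ`-structure of `K[ω]`. -/
noncomputable def polyDelta : DeltaStructure p K[X] :=
  DeltaStructure.ofFrob (fun a h => by
      have h0 : (p : K[X]) ≠ 0 := by
        rw [← map_natCast (C : K →+* K[X])]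
        exact C_ne_zero.2 M.natCast_ne_zero
      exact (mul_eq_zero.1 h).resolve_left h0) M.Φ
    (fun f => C (p : K)⁻¹ * (M.Φ f - f ^ p)) fun f => by
      rw [← map_natCast (C : K →+* K[X]) p, ← mul_assoc, ← map_mul,
        mul_inv_cancel₀ M.natCast_ne_zero, map_one, one_mul]
      ring

theorem polyDelta_apply (f : K[X]) : M.polyDelta.δ f = C (p : K)⁻¹ * (M.Φ f - f ^ p) := rfl

theorem Φ_eq (f : K[X]) : M.Φ f = f ^ p + p * M.polyDelta.δ f := by
  rw [polyDelta_apply, ← map_natCast (C : K →+* K[X]) p, ← mul_assoc, ← map_mul,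
    mul_inv_cancel₀ M.natCast_ne_zero, map_one, one_mul]
  ring

theorem polyDelta_z : M.polyDelta.δ (zPoly p M.Q M.x') = 0 := by
  rw [polyDelta_apply, Φ_z, sub_self, mul_zero]

theorem polyDelta_shiftHom (f : K[X]) :
    M.polyDelta.δ (shiftHom p M.Q M.x' f) = shiftHom p M.Q M.x' (M.polyDelta.δ f) := by
  simp only [polyDelta_apply, map_mul, map_sub, map_pow, Φ_shiftHom, shiftHom_C]

theorem inv_mul_frob (a : L) : (p : K)⁻¹ * (M.φ (M.i a) - M.i a ^ p) = M.i (M.D.δ a) := by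
  rw [M.comm, DeltaStructure.frob_apply, map_add, map_pow, map_mul, map_natCast,
    add_sub_cancel_left, ← mul_assoc, inv_mul_cancel₀ M.natCast_ne_zero, one_mul]

theorem eval_polyDelta {f : K[X]} (hf : f.eval 0 ∈ M.i.range) :
    (M.polyDelta.δ f).eval 0 ∈ M.i.range := by
  obtain ⟨a, ha⟩ := hf
  refine ⟨M.D.δ a, ?_⟩
  rw [polyDelta_apply, eval_mul, eval_C, eval_sub, eval_pow, eval_Φ, ← ha, inv_mul_frob]

theorem isDeltaHom_C : IsDeltaHom M.D M.polyDelta (C.comp M.i) := fun a => by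
  rw [RingHom.comp_apply, RingHom.comp_apply, polyDelta_apply, Φ_C, ← map_pow, ← map_sub,
    ← map_mul, inv_mul_frob]

/-- The divided powers as polynomials. -/
noncomputable def γ (n : ℕ) : K[X] :=
  C (qFact (M.Q ^ p) n)⁻¹ * twPow (M.Q ^ p) ((1 - M.Q) * M.x') n

theorem γ_zero : M.γ 0 = 1 := by simp [γ, qFact, twPow]

theorem shiftHom_γ (n : ℕ) : shiftHom p M.Q M.x' (M.γ (n + 1)) =
    M.γ (n + 1) + wPoly p M.Q M.x' * M.γ n := by
  have h := M.qNum_pow_ne_zero n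
  have e : C (qFact (M.Q ^ p) (n + 1))⁻¹ * C (qNum (M.Q ^ p) (n + 1)) =
      (C (qFact (M.Q ^ p) n)⁻¹ : K[X]) := by
    rw [← map_mul, qFact_succ, mul_inv, mul_assoc, inv_mul_cancel₀ h, mul_one]
  rw [γ, map_mul, shiftHom_C, shiftHom_twPow', γ]
  linear_combination wPoly p M.Q M.x' * twPow (M.Q ^ p) ((1 - M.Q) * M.x') n * e

theorem eval_γ_succ (n : ℕ) : (M.γ (n + 1)).eval 0 = 0 := by
  rw [γ, eval_mul, twPow, eval_prod, Finset.prod_eq_zero (Finset.mem_range.2 n.succ_pos) (by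
    simp [qNum_zero]), mul_zero]

/-- The embedding of the ring of divided powers into `K[ω]`. -/
noncomputable def toPoly : M.E →+* K[X] :=
  liftHom (C.comp M.i) M.γ M.γ_zero fun m n => by
    have h := toPoly_mulHom_dp (M.Q ^ p) ((1 - M.Q) * M.x') M.qNum_pow_ne_zero m n
    rw [QDivPow.toPoly_dp, QDivPow.toPoly_dp] at h
    rw [γ, γ, ← h, mulHom_dp, dpMul, map_sum]
    refine Finset.sum_congr rfl fun k _ => ?_
    rw [map_smul, QDivPow.toPoly_dp, smul_eq_C_mul, RingHom.comp_apply, map_mulCoeff M.i,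
      map_mul M.i, map_pow M.i, map_sub M.i, map_one M.i]
    rfl

theorem toPoly_smul_dp (a : L) (n : ℕ) : M.toPoly (a • dp _ _ n) = C (M.i a) * M.γ n :=
  liftHom_smul_dp _ _ _ _ a n

theorem toPoly_algebraMap (a : L) : M.toPoly (algebraMap L _ a) = C (M.i a) := by
  rw [algebraMap_apply, toPoly_smul_dp, γ_zero, mul_one]
  rfl

theorem toPoly_z : M.toPoly (algebraMap L _ M.x + qNum M.q p • dp _ _ 1) =
    zPoly p M.Q M.x' := by
  rw [map_add, toPoly_algebraMap, toPoly_smul_dp, zPoly, map_qNum]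
  simp [γ, qFact, twPow, qNum_zero, qNum_one, Q, x']

theorem natDegree_γ (n : ℕ) : (M.γ n).natDegree = n := by
  refine natDegree_eq_of_degree_eq_some ?_
  rw [γ, degree_C_mul (inv_ne_zero (qFact_ne_zero _ M.qNum_pow_ne_zero n)), twPow_degree]

theorem natDegree_toPoly_le {n : ℕ} {e : M.E} (h : DegLE n e) : (M.toPoly e).natDegree ≤ n := by
  rw [h.eq_sum, map_sum]
  refine natDegree_sum_le_of_forall_le _ _ fun i hi => ?_
  rw [Finset.mem_range] at hi
  rw [toPoly_smul_dp]
  refine (natDegree_C_mul_le _ _).trans ?_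
  rw [natDegree_γ]
  omega

/-- `γ n` has degree exactly `n`, so a top coefficient of `e` that maps to zero is itself zero; one
descends from any bound on the degree of `e`. -/
theorem degLE_of_natDegree_le {n : ℕ} {e : M.E} (h : (M.toPoly e).natDegree ≤ n) :
    DegLE n e := by
  obtain ⟨k, hk⟩ := exists_degLE e
  induction k with
  | zero => exact hk.mono n.zero_le
  | succ k ih =>
    by_cases hn : k + 1 ≤ n
    · exact hk.mono hn
    refine ih fun m hm => ?_
    rcases Nat.lt_or_ge (k + 1) m with h' | h'
    · exact hk m h'
    obtain rfl : m = k + 1 := by omega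
    have h1 : (M.toPoly e).coeff (k + 1) = 0 := coeff_eq_zero_of_natDegree_lt (by omega)
    rw [hk.eq_sum, map_sum, Finset.sum_range_succ, Polynomial.coeff_add,
      toPoly_smul_dp, Polynomial.coeff_C_mul] at h1
    rw [coeff_eq_zero_of_natDegree_lt, zero_add] at h1
    · have h2 : (M.γ (k + 1)).coeff (k + 1) ≠ 0 := by
        refine coeff_ne_zero_of_eq_degree ?_
        rw [γ, degree_C_mul (inv_ne_zero (qFact_ne_zero _ M.qNum_pow_ne_zero _)), twPow_degree]
      have h3 := (mul_eq_zero.1 h1).resolve_right h2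
      exact M.i_injective (by rw [h3, map_zero])
    · refine Nat.lt_succ_of_le (natDegree_sum_le_of_forall_le _ _ fun i hi => ?_)
      rw [Finset.mem_range] at hi
      rw [toPoly_smul_dp]
      refine (natDegree_C_mul_le _ _).trans ?_
      rw [natDegree_γ]
      omega

theorem toPoly_injective : Function.Injective M.toPoly := by
  rw [injective_iff_map_eq_zero]
  intro e he
  have h : DegLE 0 e := M.degLE_of_natDegree_le (by rw [he, natDegree_zero])
  have h1 := h.eq_sum
  rw [Finset.sum_range_one] at h1
  rw [h1, toPoly_smul_dp, γ_zero, mul_one, C_eq_zero] at he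
  rw [h1, M.i_injective (he.trans (map_zero _).symm), zero_smul]

/-- Integration: replace each `ω^[n]` by `ω^[n+1]`, which vanishes at `ω = 0`. -/
theorem exists_shift (e : M.E) : ∃ e' : M.E,
    shiftHom p M.Q M.x' (M.toPoly e') = M.toPoly e' + wPoly p M.Q M.x' * M.toPoly e ∧
      (M.toPoly e').eval 0 = 0 := by
  induction e using dp_induction with
  | h0 => exact ⟨0, by simp⟩
  | hadd v w hv hw =>
    obtain ⟨v', h1, h2⟩ := hv
    obtain ⟨w', h3, h4⟩ := hw
    refine ⟨v' + w', ?_, ?_⟩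
    · simp only [map_add, h1, h3]; ring
    · rw [map_add, eval_add, h2, h4, add_zero]
  | hdp a n =>
    refine ⟨a • dp _ _ (n + 1), ?_, ?_⟩
    · rw [toPoly_smul_dp, toPoly_smul_dp, map_mul, shiftHom_C, shiftHom_γ]; ring
    · rw [toPoly_smul_dp, eval_mul, eval_γ_succ, mul_zero]

/-- Differentiation: replace each `ω^[n+1]` by `ω^[n]` and drop the constant term. -/
theorem exists_derivation (e : M.E) : ∃ e' : M.E,
    shiftHom p M.Q M.x' (M.toPoly e) = M.toPoly e + wPoly p M.Q M.x' * M.toPoly e' := by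
  induction e using dp_induction with
  | h0 => exact ⟨0, by simp⟩
  | hadd v w hv hw =>
    obtain ⟨v', h1⟩ := hv
    obtain ⟨w', h3⟩ := hw
    refine ⟨v' + w', ?_⟩
    simp only [map_add, h1, h3]; ring
  | hdp a n =>
    rcases n with _ | n
    · refine ⟨0, ?_⟩
      rw [toPoly_smul_dp, γ_zero, mul_one, shiftHom_C, map_zero, mul_zero, add_zero]
    · refine ⟨a • dp _ _ n, ?_⟩
      rw [toPoly_smul_dp, toPoly_smul_dp, map_mul, shiftHom_C, shiftHom_γ]; ring

theorem eval_toPoly (e : M.E) : (M.toPoly e).eval 0 ∈ M.i.range := by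
  induction e using dp_induction with
  | h0 => rw [map_zero, eval_zero]; exact zero_mem _
  | hadd v w hv hw => rw [map_add, eval_add]; exact add_mem hv hw
  | hdp a n =>
    rcases n with _ | n
    · exact ⟨a, by rw [toPoly_smul_dp, γ_zero, mul_one, eval_C]⟩
    · rw [toPoly_smul_dp, eval_mul, eval_γ_succ, mul_zero]; exact zero_mem _

/-- The subring generated by the divided powers and their images under `δ`. -/
noncomputable def deltaClosure : Subring K[X] :=
  Subring.closure (Set.range M.toPoly ∪ Set.range fun e => M.polyDelta.δ (M.toPoly e))

theorem toPoly_mem (e : M.E) : M.toPoly e ∈ M.deltaClosure :=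
  Subring.subset_closure (Or.inl ⟨e, rfl⟩)

theorem polyDelta_mem (e : M.E) : M.polyDelta.δ (M.toPoly e) ∈ M.deltaClosure :=
  Subring.subset_closure (Or.inr ⟨e, rfl⟩)

theorem C_mem (a : L) : C (M.i a) ∈ M.deltaClosure := by
  rw [← toPoly_algebraMap]
  exact M.toPoly_mem _

theorem z_mem : zPoly p M.Q M.x' ∈ M.deltaClosure := by
  rw [← toPoly_z]
  exact M.toPoly_mem _

theorem w_mem : wPoly p M.Q M.x' ∈ M.deltaClosure := by
  refine mul_mem ?_ M.z_mem
  have := M.C_mem (M.q - 1)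
  rwa [map_sub, map_one] at this

/-- Since `δ z = 0`, only `z ^ p δ (q - 1)` survives in `δ w`; and `δ (q - 1)` is `deltaPoly p 1 (q
- 1)`, a multiple of `q - 1`. -/
theorem polyDelta_w_mem :
    ∃ g ∈ M.deltaClosure, M.polyDelta.δ (wPoly p M.Q M.x') = wPoly p M.Q M.x' * g := by
  have h1 : M.D.δ (M.q - 1) = deltaPoly p 1 (M.q - 1) := by
    have h := M.D.map_add 1 (M.q - 1)
    rw [add_sub_cancel, M.δq, M.D.map_one] at h
    linear_combination -h
  obtain ⟨g, -, hg⟩ := deltaPoly_mul_mem p (⊤ : Subring L) (a := 1) (b := M.q - 1) (c := 1)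
    trivial trivial trivial
  rw [mul_one] at hg
  have h2 := M.isDeltaHom_C (M.q - 1)
  rw [h1, hg, RingHom.comp_apply, RingHom.comp_apply] at h2
  have h3 : zPoly p M.Q M.x' ^ p = zPoly p M.Q M.x' * zPoly p M.Q M.x' ^ (p - 1) := by
    rw [← pow_succ', Nat.sub_add_cancel hp.out.one_le]
  refine ⟨C (M.i g) * zPoly p M.Q M.x' ^ (p - 1), mul_mem (M.C_mem _) (pow_mem M.z_mem _), ?_⟩
  have h4 : C (M.Q - 1) = C (M.i (M.q - 1)) := by rw [map_sub M.i, map_one M.i]; rfl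
  rw [wPoly, h4, M.polyDelta.map_mul, polyDelta_z, h2, h3, map_mul M.i, map_mul C]
  ring

/-- The two properties that characterise the divided power ring inside `K[ω]` pass to the larger
ring generated by it and its image under `δ`. -/
theorem mem_deltaClosure {f : K[X]} (hf : f ∈ M.deltaClosure) :
    (∃ g ∈ M.deltaClosure, shiftHom p M.Q M.x' f = f + wPoly p M.Q M.x' * g) ∧
      f.eval 0 ∈ M.i.range := by
  induction hf using Subring.closure_induction with
  | mem f hf =>
    rcases hf with ⟨e, rfl⟩ | ⟨e, rfl⟩
    · obtain ⟨e', he'⟩ := M.exists_derivation e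
      exact ⟨⟨_, M.toPoly_mem e', he'⟩, M.eval_toPoly e⟩
    · refine ⟨?_, M.eval_polyDelta (M.eval_toPoly e)⟩
      obtain ⟨e', he'⟩ := M.exists_derivation e
      obtain ⟨g, hg, hg'⟩ := M.polyDelta_w_mem
      obtain ⟨h, hh, hh'⟩ := deltaPoly_mul_mem p M.deltaClosure (M.toPoly_mem e) M.w_mem
        (M.toPoly_mem e')
      refine ⟨C (qNum M.Q p) * zPoly p M.Q M.x' ^ (p - 1) * M.polyDelta.δ (M.toPoly e') +
        M.toPoly e' ^ p * g - h, ?_, ?_⟩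
      · refine sub_mem (add_mem (mul_mem (mul_mem ?_ (pow_mem M.z_mem _)) (M.polyDelta_mem e'))
          (mul_mem (pow_mem (M.toPoly_mem e') _) hg)) hh
        have := M.C_mem (qNum M.q p)
        rwa [map_qNum] at this
      · have hw := M.Φ_w
        rw [Φ_eq] at hw
        change shiftHom p M.Q M.x' (M.polyDelta.δ (M.toPoly e)) = M.polyDelta.δ (M.toPoly e) + _
        -- As `σ` commutes with `δ`, one expands `δ (e + w e') = δ e + φ(w) δ e' + e' ^ p δ w -
        -- deltaPoly p e (w e')`; the last three terms are multiples of `w`.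
        rw [← polyDelta_shiftHom, he', M.polyDelta.map_add, M.polyDelta.map_mul, hh']
        linear_combination M.polyDelta.δ (M.toPoly e') * hw + M.toPoly e' ^ p * hg'
  | zero => exact ⟨⟨0, zero_mem _, by simp⟩, by rw [eval_zero]; exact zero_mem _⟩
  | one => exact ⟨⟨0, zero_mem _, by simp⟩, by rw [eval_one]; exact one_mem _⟩
  | add f g _ _ hf hg =>
    obtain ⟨⟨f', hf', e1⟩, hf0⟩ := hf
    obtain ⟨⟨g', hg', e2⟩, hg0⟩ := hg
    refine ⟨⟨f' + g', add_mem hf' hg', ?_⟩, by rw [eval_add]; exact add_mem hf0 hg0⟩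
    rw [map_add, e1, e2]; ring
  | neg f _ hf =>
    obtain ⟨⟨f', hf', e1⟩, hf0⟩ := hf
    refine ⟨⟨-f', neg_mem hf', ?_⟩, by rw [eval_neg]; exact neg_mem hf0⟩
    rw [map_neg, e1]; ring
  | mul f g hf0 hg0 hf hg =>
    obtain ⟨⟨f', hf', e1⟩, hf1⟩ := hf
    obtain ⟨⟨g', hg', e2⟩, hg1⟩ := hg
    -- The twisted Leibniz rule for `(σ - 1) / w`.
    refine ⟨⟨f' * g + f * g' + wPoly p M.Q M.x' * f' * g',
      add_mem (add_mem (mul_mem hf' hg0) (mul_mem hf0 hg'))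
        (mul_mem (mul_mem M.w_mem hf') hg'), ?_⟩, by rw [eval_mul]; exact mul_mem hf1 hg1⟩
    rw [map_mul, e1, e2]; ring

theorem X_add_w : (X + wPoly p M.Q M.x' : K[X]) = C (M.Q ^ p) * X + C ((M.Q - 1) * M.x') := by
  have h : C (M.Q ^ p) = C (M.Q - 1) * C (qNum M.Q p) + (1 : K[X]) := by
    rw [← map_mul, sub_one_mul_qNum, map_sub, map_one, sub_add_cancel]
  rw [wPoly, zPoly, h, map_mul]
  ring

theorem natDegree_X_add_w : (X + wPoly p M.Q M.x' : K[X]).natDegree = 1 := by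
  rw [X_add_w]
  exact natDegree_linear (pow_ne_zero _ M.q_ne_zero)

theorem natDegree_shiftHom (f : K[X]) : (shiftHom p M.Q M.x' f).natDegree = f.natDegree := by
  rw [shiftHom_eq_comp, natDegree_comp, natDegree_X_add_w, mul_one]

theorem natDegree_wPoly : (wPoly p M.Q M.x').natDegree = 1 := by
  have h : wPoly p M.Q M.x' = C ((M.Q - 1) * qNum M.Q p) * X + C ((M.Q - 1) * M.x') := by
    rw [wPoly, zPoly, map_mul, map_mul]
    ring
  rw [h]
  exact natDegree_linear (mul_ne_zero (sub_ne_zero.2 M.q_ne_one) M.qNum_Q_p_ne_zero)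

/-- In degree `n` the leading coefficient is multiplied by `q ^ (p n)`, which is not `1` unless `n =
0`. -/
theorem natDegree_eq_zero_of_shiftHom_eq {f : K[X]} (h : shiftHom p M.Q M.x' f = f) :
    f.natDegree = 0 := by
  by_contra hn
  have h1 := congrArg leadingCoeff h
  rw [shiftHom_eq_comp, leadingCoeff_comp (by rw [natDegree_X_add_w]; exact one_ne_zero),
    X_add_w, leadingCoeff_linear (a := M.Q ^ p) (pow_ne_zero _ M.q_ne_zero)] at h1
  have h2 : f.leadingCoeff ≠ 0 := leadingCoeff_ne_zero.2 (by rintro rfl; exact hn natDegree_zero)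
  exact M.pow_ne_one hn (mul_left_cancel₀ h2 (h1.trans (mul_one _).symm))

/-- Induction on the degree. The difference quotient `g` of `f` has smaller degree, hence is a
divided power polynomial; subtracting its integral from `f` leaves an element fixed by `σ`, that is
a constant, which lies in the coefficient ring. -/
theorem exists_toPoly_eq {f : K[X]} (hf : f ∈ M.deltaClosure) : ∃ e, M.toPoly e = f := by
  suffices H : ∀ n (f : K[X]), f.natDegree ≤ n → f ∈ M.deltaClosure → ∃ e, M.toPoly e = f from
    H _ f le_rfl hf
  have hw : wPoly p M.Q M.x' ≠ 0 := fun h => by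
    have := M.natDegree_wPoly
    rw [h, natDegree_zero] at this
    omega
  have const : ∀ f : K[X], f.natDegree = 0 → f.eval 0 ∈ M.i.range → ∃ e, M.toPoly e = f := by
    rintro f hf ⟨a, ha⟩
    refine ⟨algebraMap L _ a, ?_⟩
    rw [toPoly_algebraMap, ha, eq_C_of_natDegree_eq_zero hf, eval_C]
  intro n
  induction n with
  | zero => exact fun f hn hf => const f (Nat.le_zero.1 hn) (M.mem_deltaClosure hf).2
  | succ n ih =>
    intro f hn hf
    obtain ⟨⟨g, hg, hg'⟩, hf0⟩ := M.mem_deltaClosure hf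
    have hgn : g.natDegree ≤ n := by
      by_cases h0 : g = 0
      · rw [h0, natDegree_zero]; exact n.zero_le
      have h1 : (wPoly p M.Q M.x' * g).natDegree ≤ n + 1 := by
        have : wPoly p M.Q M.x' * g = shiftHom p M.Q M.x' f - f := by rw [hg']; ring
        rw [this]
        refine (natDegree_sub_le _ _).trans ?_
        rw [natDegree_shiftHom, max_self]
        exact hn
      rw [natDegree_mul hw h0, natDegree_wPoly] at h1
      omega
    obtain ⟨e, rfl⟩ := ih g hgn hg
    obtain ⟨e', h1, h2⟩ := M.exists_shift e
    have h3 : shiftHom p M.Q M.x' (f - M.toPoly e') = f - M.toPoly e' := by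
      rw [map_sub, hg', h1]; ring
    obtain ⟨e'', h4⟩ := const _ (M.natDegree_eq_zero_of_shiftHom_eq h3) (by
      rw [eval_sub, h2, sub_zero]; exact hf0)
    exact ⟨e'' + e', by rw [map_add, h4, sub_add_cancel]⟩

/-- `φ ω` has degree at most `p`, so both `φ f` and `f ^ p` obey the bound. -/
theorem natDegree_polyDelta_le (f : K[X]) :
    (M.polyDelta.δ f).natDegree ≤ p * f.natDegree := by
  rw [polyDelta_apply]
  refine (natDegree_C_mul_le _ _).trans ((natDegree_sub_le _ _).trans (max_le ?_ ?_))
  · have h : M.Φ f = (f.map M.φ).comp (M.Φ X) := by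
      rw [Φ_X, comp, eval₂_map]
      rfl
    rw [h]
    refine natDegree_comp_le.trans ?_
    rw [mul_comm]
    refine Nat.mul_le_mul ?_ natDegree_map_le
    rw [Φ_X]
    refine (natDegree_C_mul_le _ _).trans ((natDegree_sub_le _ _).trans (max_le ?_ ?_))
    · refine natDegree_pow_le.trans ?_
      have : (zPoly p M.Q M.x').natDegree ≤ 1 := by
        rw [zPoly, add_comm]
        exact natDegree_linear_le
      calc _ ≤ p * 1 := Nat.mul_le_mul_left p this
        _ = p := mul_one p
    · rw [← map_pow, natDegree_C]
      exact p.zero_le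
  · exact natDegree_pow_le

theorem exists_toPoly_eq_polyDelta (e : M.E) :
    ∃ e', M.toPoly e' = M.polyDelta.δ (M.toPoly e) :=
  M.exists_toPoly_eq (M.polyDelta_mem e)

/-- The `δ`-structure on the ring of divided powers. -/
noncomputable def delta : DeltaStructure p M.E :=
  M.polyDelta.restrict M.toPoly M.toPoly_injective
    (fun e => (M.exists_toPoly_eq_polyDelta e).choose)
    fun e => (M.exists_toPoly_eq_polyDelta e).choose_spec

theorem toPoly_delta (e : M.E) : M.toPoly (M.delta.δ e) = M.polyDelta.δ (M.toPoly e) :=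
  (M.exists_toPoly_eq_polyDelta e).choose_spec

theorem isDeltaHom_algebraMap : IsDeltaHom M.D M.delta (algebraMap L M.E) := fun a => by
  apply M.toPoly_injective
  rw [toPoly_delta, toPoly_algebraMap, toPoly_algebraMap]
  exact M.isDeltaHom_C a

theorem delta_z : M.delta.δ (algebraMap L _ M.x + qNum M.q p • dp _ _ 1) = 0 := by
  apply M.toPoly_injective
  rw [toPoly_delta, toPoly_z, polyDelta_z, map_zero]

theorem degLE_delta {n : ℕ} {e : M.E} (h : DegLE n e) : DegLE (p * n) (M.delta.δ e) := by
  refine M.degLE_of_natDegree_le ?_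
  rw [toPoly_delta]
  exact (M.natDegree_polyDelta_le _).trans (Nat.mul_le_mul_left p (M.natDegree_toPoly_le h))

end ModelData

end Model

end QDivPow

/-! ### The `δ`-structure in general -/

namespace QDivPow

open Polynomial

section Base

variable (p : ℕ) [hp : Fact p.Prime]

/-- The `δ`-structure of `ℤ[q]` with `δ q = 0`. -/
noncomputable def intPolyDelta : DeltaStructure p ℤ[X] := polyDelta (intDelta p) 0

/-- The `δ`-structure of `ℤ[q][x]` with `δ q = 0` and `δ x = 0`. -/
noncomputable def baseDelta : DeltaStructure p ℤ[X][X] := polyDelta (intPolyDelta p) 0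

theorem intPolyDelta_X : (intPolyDelta p).δ X = 0 := polyDelta_X _ _

theorem baseDelta_C (a : ℤ[X]) : (baseDelta p).δ (C a) = C ((intPolyDelta p).δ a) :=
  polyDelta_C _ _ _

theorem baseDelta_CX : (baseDelta p).δ (C X) = 0 := by
  rw [baseDelta_C, intPolyDelta_X, map_zero]

theorem baseDelta_X : (baseDelta p).δ X = 0 := polyDelta_X _ _

/-- The explicit form `q ↦ q ^ p`, `x ↦ x ^ p` shows injectivity, so the Frobenius lift extends to
the fraction field. -/
theorem baseDelta_frob : (baseDelta p).frob =
    ((expand ℤ[X] p : ℤ[X][X] →ₐ[ℤ[X]] ℤ[X][X]) : ℤ[X][X] →+* ℤ[X][X]).comp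
      (mapRingHom ((expand ℤ p : ℤ[X] →ₐ[ℤ] ℤ[X]) : ℤ[X] →+* ℤ[X])) := by
  refine Polynomial.ringHom_ext' (Polynomial.ringHom_ext' (RingHom.ext_int _ _) ?_) ?_
  · simp [DeltaStructure.frob_apply, baseDelta_CX]
  · simp [DeltaStructure.frob_apply, baseDelta_X]

theorem baseDelta_frob_injective : Function.Injective (baseDelta p).frob := by
  rw [baseDelta_frob]
  exact (expand_injective hp.out.pos).comp
    (map_injective _ (expand_injective hp.out.pos))

theorem base_qNum_ne_zero (n : ℕ) : qNum (C X : ℤ[X][X]) (n + 1) ≠ 0 := by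
  intro h
  have h1 := congrArg ((evalRingHom (1 : ℤ)).comp (evalRingHom (0 : ℤ[X]))) h
  rw [map_qNum, map_zero] at h1
  simp [qNum] at h1
  omega

/-- The universal coefficients. -/
noncomputable def baseModel : ModelData p ℤ[X][X] (FractionRing ℤ[X][X]) where
  D := baseDelta p
  i := algebraMap _ _
  φ := IsFractionRing.map (baseDelta_frob_injective p)
  q := C X
  x := X
  i_injective := IsFractionRing.injective _ _
  comm a := IsLocalization.map_eq _ _
  δq := baseDelta_CX p
  δx := baseDelta_X p
  qNum_ne_zero n h := by
    rw [← map_qNum] at h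
    exact base_qNum_ne_zero n (IsFractionRing.injective _ (FractionRing ℤ[X][X])
      (h.trans (map_zero _).symm))
  q_ne_one h := by
    have h1 : (C X : ℤ[X][X]) = 1 :=
      IsFractionRing.injective _ (FractionRing ℤ[X][X]) (h.trans (map_one _).symm)
    have h2 := C_injective (h1.trans (map_one C).symm)
    simpa using congrArg (eval 0) h2
  q_ne_zero h := by
    have h1 : (C X : ℤ[X][X]) = 0 :=
      IsFractionRing.injective _ (FractionRing ℤ[X][X]) (h.trans (map_zero _).symm)
    exact X_ne_zero (C_eq_zero.1 h1)
  natCast_ne_zero := Nat.cast_ne_zero.2 hp.out.ne_zero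

end Base

section General

variable {p : ℕ} [hp : Fact p.Prime] {A : Type*} [CommRing A]

/-- The homomorphism from `ℤ[q][x]` given by two elements. -/
noncomputable def baseHom (q x : A) : ℤ[X][X] →+* A :=
  eval₂RingHom (eval₂RingHom (Int.castRingHom A) q) x

theorem baseHom_C (q x : A) (a : ℤ[X]) : baseHom q x (C a) = aeval q a := by
  simp [baseHom, aeval_def, algebraMap_int_eq]

theorem baseHom_CX (q x : A) : baseHom q x (C X) = q := by simp [baseHom]

theorem baseHom_X (q x : A) : baseHom q x X = x := by simp [baseHom]

variable {δA : DeltaStructure p A} {q x : A}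

theorem isDeltaHom_baseHom (hq : δA.δ q = 0) (hx : δA.δ x = 0) :
    IsDeltaHom (baseDelta p) δA (baseHom q x) := by
  refine isDeltaHom_polyDelta (isDeltaHom_polyDelta (isDeltaHom_int _ _ _) ?_) ?_
  · rw [RingHom.comp_apply, baseHom_CX, hq, map_zero]
  · rw [baseHom_X, hx, map_zero]

variable (p q x) in
/-- The homomorphism from the universal ring of divided powers. -/
noncomputable def baseChange : (baseModel p).E →+* LevelRing p A q x :=
  mapHom (baseHom q x) (by rw [map_pow]; exact congrArg (· ^ p) (baseHom_CX q x))
    (by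
      rw [map_mul, map_sub, map_one]
      exact congrArg₂ (fun a b => (1 - a) * b) (baseHom_CX q x) (baseHom_X q x))

theorem baseChange_algebraMap (a : ℤ[X][X]) :
    baseChange p q x (algebraMap _ _ a) = algebraMap A _ (baseHom q x a) :=
  mapHom_algebraMap _ _ _ a

theorem baseChange_dp (n : ℕ) : baseChange p q x (dp _ _ n) = dp _ _ n :=
  mapHom_dp _ _ _ n

theorem coeff_baseChange (n : ℕ) (e : (baseModel p).E) :
    coeff n (baseChange p q x e) = baseHom q x (coeff n e) :=
  coeff_mapHom _ _ _ n e

/-- The Witt vectors coming from the universal ring and those coming from `A` agree on universal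
coefficients, in particular on the structure constants of the multiplication. -/
theorem toWitt_baseChange_algebraMap (hq : δA.δ q = 0) (hx : δA.δ x = 0) (a : ℤ[X][X]) :
    (baseModel p).delta.toWitt (baseChange p q x) (algebraMap _ _ a) =
      δA.toWitt (algebraMap A (LevelRing p A q x)) (baseHom q x a) := by
  refine WittTwo.ext (baseChange_algebraMap a) ?_
  change baseChange p q x ((baseModel p).delta.δ (algebraMap _ _ a)) =
    algebraMap A _ (δA.δ (baseHom q x a))
  rw [(baseModel p).isDeltaHom_algebraMap a, baseChange_algebraMap, isDeltaHom_baseHom hq hx a]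
  rfl

/-- The section of the Witt vectors of length two over the ring of divided powers. -/
noncomputable def wittSection (hq : δA.δ q = 0) (hx : δA.δ x = 0) :
    LevelRing p A q x →+* WittTwo p (LevelRing p A q x) :=
  liftHom (δA.toWitt (algebraMap A _))
    (fun n => (baseModel p).delta.toWitt (baseChange p q x) (dp _ _ n))
    (map_one ((baseModel p).delta.toWitt (baseChange p q x))) fun m n => by
      -- The product is computed in the universal ring, where `e ↦ (e, δ e)` is already
      -- multiplicative; only the structure constants remain to be compared.
      rw [← map_mul, dp_mul_dp', map_sum]
      refine Finset.sum_congr rfl fun k _ => ?_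
      rw [smul_eq_algebraMap_mul, map_mul, toWitt_baseChange_algebraMap hq hx, map_mulCoeff]
      congr 4
      · rw [map_pow]; exact congrArg (· ^ p) (baseHom_CX q x)
      · rw [map_mul, map_sub, map_one]
        exact congrArg₂ (fun a b => (1 - a) * b) (baseHom_CX q x) (baseHom_X q x)

theorem wittSection_algebraMap (hq : δA.δ q = 0) (hx : δA.δ x = 0) (a : A) :
    wittSection hq hx (algebraMap A _ a) = δA.toWitt (algebraMap A _) a := by
  rw [algebraMap_apply, wittSection, liftHom_smul_dp]
  exact (congrArg _ (map_one ((baseModel p).delta.toWitt (baseChange p q x)))).trans (mul_one _)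

theorem wittSection_dp (hq : δA.δ q = 0) (hx : δA.δ x = 0) (n : ℕ) :
    wittSection hq hx (dp _ _ n) =
      (baseModel p).delta.toWitt (baseChange p q x) (dp _ _ n) := by
  rw [← one_smul A (dp _ _ n), wittSection, liftHom_smul_dp, map_one, one_mul]

theorem wittSection_fst (hq : δA.δ q = 0) (hx : δA.δ x = 0) (e : LevelRing p A q x) :
    (wittSection hq hx e).fst = e := by
  refine RingHom.congr_fun (f := WittTwo.fstHom.comp (wittSection hq hx))
    (g := RingHom.id _) (ringHom_ext (fun a => ?_) fun n => ?_) e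
  · rw [RingHom.comp_apply, wittSection_algebraMap]; rfl
  · rw [RingHom.comp_apply, wittSection_dp]; exact baseChange_dp n

/-- The `δ`-structure of the ring of divided powers. -/
noncomputable def levelDelta (hq : δA.δ q = 0) (hx : δA.δ x = 0) :
    DeltaStructure p (LevelRing p A q x) :=
  DeltaStructure.ofSection (wittSection hq hx) (wittSection_fst hq hx)

theorem levelDelta_algebraMap (hq : δA.δ q = 0) (hx : δA.δ x = 0) :
    IsDeltaHom δA (levelDelta hq hx) (algebraMap A (LevelRing p A q x)) := fun a => by
  change (wittSection hq hx (algebraMap A _ a)).snd = _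
  rw [wittSection_algebraMap]
  rfl

theorem levelDelta_baseChange (hq : δA.δ q = 0) (hx : δA.δ x = 0) :
    IsDeltaHom (baseModel p).delta (levelDelta hq hx) (baseChange p q x) := fun e => by
  have h : (wittSection hq hx).comp (baseChange p q x) =
      (baseModel p).delta.toWitt (baseChange p q x) := by
    refine ringHom_ext (fun a => ?_) fun n => ?_
    · rw [RingHom.comp_apply, baseChange_algebraMap, wittSection_algebraMap,
        toWitt_baseChange_algebraMap hq hx]
    · rw [RingHom.comp_apply, baseChange_dp, wittSection_dp]
  exact congrArg WittTwo.snd (RingHom.congr_fun h e)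

theorem baseChange_z : baseChange p q x
    (algebraMap _ _ (baseModel p).x + qNum (baseModel p).q p • dp _ _ 1) =
      algebraMap A _ x + qNum q p • dp _ _ 1 := by
  rw [smul_eq_algebraMap_mul, map_add, map_mul, baseChange_algebraMap, baseChange_algebraMap,
    baseChange_dp, map_qNum, smul_eq_algebraMap_mul]
  congr 3
  · exact baseHom_X q x
  · exact congrArg (qNum · p) (baseHom_CX q x)

theorem levelDelta_z (hq : δA.δ q = 0) (hx : δA.δ x = 0) :
    (levelDelta hq hx).δ (algebraMap A _ x + qNum q p • dp _ _ 1) = 0 := by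
  rw [← baseChange_z, levelDelta_baseChange hq hx, (baseModel p).delta_z, map_zero]

end General

end QDivPow

/-! ### The weight filtration generated by the iterates of `δ` on one element -/

section PowDelta

variable {p : ℕ} [hp : Fact p.Prime] {R : Type*} [CommRing R]

/-- The second ghost component. -/
def WittTwo.ghost : WittTwo p R →+* R where
  toFun a := a.fst ^ p + p * a.snd
  map_zero' := by
    change (0 : R) ^ p + p * 0 = 0
    rw [zero_pow hp.out.ne_zero]; ring
  map_one' := by
    change (1 : R) ^ p + p * 0 = 1
    rw [one_pow]; ring
  map_add' a b := by
    change (a.fst + b.fst) ^ p + p * (a.snd + b.snd - deltaPoly p a.fst b.fst) = _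
    linear_combination -mul_deltaPoly p a.fst b.fst
  map_mul' a b := by
    change (a.fst * b.fst) ^ p + p * (a.fst ^ p * b.snd + b.fst ^ p * a.snd + p * a.snd * b.snd) = _
    ring

theorem WittTwo.pow_fst (a : WittTwo p R) (n : ℕ) : (a ^ n).fst = a.fst ^ n :=
  map_pow WittTwo.fstHom a n

/-- Multiplicativity of the second ghost component gives `p` times the identity. This suffices over
a polynomial ring on `ℤ`, from which the general case is obtained by specialisation. -/
theorem WittTwo.pow_prime_snd (a : WittTwo p R) :
    (a ^ p).snd = deltaPoly p (a.fst ^ p) (p * a.snd) + p ^ (p - 1) * a.snd ^ p := by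
  have key : ∀ a : WittTwo p (MvPolynomial (Fin 2) ℤ),
      (a ^ p).snd = deltaPoly p (a.fst ^ p) (p * a.snd) + p ^ (p - 1) * a.snd ^ p := by
    intro a
    have h0 : (p : MvPolynomial (Fin 2) ℤ) ≠ 0 := Nat.cast_ne_zero.2 hp.out.ne_zero
    apply mul_left_cancel₀ h0
    have h1 : (a ^ p).fst ^ p + p * (a ^ p).snd = (a.fst ^ p + p * a.snd) ^ p :=
      map_pow WittTwo.ghost a p
    rw [WittTwo.pow_fst] at h1
    have h2 : (p : MvPolynomial (Fin 2) ℤ) ^ p = p * p ^ (p - 1) := by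
      rw [← pow_succ', Nat.sub_add_cancel hp.out.one_le]
    rw [mul_add, mul_deltaPoly, mul_pow, h2]
    linear_combination h1
  let f : MvPolynomial (Fin 2) ℤ →+* R := MvPolynomial.eval₂Hom (Int.castRingHom R) ![a.fst, a.snd]
  have ha : a = WittTwo.map f ⟨MvPolynomial.X 0, MvPolynomial.X 1⟩ := by
    refine WittTwo.ext ?_ ?_
    · change _ = f (MvPolynomial.X 0); simp [f]
    · change _ = f (MvPolynomial.X 1); simp [f]
  have h := congrArg f (key ⟨MvPolynomial.X 0, MvPolynomial.X 1⟩)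
  have h0 : f (MvPolynomial.X 0) = a.fst := by simp [f]
  have h1 : f (MvPolynomial.X 1) = a.snd := by simp [f]
  have h2 : (a ^ p).snd = f ((⟨MvPolynomial.X 0, MvPolynomial.X 1⟩ :
      WittTwo p (MvPolynomial (Fin 2) ℤ)) ^ p).snd := by
    conv_lhs => rw [ha]
    rw [← map_pow]
    rfl
  rw [h2, h, map_add, map_deltaPoly]
  simp only [map_mul, map_pow, map_natCast, h0, h1]

theorem DeltaStructure.map_pow_prime (D : DeltaStructure p R) (a : R) :
    D.δ (a ^ p) = deltaPoly p (a ^ p) (p * D.δ a) + p ^ (p - 1) * D.δ a ^ p := by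
  have h := WittTwo.pow_prime_snd (D.toWitt (RingHom.id R) a)
  rw [← map_pow] at h
  exact h

theorem DeltaStructure.map_mul' (D : DeltaStructure p R) (a b : R) :
    D.δ (a * b) = D.frob a * D.δ b + D.δ a * b ^ p := by
  rw [D.map_mul, D.frob_apply]
  ring

end PowDelta

/-! ### Weight estimates and their behaviour under `δ` -/

section Filtration

variable {p : ℕ} {A T : Type*} [CommRing A] [CommRing T]

/-- The subsets of elements of weight at most `n` in the `A`-algebra generated by the `δ^k b`,
where `δ^k b` has weight `p ^ k`. -/
inductive DeltaFilt (δT : DeltaStructure p T) (j : A →+* T) (b : T) : ℕ → T → Prop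
  | base (a : A) (n : ℕ) : DeltaFilt δT j b n (j a)
  | gen (k : ℕ) : DeltaFilt δT j b (p ^ k) (δT.δ^[k] b)
  | add {n : ℕ} {s t : T} : DeltaFilt δT j b n s → DeltaFilt δT j b n t →
      DeltaFilt δT j b n (s + t)
  | mul {m n : ℕ} {s t : T} : DeltaFilt δT j b m s → DeltaFilt δT j b n t →
      DeltaFilt δT j b (m + n) (s * t)
  | mono {m n : ℕ} {s : T} : DeltaFilt δT j b m s → m ≤ n → DeltaFilt δT j b n s

/-- Elements of weight less than `n`. -/
def DeltaLow (δT : DeltaStructure p T) (j : A →+* T) (b : T) : ℕ → T → Prop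
  -- No nonzero element has negative weight; this is where the descent on the weight ends in
  -- `graph_eq_zero`.
  | 0, t => t = 0
  | n + 1, t => DeltaFilt δT j b n t

variable {δA : DeltaStructure p A} {δT : DeltaStructure p T} {j : A →+* T} {b : T}

namespace DeltaFilt

theorem zero (n : ℕ) : DeltaFilt δT j b n 0 := by
  have := base (δT := δT) (j := j) (b := b) 0 n
  rwa [map_zero] at this

theorem one (n : ℕ) : DeltaFilt δT j b n 1 := by
  have := base (δT := δT) (j := j) (b := b) 1 n
  rwa [map_one] at this

theorem neg {n : ℕ} {t : T} (h : DeltaFilt δT j b n t) : DeltaFilt δT j b n (-t) := by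
  have := (base (δT := δT) (j := j) (b := b) (-1) 0).mul h
  rwa [map_neg, map_one, neg_one_mul, zero_add] at this

theorem sub {n : ℕ} {s t : T} (hs : DeltaFilt δT j b n s) (h : DeltaFilt δT j b n t) :
    DeltaFilt δT j b n (s - t) := by
  rw [sub_eq_add_neg]; exact hs.add h.neg

theorem pow {n : ℕ} {t : T} (h : DeltaFilt δT j b n t) (k : ℕ) :
    DeltaFilt δT j b (k * n) (t ^ k) := by
  induction k with
  | zero => rw [pow_zero]; exact one _
  | succ k ih => rw [pow_succ, Nat.succ_mul]; exact ih.mul h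

theorem base_mul {n : ℕ} {t : T} (h : DeltaFilt δT j b n t) (a : A) :
    DeltaFilt δT j b n (j a * t) := by
  have := (base (δT := δT) (j := j) (b := b) a 0).mul h
  rwa [zero_add] at this

theorem natCast_mul {n : ℕ} {t : T} (h : DeltaFilt δT j b n t) (a : ℕ) :
    DeltaFilt δT j b n (a * t) := by
  have := h.base_mul a
  rwa [map_natCast] at this

theorem low_succ {n : ℕ} {t : T} : DeltaLow δT j b (n + 1) t ↔ DeltaFilt δT j b n t := Iff.rfl

theorem low_of_lt {m n : ℕ} {t : T} (h : DeltaFilt δT j b m t) (hmn : m < n) :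
    DeltaLow δT j b n t := by
  obtain ⟨k, rfl⟩ : ∃ k, n = k + 1 := ⟨n - 1, by omega⟩
  exact h.mono (by omega)

end DeltaFilt

namespace DeltaLow

theorem zero (n : ℕ) : DeltaLow δT j b n 0 := by
  cases n with
  | zero => rfl
  | succ n => exact DeltaFilt.zero n

theorem filt {n : ℕ} {t : T} (h : DeltaLow δT j b n t) : DeltaFilt δT j b n t := by
  cases n with
  | zero => obtain rfl : t = 0 := h; exact DeltaFilt.zero 0
  | succ n => exact DeltaFilt.mono h n.le_succ

theorem add {n : ℕ} {s t : T} (hs : DeltaLow δT j b n s) (h : DeltaLow δT j b n t) :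
    DeltaLow δT j b n (s + t) := by
  cases n with
  | zero =>
    obtain rfl : t = 0 := h
    obtain rfl : s = 0 := hs
    exact add_zero 0
  | succ n => exact DeltaFilt.add hs h

theorem mul {m n : ℕ} {s t : T} (hs : DeltaFilt δT j b m s) (h : DeltaLow δT j b n t) :
    DeltaLow δT j b (m + n) (s * t) := by
  cases n with
  | zero =>
    obtain rfl : t = 0 := h
    rw [mul_zero]
    exact zero _
  | succ n => exact DeltaFilt.mul hs h

theorem mul_right {m n : ℕ} {s t : T} (h : DeltaLow δT j b m s) (ht : DeltaFilt δT j b n t) :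
    DeltaLow δT j b (m + n) (s * t) := by
  rw [mul_comm s, add_comm m]
  exact mul ht h

theorem base_mul {n : ℕ} {t : T} (h : DeltaLow δT j b n t) (a : A) :
    DeltaLow δT j b n (j a * t) := by
  have := mul (DeltaFilt.base a 0) h
  rwa [zero_add] at this

theorem neg {n : ℕ} {t : T} (h : DeltaLow δT j b n t) : DeltaLow δT j b n (-t) := by
  have := h.base_mul (-1)
  rwa [map_neg, map_one, neg_one_mul] at this

theorem sub {n : ℕ} {s t : T} (hs : DeltaLow δT j b n s) (h : DeltaLow δT j b n t) :
    DeltaLow δT j b n (s - t) := by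
  rw [sub_eq_add_neg]; exact hs.add h.neg

theorem pow_sub_pow {n : ℕ} {s t : T} (hs : DeltaFilt δT j b n s) (ht : DeltaFilt δT j b n t)
    (h : DeltaLow δT j b n (s - t)) (k : ℕ) : DeltaLow δT j b (k * n) (s ^ k - t ^ k) := by
  induction k with
  | zero => rw [pow_zero, pow_zero, sub_self]; exact zero _
  | succ k ih =>
    have e : s ^ (k + 1) - t ^ (k + 1) = s ^ k * (s - t) + (s ^ k - t ^ k) * t := by ring
    rw [e, Nat.succ_mul]
    exact (mul (hs.pow k) h).add (ih.mul_right ht)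

theorem deltaPoly_sub {n : ℕ} {s t u : T} (hs : DeltaFilt δT j b n s)
    (ht : DeltaFilt δT j b n t) (h : DeltaLow δT j b n (s - t)) (hu : DeltaFilt δT j b n u) :
    DeltaLow δT j b (p * n) (deltaPoly p s u - deltaPoly p t u) := by
  rw [deltaPoly, deltaPoly, ← Finset.sum_sub_distrib]
  refine Finset.sum_induction _ (DeltaLow δT j b (p * n)) (fun _ _ => add) (zero _) fun i hi => ?_
  rw [Finset.mem_Ico] at hi
  have h1 := ((pow_sub_pow hs ht h (p - i)).mul_right (hu.pow i)).base_mul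
    ((p.choose i / p : ℕ) : A)
  rw [← add_mul, Nat.sub_add_cancel hi.2.le, map_natCast] at h1
  rw [← sub_mul, ← mul_sub, mul_assoc]
  exact h1

theorem deltaPoly_right {n : ℕ} {s t : T} (hs : DeltaFilt δT j b n s)
    (h : DeltaLow δT j b n t) : DeltaLow δT j b (p * n) (deltaPoly p s t) := by
  refine Finset.sum_induction _ (DeltaLow δT j b (p * n)) (fun _ _ => add) (zero _) fun i hi => ?_
  rw [Finset.mem_Ico] at hi
  obtain ⟨i, rfl⟩ : ∃ k, i = k + 1 := ⟨i - 1, by omega⟩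
  have h1 := (mul (hs.pow (p - (i + 1))) (mul (h.filt.pow i) h)).base_mul
    ((p.choose (i + 1) / p : ℕ) : A)
  rw [← Nat.succ_mul, ← add_mul, Nat.sub_add_cancel hi.2.le, map_natCast] at h1
  rw [pow_succ, mul_assoc]
  exact h1

end DeltaLow

variable [hp : Fact p.Prime]

theorem DeltaFilt.deltaPoly {n : ℕ} {s t : T} (hs : DeltaFilt δT j b n s)
    (ht : DeltaFilt δT j b n t) : DeltaFilt δT j b (p * n) (deltaPoly p s t) := by
  refine Finset.sum_induction _ (DeltaFilt δT j b (p * n)) (fun _ _ => add) (zero _) fun i hi => ?_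
  rw [Finset.mem_Ico] at hi
  have h1 := ((hs.pow (p - i)).mul (ht.pow i)).natCast_mul (p.choose i / p)
  rw [← add_mul, Nat.sub_add_cancel hi.2.le] at h1
  rw [mul_assoc]
  exact h1

/-- With `δ^k b` of weight `p ^ k`, the rules for `δ` of sums and products are homogeneous of degree
`p`. -/
theorem DeltaFilt.delta (hj : IsDeltaHom δA δT j) {n : ℕ} {t : T} (h : DeltaFilt δT j b n t) :
    DeltaFilt δT j b (p * n) (δT.δ t) := by
  induction h with
  | base a n => rw [hj]; exact base _ _
  | gen k => rw [← Function.iterate_succ_apply' δT.δ, ← pow_succ']; exact gen _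
  | @add n s t hs ht ihs iht =>
    rw [δT.map_add]
    exact (ihs.add iht).sub (hs.deltaPoly ht)
  | @mul m n s t hs ht ihs iht =>
    rw [δT.map_mul, mul_add]
    refine ((hs.pow p).mul iht).add (add_comm (p * n) (p * m) ▸ (ht.pow p).mul ihs) |>.add ?_
    rw [mul_assoc]
    exact (ihs.mul iht).natCast_mul p
  | mono _ hmn ih => exact ih.mono (Nat.mul_le_mul_left p hmn)

theorem DeltaLow.delta (hj : IsDeltaHom δA δT j) {n : ℕ} {t : T} (h : DeltaLow δT j b n t) :
    DeltaLow δT j b (p * n) (δT.δ t) := by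
  cases n with
  | zero =>
    obtain rfl : t = 0 := h
    rw [δT.map_zero]
    exact zero _
  | succ n =>
    refine (DeltaFilt.delta hj (DeltaFilt.low_succ.1 h)).low_of_lt ?_
    exact Nat.mul_lt_mul_of_pos_left n.lt_succ_self hp.out.pos

end Filtration

/-! ### The relations between `(δ^k b) ^ p` and `δ^(k+1) b` -/

section Relation

open QDivPow Polynomial

variable {p : ℕ} [hp : Fact p.Prime] {A T : Type*} [CommRing A] [CommRing T]
  {δA : DeltaStructure p A} {δT : DeltaStructure p T}

theorem isDeltaHom_eval_one : IsDeltaHom (intPolyDelta p) (intDelta p) (evalRingHom 1) :=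
  isDeltaHom_polyDelta (isDeltaHom_int _ _ _) (by simp [(intDelta p).map_one])

/-- Evaluation at `q = 1` is a `δ`-homomorphism to `ℤ`, whose Frobenius lift is the identity. -/
theorem eval_one_frob (f : ℤ[X]) : ((intPolyDelta p).frob f).eval 1 = f.eval 1 := by
  have h := isDeltaHom_eval_one.map_frob (p := p) f
  rw [coe_evalRingHom] at h
  rw [h]
  exact (intDelta_spec _).symm

theorem eval_one_delta (f : ℤ[X]) :
    ((intPolyDelta p).δ f).eval 1 = (intDelta p).δ (f.eval 1) :=
  (isDeltaHom_eval_one f).symm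

theorem intDelta_prime_mul (c : ℤ) : (intDelta p).δ (p * c) = c - p ^ (p - 1) * c ^ p := by
  have h0 : (p : ℤ) ≠ 0 := Nat.cast_ne_zero.2 hp.out.ne_zero
  apply mul_left_cancel₀ h0
  have h := intDelta_spec (p := p) ((p : ℤ) * c)
  have h2 : (p : ℤ) ^ p = p * p ^ (p - 1) := by
    rw [← pow_succ', Nat.sub_add_cancel hp.out.one_le]
  rw [mul_pow, h2] at h
  linear_combination -h

/-- `δ (p c) ≡ c` modulo `p`: on integers, `δ` lowers the `p`-adic valuation from one to zero. -/
theorem not_dvd_intDelta_prime_mul {c : ℤ} (hc : ¬ (p : ℤ) ∣ c) :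
    ¬ (p : ℤ) ∣ (intDelta p).δ (p * c) := by
  rw [intDelta_prime_mul]
  intro h
  refine hc ((dvd_sub_left (Dvd.dvd.mul_right (dvd_pow_self _ ?_) _)).1 h)
  have := hp.out.two_le
  omega

/-- The relation `κ (δ^k b) ^ p ≡ ℓ δ^(k+1) b` modulo lower weight. -/
structure WeightRel (δT : DeltaStructure p T) (j : A →+* T) (b : T) (e : ℤ[X] →+* A) (k : ℕ)
    (κ ℓ : ℤ[X]) : Prop where
  not_dvd : ¬ (p : ℤ) ∣ κ.eval 1
  exists_eq : ∃ c, ℓ.eval 1 = p * c ∧ ¬ (p : ℤ) ∣ c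
  low : DeltaLow δT j b (p ^ (k + 1)) (j (e κ) * (δT.δ^[k] b) ^ p - j (e ℓ) * δT.δ^[k + 1] b)

variable {j : A →+* T} {b : T} {e : ℤ[X] →+* A}

/-- The hypothesis gives `δ ((p)_q b) = deltaPoly p x ((p)_q b)`, whose terms have weight at most `p
- 1`; on the other hand `δ ((p)_q b) = φ((p)_q) δ b + δ((p)_q) b ^ p`. -/
theorem WeightRel.zero (he : IsDeltaHom (intPolyDelta p) δA e) (hj : IsDeltaHom δA δT j)
    {x : A} (hx : δA.δ x = 0) (hb : δT.δ (j x + j (e (qNum X p)) * b) = 0) :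
    WeightRel δT j b e 0 (-(intPolyDelta p).δ (qNum X p)) ((intPolyDelta p).frob (qNum X p)) := by
  have hev : (qNum (X : ℤ[X]) p).eval 1 = p := by
    rw [← coe_evalRingHom, map_qNum]
    simp [qNum]
  have hp1 : ¬ (p : ℤ) ∣ 1 := fun h => hp.out.one_lt.ne' (by
    exact_mod_cast Int.eq_one_of_dvd_one (Int.natCast_nonneg p) h)
  refine ⟨?_, ⟨1, by rw [eval_one_frob, hev, mul_one], hp1⟩, ?_⟩
  · rw [eval_neg, eval_one_delta, hev, dvd_neg]
    have := not_dvd_intDelta_prime_mul (p := p) hp1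
    rwa [mul_one] at this
  · have h1 : δT.δ (j (e (qNum X p)) * b) = deltaPoly p (j x) (j (e (qNum X p)) * b) := by
      rw [δT.map_add, hj, hx, map_zero] at hb
      linear_combination hb
    have h2 : j (e (-(intPolyDelta p).δ (qNum X p))) * (δT.δ^[0] b) ^ p -
        j (e ((intPolyDelta p).frob (qNum X p))) * δT.δ^[0 + 1] b =
        -deltaPoly p (j x) (j (e (qNum X p)) * b) := by
      rw [← h1, δT.map_mul', he.map_frob, hj.map_frob, hj, he, map_neg, map_neg]
      simp only [Function.iterate_zero, zero_add, Function.iterate_one, id]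
      ring
    rw [h2]
    refine DeltaLow.neg ?_
    refine Finset.sum_induction _ (DeltaLow δT j b (p ^ (0 + 1))) (fun _ _ => DeltaLow.add)
      (DeltaLow.zero _) fun i hi => ?_
    rw [Finset.mem_Ico] at hi
    have hb1 : DeltaFilt δT j b 1 b := by
      have := DeltaFilt.gen (δT := δT) (j := j) (b := b) 0
      rwa [pow_zero] at this
    have h3 := (((DeltaFilt.base x 0).pow (p - i)).mul ((hb1.base_mul (e (qNum X p))).pow i)
      ).natCast_mul (p.choose i / p)
    rw [mul_assoc]
    refine h3.low_of_lt ?_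
    rw [zero_add, pow_one]
    omega

/-- Apply `δ` to the relation `κ s ^ p ≡ ℓ t`, where `s = δ^k b` and `t = δ^(k+1) b`, multiply by `κ
^ p`, and use the relation again to express every power of `s` through `t`. What remains relates `t
^ p` and `δ t`. -/
theorem WeightRel.succ (he : IsDeltaHom (intPolyDelta p) δA e) (hj : IsDeltaHom δA δT j)
    {k : ℕ} {κ ℓ : ℤ[X]} (h : WeightRel δT j b e k κ ℓ) :
    WeightRel δT j b e (k + 1)
      ((intPolyDelta p).δ κ * ℓ ^ p + (intPolyDelta p).frob κ *
        (deltaPoly p ℓ (p * κ) + p ^ (p - 1) * κ ^ p) - κ ^ p * (intPolyDelta p).δ ℓ)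
      (κ ^ p * (intPolyDelta p).frob ℓ) := by
  obtain ⟨h1, ⟨c, h2, h3⟩, h4⟩ := h
  have hprime : Prime (p : ℤ) := Nat.prime_iff_prime_int.1 hp.out
  refine ⟨?_, ⟨κ.eval 1 ^ p * c, ?_, ?_⟩, ?_⟩
  · rw [eval_sub, eval_add, eval_mul, eval_mul, eval_mul, eval_add, eval_mul, eval_one_delta,
      eval_one_delta, ← coe_evalRingHom, map_deltaPoly]
    simp only [map_pow, map_mul, map_natCast, coe_evalRingHom]
    rw [h2]
    -- As `ℓ(1) = p c`, all terms of the new `κ(1)` are divisible by `p` except `κ(1) ^ p δ (p c)`.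
    intro hd
    refine hprime.not_dvd_mul (fun h' => h1 (hprime.dvd_of_dvd_pow h'))
      (not_dvd_intDelta_prime_mul h3) ((dvd_sub_right ?_).1 hd)
    have hp0 := hp.out.ne_zero
    have hp2 : p - 1 ≠ 0 := by have := hp.out.two_le; omega
    refine dvd_add (Dvd.dvd.mul_left (dvd_pow (Dvd.intro _ rfl) hp0) _)
      (Dvd.dvd.mul_left (dvd_add ?_ (Dvd.dvd.mul_right (dvd_pow_self _ hp2) _)) _)
    rw [deltaPoly_mul_mul]
    exact Dvd.dvd.mul_right (dvd_pow_self _ hp0) _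
  · rw [eval_mul, eval_pow, eval_one_frob, h2]
    ring
  · exact hprime.not_dvd_mul (fun h' => h1 (hprime.dvd_of_dvd_pow h')) h3
  · have hej := hj.comp he
    set f : ℤ[X] →+* T := j.comp e with hf
    change DeltaLow δT j b _ (f _ * _ - f _ * _)
    change DeltaLow δT j b _ (f κ * _ - f ℓ * _) at h4
    set s := δT.δ^[k] b with hs
    set t := δT.δ^[k + 1] b with ht
    have hst : δT.δ s = t := (Function.iterate_succ_apply' δT.δ k b).symm
    have htt : δT.δ^[k + 1 + 1] b = δT.δ t := Function.iterate_succ_apply' δT.δ (k + 1) b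
    rw [htt]
    have hsF : DeltaFilt δT j b (p ^ (k + 1)) (s ^ p) := by
      rw [pow_succ']; exact (DeltaFilt.gen k).pow p
    have htF : DeltaFilt δT j b (p ^ (k + 1)) t := DeltaFilt.gen (k + 1)
    have hE : p ^ (k + 1 + 1) = p * p ^ (k + 1) := pow_succ' _ _
    rw [hE]
    have hS : DeltaFilt δT j b (p ^ (k + 1)) (f κ * s ^ p) := hsF.base_mul (e κ)
    have hT : DeltaFilt δT j b (p ^ (k + 1)) (f ℓ * t) := htF.base_mul (e ℓ)
    have hPT : DeltaFilt δT j b (p ^ (k + 1)) (f κ * (p * t)) :=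
      (htF.natCast_mul p).base_mul (e κ)
    have c1 := DeltaLow.pow_sub_pow hS hT h4 p
    have c2 := DeltaLow.deltaPoly_sub hS hT h4 hPT
    have c3 := h4.delta hj
    have c4 := DeltaLow.deltaPoly_right hT h4
    -- `κ s ^ p` is written as `ℓ t` plus an element of lower weight; `c3` and `c4` say that this
    -- element contributes only lower weight to `δ`.
    have e1 := δT.map_add (f ℓ * t) (f κ * s ^ p - f ℓ * t)
    rw [add_sub_cancel, δT.map_mul', δT.map_mul', δT.map_pow_prime, hst] at e1
    have e2 : deltaPoly p (f κ * s ^ p) (f κ * (p * t)) =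
        f κ ^ p * deltaPoly p (s ^ p) (p * t) := deltaPoly_mul_mul _ _ _ _
    have e3 : deltaPoly p (f ℓ * t) (f κ * (p * t)) =
        t ^ p * deltaPoly p (f ℓ) (p * f κ) := by
      rw [← deltaPoly_mul_mul]
      congr 1 <;> ring
    rw [e2, e3] at c2
    -- The error terms: those of `δ`, multiplied by `κ ^ p`, and those from replacing `κ s ^ p` by
    -- `ℓ t` in `κ ^ p s ^ (p ^ 2)` and in `κ ^ p deltaPoly p (s ^ p) (p t)`.
    have c5 := ((c3.sub c4).base_mul (e (κ ^ p))).sub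
      ((c1.base_mul (e ((intPolyDelta p).δ κ))).add
        (c2.base_mul (e ((intPolyDelta p).frob κ))))
    have g : ∀ r, j (e r) = f r := fun _ => rfl
    rw [g, g, g] at c5
    have hfr : ∀ r, f ((intPolyDelta p).frob r) = δT.frob (f r) := hej.map_frob
    have hfd : ∀ r, f ((intPolyDelta p).δ r) = δT.δ (f r) := fun r => (hej r).symm
    convert c5 using 1
    simp only [map_add, map_sub, map_mul, map_pow, map_natCast, map_deltaPoly, hfr, hfd]
    linear_combination (f κ ^ p) * e1

theorem exists_weightRel (he : IsDeltaHom (intPolyDelta p) δA e) (hj : IsDeltaHom δA δT j)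
    {x : A} (hx : δA.δ x = 0) (hb : δT.δ (j x + j (e (qNum X p)) * b) = 0) (k : ℕ) :
    ∃ κ ℓ, WeightRel δT j b e k κ ℓ := by
  induction k with
  | zero => exact ⟨_, _, WeightRel.zero he hj hx hb⟩
  | succ k ih =>
    obtain ⟨κ, ℓ, h⟩ := ih
    exact ⟨_, _, h.succ he hj⟩

end Relation

/-! ### Digit monomials and their products -/

section Digits

variable {p : ℕ} [hp : Fact p.Prime] {A T : Type*} [CommRing A] [CommRing T]

/-- The monomial `∏_i (δ^(k+i) b)^(n_i)`, where the `n_i` are the digits of `n` in base `p`. -/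
def digitMon {p : ℕ} [hp : Fact p.Prime] {T : Type*} [CommRing T] (δT : DeltaStructure p T) (b : T) (k n : ℕ) : T :=
  if _h : n = 0 then 1 else
    (δT.δ^[k] b) ^ (n % p) * digitMon δT b (k + 1) (n / p)
  termination_by n
  decreasing_by exact Nat.div_lt_self (Nat.pos_of_ne_zero _h) hp.out.one_lt

variable {δT : DeltaStructure p T} {j : A →+* T} {b : T}

theorem digitMon_zero (k : ℕ) : digitMon δT b k 0 = 1 := by rw [digitMon, dif_pos rfl]

theorem digitMon_eq (k n : ℕ) : digitMon δT b k n =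
    (δT.δ^[k] b) ^ (n % p) * digitMon δT b (k + 1) (n / p) := by
  by_cases h : n = 0
  · rw [h, Nat.zero_mod, Nat.zero_div, digitMon_zero, digitMon_zero, pow_zero, one_mul]
  · rw [digitMon, dif_neg h]

theorem digitMon_add_mul (k : ℕ) {m : ℕ} (hm : m < p) (n : ℕ) :
    digitMon δT b k (m + p * n) = (δT.δ^[k] b) ^ m * digitMon δT b (k + 1) n := by
  rw [digitMon_eq, Nat.add_mul_mod_self_left, Nat.mod_eq_of_lt hm, Nat.add_mul_div_left _ _
    hp.out.pos, Nat.div_eq_of_lt hm, zero_add]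

theorem digitMon_one (k : ℕ) : digitMon δT b k 1 = δT.δ^[k] b := by
  have := digitMon_add_mul (δT := δT) (b := b) k hp.out.one_lt 0
  rwa [mul_zero, add_zero, digitMon_zero, pow_one, mul_one] at this

theorem digitMon_pow (k i : ℕ) : digitMon δT b k (p ^ i) = δT.δ^[k + i] b := by
  induction i generalizing k with
  | zero => rw [pow_zero, digitMon_one, add_zero]
  | succ i ih =>
    have := digitMon_add_mul (δT := δT) (b := b) k hp.out.pos (p ^ i)
    rw [zero_add, pow_zero, one_mul, ih, ← pow_succ'] at this
    rw [this, add_right_comm, add_assoc]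

theorem digitMon_filt (k n : ℕ) : DeltaFilt δT j b (p ^ k * n) (digitMon δT b k n) := by
  induction n using Nat.strong_induction_on generalizing k with
  | _ n ih =>
    by_cases h : n = 0
    · rw [h, digitMon_zero]; exact DeltaFilt.one _
    · rw [digitMon_eq]
      have h1 := ((DeltaFilt.gen (δT := δT) (j := j) (b := b) k).pow (n % p)).mul
        (ih (n / p) (Nat.div_lt_self (Nat.pos_of_ne_zero h) hp.out.one_lt) (k + 1))
      convert h1 using 1
      conv_lhs => rw [← Nat.mod_add_div n p]
      ring

/-- Addition in base `p`: without a carry the lowest digits simply add up, and a carry is absorbed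
by `hrel`, which trades `(δ^k b) ^ p` for a multiple of `δ^(k+1) b`. -/
theorem digitMon_mul (hrel : ∀ k, ∃ α, DeltaLow δT j b (p ^ (k + 1))
      ((δT.δ^[k] b) ^ p - j α * δT.δ^[k + 1] b)) (N : ℕ) :
    ∀ m n k, m + n = N → ∃ α, DeltaLow δT j b (p ^ k * N)
      (digitMon δT b k m * digitMon δT b k n - j α * digitMon δT b k N) := by
  induction N using Nat.strong_induction_on with
  | _ N ih =>
    intro m n k hN
    have hp2 := hp.out.two_le
    by_cases h0 : N = 0
    · obtain ⟨rfl, rfl⟩ : m = 0 ∧ n = 0 := by omega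
      refine ⟨1, ?_⟩
      rw [h0, digitMon_zero, map_one, sub_self]
      exact DeltaLow.zero _
    obtain ⟨m0, m', hm0, rfl⟩ : ∃ a c, a < p ∧ m = a + p * c :=
      ⟨m % p, m / p, Nat.mod_lt _ hp.out.pos, (Nat.mod_add_div m p).symm⟩
    obtain ⟨n0, n', hn0, rfl⟩ : ∃ a c, a < p ∧ n = a + p * c :=
      ⟨n % p, n / p, Nat.mod_lt _ hp.out.pos, (Nat.mod_add_div n p).symm⟩
    rw [digitMon_add_mul k hm0, digitMon_add_mul k hn0]
    set s := δT.δ^[k] b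
    have hs : DeltaFilt δT j b (p ^ k) s := DeltaFilt.gen k
    have hm2 : 2 * m' ≤ p * m' := Nat.mul_le_mul_right m' hp2
    have hn2 : 2 * n' ≤ p * n' := Nat.mul_le_mul_right n' hp2
    have hlt : m' + n' < N := by omega
    obtain ⟨α, hα⟩ := ih (m' + n') hlt m' n' (k + 1) rfl
    rcases Nat.lt_or_ge (m0 + n0) p with h | h
    · refine ⟨α, ?_⟩
      have e1 : N = (m0 + n0) + p * (m' + n') := by rw [← hN]; ring
      have h1 := DeltaLow.mul (hs.pow (m0 + n0)) hα
      rw [e1, digitMon_add_mul k h]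
      convert h1 using 1
      · ring
      · rw [pow_add]; ring
    -- A carry occurs, and `c` is the new lowest digit. The induction hypothesis is used a second
    -- time, to multiply the carried `δ^(k+1) b` into the higher digits.
    · obtain ⟨c, hc⟩ := Nat.exists_eq_add_of_le h
      have e1 : N = c + p * (1 + (m' + n')) := by rw [← hN]; linear_combination hc
      have hlt' : 1 + (m' + n') < N := by omega
      obtain ⟨β, hβ⟩ := ih (1 + (m' + n')) hlt' 1 (m' + n') (k + 1) rfl
      rw [digitMon_one] at hβ
      obtain ⟨ρ, hρ⟩ := hrel k
      refine ⟨ρ * α * β, ?_⟩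
      have h1 := DeltaLow.mul (hs.pow (m0 + n0)) hα
      have h2 := (DeltaLow.mul (hs.pow c) (hρ.mul_right
        (digitMon_filt (δT := δT) (j := j) (b := b) (k + 1) (m' + n')))).base_mul α
      have h3 := (DeltaLow.mul (hs.pow c) hβ).base_mul (ρ * α)
      have w : p ^ k * N = (m0 + n0) * p ^ k + p ^ (k + 1) * (m' + n') := by rw [← hN]; ring
      have w2 : c * p ^ k + (p ^ (k + 1) + p ^ (k + 1) * (m' + n')) = p ^ k * N := by
        rw [e1]; ring
      have w3 : c * p ^ k + p ^ (k + 1) * (1 + (m' + n')) = p ^ k * N := by rw [e1]; ring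
      rw [← w] at h1
      rw [w2] at h2
      rw [w3] at h3
      have hcp : c < p := by omega
      convert (h1.add h2).add h3 using 1
      rw [e1, digitMon_add_mul k hcp]
      have e2 : s ^ m0 * s ^ n0 = s ^ p * s ^ c := by rw [← pow_add, hc, pow_add]
      have e3 : s ^ (m0 + n0) = s ^ p * s ^ c := by rw [hc, pow_add]
      rw [e3]
      simp only [map_mul]
      linear_combination (digitMon δT b (k + 1) m' * digitMon δT b (k + 1) n') * e2

/-- Each graded piece of the weight filtration is generated over `A` by a single digit monomial. -/
theorem DeltaFilt.exists_digitMon (hrel : ∀ k, ∃ α, DeltaLow δT j b (p ^ (k + 1))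
      ((δT.δ^[k] b) ^ p - j α * δT.δ^[k + 1] b)) {n : ℕ} {t : T} (h : DeltaFilt δT j b n t) :
    ∃ α, DeltaLow δT j b n (t - j α * digitMon δT b 0 n) := by
  induction h with
  | base a n =>
    rcases n with _ | n
    · refine ⟨a, ?_⟩
      rw [digitMon_zero, mul_one, sub_self]
      exact DeltaLow.zero _
    · refine ⟨0, ?_⟩
      rw [map_zero, zero_mul, sub_zero]
      exact DeltaFilt.base a n
  | gen k =>
    refine ⟨1, ?_⟩
    rw [digitMon_pow, zero_add, map_one, one_mul, sub_self]
    exact DeltaLow.zero _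
  | add _ _ ih1 ih2 =>
    obtain ⟨α, hα⟩ := ih1
    obtain ⟨β, hβ⟩ := ih2
    refine ⟨α + β, ?_⟩
    convert hα.add hβ using 1
    rw [map_add]; ring
  | @mul m n s t hs ht ih1 ih2 =>
    obtain ⟨α, hα⟩ := ih1
    obtain ⟨β, hβ⟩ := ih2
    obtain ⟨ρ, hρ⟩ := digitMon_mul hrel (m + n) m n 0 rfl
    rw [pow_zero, one_mul] at hρ
    refine ⟨α * β * ρ, ?_⟩
    have hm := digitMon_filt (δT := δT) (j := j) (b := b) 0 m
    rw [pow_zero, one_mul] at hm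
    have h1 := hα.mul_right ht
    have h2 := (DeltaLow.mul hm hβ).base_mul α
    convert (h1.add h2).add (hρ.base_mul (α * β)) using 1
    simp only [map_mul]
    ring
  | @mono m n s hs hmn ih =>
    rcases hmn.eq_or_lt with rfl | hlt
    · exact ih
    · refine ⟨0, ?_⟩
      rw [map_zero, zero_mul, sub_zero]
      exact hs.low_of_lt hlt

end Digits

/-! ### Leading coefficients of the iterates of `δ` on `ω` -/

section Choose

variable {p : ℕ} [hp : Fact p.Prime]

theorem qBinom_one_left (n k : ℕ) : qBinom (1 : ℤ) n k = n.choose k := by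
  induction n generalizing k with
  | zero => cases k <;> simp [qBinom]
  | succ n ih => cases k <;> simp [qBinom, ih, Nat.choose_succ_succ]

/-- Lucas' theorem, removing one vanishing lowest digit at a time. -/
theorem choose_pow_mul_modEq (k m n : ℕ) :
    (p ^ k * m).choose (p ^ k * n) ≡ m.choose n [MOD p] := by
  induction k with
  | zero => rw [pow_zero, one_mul, one_mul]
  | succ k ih =>
    refine (Choose.choose_modEq_choose_mod_mul_choose_div_nat (p := p)).trans ?_
    rw [pow_succ', mul_assoc, mul_assoc, Nat.mul_mod_right, Nat.mul_mod_right,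
      Nat.mul_div_cancel_left _ hp.out.pos, Nat.mul_div_cancel_left _ hp.out.pos,
      Nat.choose_zero_right, one_mul]
    exact ih

theorem not_dvd_choose_succ {k i : ℕ} (hi : i + 1 < p) :
    ¬ p ∣ (i * p ^ k + p ^ k).choose (i * p ^ k) := by
  have h := choose_pow_mul_modEq (p := p) k (i + 1) i
  rw [Nat.choose_succ_self_right] at h
  rw [show i * p ^ k + p ^ k = p ^ k * (i + 1) by ring, mul_comm i]
  intro hd
  have := (Nat.modEq_zero_iff_dvd.1 (h.symm.trans (Nat.modEq_zero_iff_dvd.2 hd)))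
  exact Nat.not_dvd_of_pos_of_lt i.succ_pos hi this

theorem not_dvd_choose_mod (k n : ℕ) :
    ¬ p ∣ (n % p * p ^ k + p ^ (k + 1) * (n / p)).choose (n % p * p ^ k) := by
  have h := choose_pow_mul_modEq (p := p) k n (n % p)
  have h2 : n.choose (n % p) ≡ 1 [MOD p] := by
    refine (Choose.choose_modEq_choose_mod_mul_choose_div_nat (p := p)).trans ?_
    rw [Nat.mod_mod, Nat.choose_self, Nat.div_eq_of_lt (Nat.mod_lt _ hp.out.pos),
      Nat.choose_zero_right, one_mul]
  have e : n % p * p ^ k + p ^ (k + 1) * (n / p) = p ^ k * n := by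
    conv_rhs => rw [← Nat.mod_add_div n p]
    ring
  rw [e, mul_comm (n % p)]
  intro hd
  have := Nat.modEq_zero_iff_dvd.1 ((h.trans h2).symm.trans (Nat.modEq_zero_iff_dvd.2 hd))
  exact hp.out.one_lt.ne' (Nat.dvd_one.1 this)

/-- By symmetry this is the binomial coefficient of `p ^ (k + 1)` over `p ^ k`, whose `p`-adic
valuation is `(k + 1) - k = 1`. -/
theorem exists_choose_eq (k : ℕ) : ∃ c, ¬ p ∣ c ∧
    ((p - 1) * p ^ k + p ^ k).choose ((p - 1) * p ^ k) = p * c := by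
  have e : (p - 1) * p ^ k + p ^ k = p ^ (k + 1) := by
    rw [← Nat.succ_mul, Nat.succ_eq_add_one, Nat.sub_add_cancel hp.out.one_le, pow_succ']
  have hk : p ^ k ≤ p ^ (k + 1) := Nat.pow_le_pow_right hp.out.pos k.le_succ
  have hpos : 0 < p ^ k := pow_pos hp.out.pos k
  have e2 : (p - 1) * p ^ k = p ^ (k + 1) - p ^ k := by omega
  rw [e, e2, Nat.choose_symm hk]
  have h := Nat.factorization_choose_prime_pow_add_factorization hp.out hk hpos.ne'
  rw [hp.out.factorization_pow, Finsupp.single_eq_same] at h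
  have h1 : ((p ^ (k + 1)).choose (p ^ k)).factorization p = 1 := by omega
  have h0 : (p ^ (k + 1)).choose (p ^ k) ≠ 0 := (Nat.choose_pos hk).ne'
  obtain ⟨c, hc⟩ : p ∣ (p ^ (k + 1)).choose (p ^ k) := by
    by_contra hd
    rw [Nat.factorization_eq_zero_of_not_dvd hd] at h1
    omega
  refine ⟨c, fun hd => ?_, hc⟩
  have h2 : p ^ 2 ∣ (p ^ (k + 1)).choose (p ^ k) := by
    rw [hc, sq]
    exact Nat.mul_dvd_mul_left p hd
  have := (hp.out.pow_dvd_iff_le_factorization h0).1 h2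
  omega

end Choose

namespace QDivPow

open Polynomial

/-! ### Leading coefficients in the divided power ring -/

section Lead

variable {A : Type*} [CommRing A] {q y : A}

theorem DegLE.pow {n : ℕ} {v : QDivPow A q y} (hv : DegLE n v) (i : ℕ) :
    DegLE (i * n) (v ^ i) := by
  induction i with
  | zero => rw [pow_zero, one_def]; exact (degLE_dp 0).mono (Nat.zero_le _)
  | succ i ih => rw [pow_succ, Nat.succ_mul]; exact ih.mul hv

theorem DegLE.coeff_pow {n : ℕ} {v : QDivPow A q y} (hv : DegLE n v) (i : ℕ) :
    coeff (i * n) (v ^ i) =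
      (∏ t ∈ Finset.range i, qBinom q (t * n + n) (t * n)) * coeff n v ^ i := by
  induction i with
  | zero => rw [pow_zero, one_def, zero_mul, coeff_dp]; simp
  | succ i ih =>
    rw [pow_succ, Nat.succ_mul, (hv.pow i).coeff_mul hv, ih, Finset.prod_range_succ]
    ring

theorem degLE_of_deltaFilt {p : ℕ} {δ : DeltaStructure p (QDivPow A q y)} {b : QDivPow A q y}
    (hb : ∀ k, DegLE (p ^ k) (δ.δ^[k] b)) {n : ℕ} {v : QDivPow A q y}
    (h : DeltaFilt δ (algebraMap A _) b n v) : DegLE n v := by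
  induction h with
  | base a n => exact (degLE_algebraMap a).mono n.zero_le
  | gen k => exact hb k
  | add _ _ h1 h2 => exact h1.add h2
  | mul _ _ h1 h2 => exact h1.mul h2
  | mono _ hmn ih => exact ih.mono hmn

theorem coeff_of_deltaLow {p : ℕ} {δ : DeltaStructure p (QDivPow A q y)} {b : QDivPow A q y}
    (hb : ∀ k, DegLE (p ^ k) (δ.δ^[k] b)) {n : ℕ} {v : QDivPow A q y}
    (h : DeltaLow δ (algebraMap A _) b n v) : coeff n v = 0 := by
  cases n with
  | zero => obtain rfl : v = 0 := h; exact map_zero _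
  | succ n => exact degLE_of_deltaFilt hb (DeltaFilt.low_succ.1 h) _ n.lt_succ_self

end Lead

/-! ### Leading coefficients of the iterates in the universal case -/

section BaseLead

variable (p : ℕ) [hp : Fact p.Prime]

/-- The iterates of `δ` on `ω` in the universal case. -/
noncomputable def baseIter (k : ℕ) : (baseModel p).E := (baseModel p).delta.δ^[k] (dp _ _ 1)

theorem degLE_baseIter (k : ℕ) : DegLE (p ^ k) (baseIter p k) := by
  induction k with
  | zero => exact degLE_dp 1
  | succ k ih =>
    rw [baseIter, Function.iterate_succ_apply', pow_succ']
    exact (baseModel p).degLE_delta ih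

/-- Degree at most `n`, with a leading coefficient in `ℤ[q]` which is prime to `p` at `q = 1`. -/
def UnitLead (n : ℕ) (v : (baseModel p).E) : Prop :=
  DegLE n v ∧ ∃ f : ℤ[X], coeff n v = C f ∧ ¬ (p : ℤ) ∣ f.eval 1

theorem base_qBinom (n k : ℕ) : qBinom ((baseModel p).q ^ p) n k = C (qBinom (X ^ p) n k) := by
  rw [map_qBinom, map_pow]
  rfl

theorem eval_one_qBinom (n k : ℕ) : (qBinom (X ^ p : ℤ[X]) n k).eval 1 = n.choose k := by
  rw [← coe_evalRingHom, map_qBinom, map_pow, coe_evalRingHom, eval_X, one_pow, qBinom_one_left]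

variable {p}

theorem UnitLead.mul {m n : ℕ} {v w : (baseModel p).E} (hv : UnitLead p m v)
    (hw : UnitLead p n w) (h : ¬ p ∣ (m + n).choose m) : UnitLead p (m + n) (v * w) := by
  obtain ⟨hv, f, hf, hf'⟩ := hv
  obtain ⟨hw, g, hg, hg'⟩ := hw
  have hprime : Prime (p : ℤ) := Nat.prime_iff_prime_int.1 hp.out
  refine ⟨hv.mul hw, qBinom (X ^ p) (m + n) m * f * g, ?_, ?_⟩
  · rw [hv.coeff_mul hw, hf, hg, base_qBinom, map_mul, map_mul]
  · rw [eval_mul, eval_mul, eval_one_qBinom]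
    exact hprime.not_dvd_mul (hprime.not_dvd_mul (by exact_mod_cast h) hf') hg'

theorem not_dvd_one : ¬ (p : ℤ) ∣ 1 := fun h =>
  hp.out.one_lt.ne' (by exact_mod_cast Int.eq_one_of_dvd_one (Int.natCast_nonneg p) h)

theorem unitLead_one : UnitLead p 0 1 := by
  refine ⟨degLE_dp 0, 1, ?_, ?_⟩
  · rw [one_def, coeff_dp, if_pos rfl, map_one]
  · rw [eval_one]; exact not_dvd_one

theorem UnitLead.pow {k : ℕ} {v : (baseModel p).E} (hv : UnitLead p (p ^ k) v) {i : ℕ}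
    (hi : i < p) : UnitLead p (i * p ^ k) (v ^ i) := by
  induction i with
  | zero => rw [pow_zero, zero_mul]; exact unitLead_one
  | succ i ih =>
    rw [pow_succ, Nat.succ_mul]
    exact (ih (by omega)).mul hv (not_dvd_choose_succ hi)

/-- The factors with `t < p - 1` are prime to `p`; the one with `t = p - 1` contributes exactly one
factor `p`, matching the one in `ℓ(1)`. -/
theorem eval_prod_qBinom (k : ℕ) : ∃ c : ℤ, ¬ (p : ℤ) ∣ c ∧
    (∏ t ∈ Finset.range p, qBinom (X ^ p : ℤ[X]) (t * p ^ k + p ^ k) (t * p ^ k)).eval 1 =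
      p * c := by
  have hprime : Prime (p : ℤ) := Nat.prime_iff_prime_int.1 hp.out
  obtain ⟨c, hc, hc'⟩ := exists_choose_eq (p := p) k
  have h1 : p = p - 1 + 1 := (Nat.sub_add_cancel hp.out.one_le).symm
  refine ⟨(∏ t ∈ Finset.range (p - 1), ((t * p ^ k + p ^ k).choose (t * p ^ k) : ℤ)) * c, ?_, ?_⟩
  · refine hprime.not_dvd_mul (fun h => ?_) (by exact_mod_cast hc)
    obtain ⟨t, ht, hd⟩ := (Prime.dvd_finsetProd_iff hprime _).1 h
    rw [Finset.mem_range] at ht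
    exact not_dvd_choose_succ (p := p) (k := k) (i := t) (by omega) (by exact_mod_cast hd)
  · rw [eval_prod]
    simp only [eval_one_qBinom]
    have h2 : Finset.range p = Finset.range (p - 1 + 1) := by rw [← h1]
    rw [h2, Finset.prod_range_succ, hc']
    push_cast
    ring

theorem isDeltaHom_C_base : IsDeltaHom (intPolyDelta p) (baseDelta p) (C : ℤ[X] →+* ℤ[X][X]) :=
  baseDelta_C p

/-- Comparing coefficients in degree `p ^ (k + 1)` in the weight relation expresses `ℓ` times the
next leading coefficient through the previous one. -/
theorem unitLead_baseIter (k : ℕ) : UnitLead p (p ^ k) (baseIter p k) := by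
  refine ⟨degLE_baseIter p k, ?_⟩
  induction k with
  | zero =>
    refine ⟨1, ?_, by rw [eval_one]; exact not_dvd_one⟩
    rw [map_one]
    exact (coeff_dp _ _).trans (if_pos rfl)
  | succ k ih =>
    obtain ⟨f, hf, hf'⟩ := ih
    have hprime : Prime (p : ℤ) := Nat.prime_iff_prime_int.1 hp.out
    have hz : (baseModel p).delta.δ (algebraMap ℤ[X][X] (baseModel p).E X +
        algebraMap ℤ[X][X] (baseModel p).E (C (qNum (X : ℤ[X]) p)) * dp _ _ 1) = 0 := by
      have := (baseModel p).delta_z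
      rw [smul_eq_algebraMap_mul] at this
      rw [map_qNum]
      exact this
    obtain ⟨κ, ℓ, h1, ⟨c, h2, h3⟩, h4⟩ := exists_weightRel (e := C) isDeltaHom_C_base
      (baseModel p).isDeltaHom_algebraMap (baseDelta_X p) hz k
    have h5 := coeff_of_deltaLow (degLE_baseIter p) h4
    change coeff _ (_ * baseIter p k ^ p - _ * baseIter p (k + 1)) = 0 at h5
    have h6 := (degLE_baseIter p k).coeff_pow p
    rw [← pow_succ', hf] at h6
    simp only [base_qBinom] at h6
    rw [map_sub, ← smul_eq_algebraMap_mul, ← smul_eq_algebraMap_mul, map_smul, map_smul, h6,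
      smul_eq_mul, smul_eq_mul, ← map_prod, ← map_pow, ← map_mul, ← map_mul, sub_eq_zero] at h5
    obtain ⟨d, hd, hd'⟩ := eval_prod_qBinom (p := p) k
    have hp0 : (p : ℤ) ≠ 0 := hprime.ne_zero
    have hl : ℓ ≠ 0 := by
      rintro rfl
      rw [eval_zero] at h2
      exact h3 ((mul_eq_zero.1 h2.symm).resolve_left hp0 ▸ dvd_zero _)
    -- The other side does not involve `x` and `ℓ` is a nonzero element of `ℤ[q]`, so the new
    -- leading coefficient does not involve `x` either.
    have hdeg : (coeff (p ^ (k + 1)) (baseIter p (k + 1))).natDegree = 0 := by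
      have := congrArg natDegree h5
      rwa [natDegree_C, natDegree_C_mul hl, eq_comm] at this
    obtain ⟨g, hg⟩ := natDegree_eq_zero.1 hdeg
    refine ⟨g, hg.symm, fun hgd => ?_⟩
    rw [← hg, ← map_mul] at h5
    have h7 := congrArg (eval 1) (C_injective h5)
    rw [eval_mul, eval_mul, hd', eval_mul, eval_pow, h2] at h7
    -- At `q = 1` the factor `p` of the binomial product cancels against that of `ℓ(1)`.
    have h8 : κ.eval 1 * (d * f.eval 1 ^ p) = c * g.eval 1 :=
      mul_left_cancel₀ hp0 (by linear_combination h7)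
    exact hprime.not_dvd_mul h1 (hprime.not_dvd_mul hd
      fun h' => hf' (hprime.dvd_of_dvd_pow h')) (h8 ▸ Dvd.dvd.mul_left hgd c)

/-- Multiplying powers along the digits of `n` involves no carry, so by Lucas' theorem all binomial
coefficients that appear are prime to `p`. -/
theorem unitLead_digitMon (k n : ℕ) :
    UnitLead p (p ^ k * n) (digitMon (baseModel p).delta (dp _ _ 1) k n) := by
  induction n using Nat.strong_induction_on generalizing k with
  | _ n ih =>
    by_cases h : n = 0
    · rw [h, digitMon_zero, mul_zero]; exact unitLead_one
    · rw [digitMon_eq]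
      have h1 := ((unitLead_baseIter k).pow (Nat.mod_lt n hp.out.pos)).mul
        (ih (n / p) (Nat.div_lt_self (Nat.pos_of_ne_zero h) hp.out.one_lt) (k + 1))
        (not_dvd_choose_mod k n)
      have e : p ^ k * n = n % p * p ^ k + p ^ (k + 1) * (n / p) := by
        conv_lhs => rw [← Nat.mod_add_div n p]
        ring
      rw [e]
      exact h1

end BaseLead

section GeneralLead

variable {p : ℕ} [hp : Fact p.Prime] {A : Type*} [CommRing A] {δA : DeltaStructure p A} {q x : A}

theorem baseChange_iterate (hq : δA.δ q = 0) (hx : δA.δ x = 0) (k : ℕ) :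
    baseChange p q x (baseIter p k) = (levelDelta hq hx).δ^[k] (dp _ _ 1) := by
  induction k with
  | zero => exact baseChange_dp 1
  | succ k ih =>
    rw [baseIter, Function.iterate_succ_apply', Function.iterate_succ_apply', ← ih]
    exact (levelDelta_baseChange hq hx _).symm

theorem baseChange_digitMon (hq : δA.δ q = 0) (hx : δA.δ x = 0) (k n : ℕ) :
    baseChange p q x (digitMon (baseModel p).delta (dp _ _ 1) k n) =
      digitMon (levelDelta hq hx) (dp _ _ 1) k n := by
  induction n using Nat.strong_induction_on generalizing k with
  | _ n ih =>
    by_cases h : n = 0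
    · rw [h, digitMon_zero, digitMon_zero, map_one]
    · rw [digitMon_eq, digitMon_eq k n, map_mul, map_pow,
        ih _ (Nat.div_lt_self (Nat.pos_of_ne_zero h) hp.out.one_lt), ← baseChange_iterate]
      rfl

theorem DegLE.baseChange {n : ℕ} {e : (baseModel p).E} (h : DegLE n e) :
    DegLE n (baseChange p q x e) := fun m hm => by
  rw [coeff_baseChange, h m hm, map_zero]

theorem degLE_iterate (hq : δA.δ q = 0) (hx : δA.δ x = 0) (k : ℕ) :
    DegLE (p ^ k) ((levelDelta hq hx).δ^[k] (dp _ _ 1)) := by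
  rw [← baseChange_iterate]
  exact (degLE_baseIter p k).baseChange

theorem coeff_digitMon (hq : δA.δ q = 0) (hx : δA.δ x = 0)
    (hu : ∀ f : ℤ[X], ¬ (p : ℤ) ∣ f.eval 1 → IsUnit (aeval q f)) (n : ℕ) :
    IsUnit (coeff n (digitMon (levelDelta hq hx) (dp _ _ 1) 0 n)) := by
  obtain ⟨-, f, hf, hf'⟩ := unitLead_digitMon (p := p) 0 n
  rw [pow_zero, one_mul] at hf
  rw [← baseChange_digitMon, coeff_baseChange, hf, baseHom_C]
  exact hu f hf'

end GeneralLead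

end QDivPow

/-! ### The universal property -/

section Functoriality

variable {p : ℕ} [hp : Fact p.Prime] {A T T' : Type*} [CommRing A] [CommRing T] [CommRing T']
  {δT : DeltaStructure p T} {δT' : DeltaStructure p T'} {g : T →+* T'} {j : A →+* T} {b : T}

theorem IsDeltaHom.map_iterate (hg : IsDeltaHom δT δT' g) (k : ℕ) (b : T) :
    g (δT.δ^[k] b) = δT'.δ^[k] (g b) :=
  (show Function.Semiconj g δT.δ δT'.δ from fun r => (hg r).symm).iterate_right k b

theorem IsDeltaHom.map_digitMon (hg : IsDeltaHom δT δT' g) (b : T) (k n : ℕ) :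
    g (digitMon δT b k n) = digitMon δT' (g b) k n := by
  induction n using Nat.strong_induction_on generalizing k with
  | _ n ih =>
    by_cases h : n = 0
    · rw [h, digitMon_zero, digitMon_zero, map_one]
    · rw [digitMon_eq, digitMon_eq k n, map_mul, map_pow,
        ih _ (Nat.div_lt_self (Nat.pos_of_ne_zero h) hp.out.one_lt), hg.map_iterate]

theorem DeltaFilt.map (hg : IsDeltaHom δT δT' g) {n : ℕ} {t : T} (h : DeltaFilt δT j b n t) :
    DeltaFilt δT' (g.comp j) (g b) n (g t) := by
  induction h with
  | base a n => exact .base (j := g.comp j) a n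
  | gen k => rw [hg.map_iterate]; exact .gen k
  | add _ _ h1 h2 => rw [map_add]; exact h1.add h2
  | mul _ _ h1 h2 => rw [map_mul]; exact h1.mul h2
  | mono _ hmn ih => exact ih.mono hmn

theorem DeltaLow.map (hg : IsDeltaHom δT δT' g) {n : ℕ} {t : T} (h : DeltaLow δT j b n t) :
    DeltaLow δT' (g.comp j) (g b) n (g t) := by
  cases n with
  | zero => obtain rfl : t = 0 := h; exact map_zero g
  | succ n => exact DeltaFilt.map hg (DeltaFilt.low_succ.1 h)

end Functoriality

/-! ### Units coming from `ℤ_p⟦q - 1⟧` -/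

section Units

open Polynomial

variable {p : ℕ} [hp : Fact p.Prime]

/-- As a power series in `q - 1`, the element `f(q)` has constant coefficient `f(1)`, a unit of
`ℤ_p`. -/
theorem isUnit_aeval_qElt {R : Type*} [CommRing R] [Algebra (PowerSeries ℤ_[p]) R] {f : ℤ[X]}
    (hf : ¬ (p : ℤ) ∣ f.eval 1) : IsUnit (aeval (qElt p R) f) := by
  have h : IsUnit (aeval (1 + PowerSeries.X : PowerSeries ℤ_[p]) f) := by
    rw [PowerSeries.isUnit_iff_constantCoeff, ← RingHom.coe_coe (aeval _), ← RingHom.comp_apply]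
    have e : (PowerSeries.constantCoeff (R := ℤ_[p])).comp
        ((aeval (1 + PowerSeries.X : PowerSeries ℤ_[p]) : ℤ[X] →ₐ[ℤ] _) : ℤ[X] →+* _) =
        (Int.castRingHom ℤ_[p]).comp (evalRingHom 1) :=
      Polynomial.ringHom_ext' (RingHom.ext_int _ _) (by simp)
    rw [e, RingHom.comp_apply, coe_evalRingHom, eq_intCast, PadicInt.isUnit_iff]
    refine le_antisymm (PadicInt.norm_le_one _) (not_lt.1 fun hlt => hf ?_)
    exact (PadicInt.norm_int_lt_one_iff_dvd _).1 hlt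
  have h2 := h.map (algebraMap (PowerSeries ℤ_[p]) R)
  rw [← RingHom.coe_coe (aeval _), ← RingHom.comp_apply] at h2
  rw [← RingHom.coe_coe (aeval _)]
  convert h2 using 1
  refine RingHom.congr_fun (Polynomial.ringHom_ext' (RingHom.ext_int _ _) ?_) f
  simp [qElt]

end Units

namespace QDivPow

open Polynomial

/-! ### The subalgebra of `E × B` generated by the iterates of `(ω, β)` -/

section Graph

variable {p : ℕ} [hp : Fact p.Prime] {A B : Type*} [CommRing A] [CommRing B]
  {δA : DeltaStructure p A} {δB : DeltaStructure p B} {q x : A}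

theorem isDeltaHom_aeval (hq : δA.δ q = 0) :
    IsDeltaHom (intPolyDelta p) δA ((aeval q : ℤ[X] →ₐ[ℤ] A) : ℤ[X] →+* A) :=
  isDeltaHom_polyDelta (isDeltaHom_int _ _ _) (by simp [hq])

/-- The homomorphism `A → E × B`. -/
noncomputable def graphBase (q x : A) (v : A →+* B) : A →+* LevelRing p A q x × B :=
  (algebraMap A (LevelRing p A q x)).prod v

variable (hq : δA.δ q = 0) (hx : δA.δ x = 0)
  (hu : ∀ f : ℤ[X], ¬ (p : ℤ) ∣ f.eval 1 → IsUnit (aeval q f))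
  {v : A →+* B} (hv : IsDeltaHom δA δB v) {β : B} (hβ : δB.δ (v x + v (qNum q p) * β) = 0)

theorem isDeltaHom_graphBase (hv : IsDeltaHom δA δB v) :
    IsDeltaHom δA ((levelDelta hq hx).prod δB) (graphBase q x v) := fun a =>
  Prod.ext (levelDelta_algebraMap hq hx a) (hv a)

theorem isDeltaHom_fst (D : DeltaStructure p A) (D' : DeltaStructure p B) :
    IsDeltaHom (D.prod D') D (RingHom.fst A B) := fun _ => rfl

theorem isDeltaHom_snd (D : DeltaStructure p A) (D' : DeltaStructure p B) :
    IsDeltaHom (D.prod D') D' (RingHom.snd A B) := fun _ => rfl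

include hu hv hβ in
-- The vanishing of `δ (x + (p)_q b)` holds in both components, so the weight relations hold for `b
-- = (ω, β)`; dividing by the unit `κ(q)` puts them in the form needed for digit monomials.
theorem exists_graph_rel (k : ℕ) : ∃ α,
    DeltaLow ((levelDelta hq hx).prod δB) (graphBase q x v) (dp _ _ 1, β) (p ^ (k + 1))
      ((((levelDelta hq hx).prod δB).δ^[k] (dp _ _ 1, β)) ^ p -
        graphBase q x v α * ((levelDelta hq hx).prod δB).δ^[k + 1] (dp _ _ 1, β)) := by
  have hd : aeval q (qNum (X : ℤ[X]) p) = qNum q p := by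
    rw [← RingHom.coe_coe (aeval _), map_qNum]
    simp
  obtain ⟨κ, ℓ, h1, -, h2⟩ := exists_weightRel (b := ((dp _ _ 1, β) : LevelRing p A q x × B))
    (isDeltaHom_aeval hq) (isDeltaHom_graphBase hq hx hv) hx (by
      rw [RingHom.coe_coe, hd]
      refine Prod.ext ?_ hβ
      have := levelDelta_z hq hx
      rw [smul_eq_algebraMap_mul] at this
      exact this) k
  obtain ⟨w, hw⟩ := hu κ h1
  refine ⟨↑w⁻¹ * aeval q ℓ, ?_⟩
  have h3 := h2.base_mul (↑w⁻¹ : A)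
  have h4 : graphBase (p := p) q x v (↑w⁻¹) * graphBase q x v (aeval q κ) = 1 := by
    rw [← map_mul, ← hw, Units.inv_mul, map_one]
  convert h3 using 1
  rw [RingHom.coe_coe, map_mul]
  linear_combination -((((levelDelta hq hx).prod δB).δ^[k] (dp _ _ 1, β)) ^ p) * h4

include hu hv hβ in
-- Descent on the weight: modulo lower weight `t` is a multiple of a digit monomial, and as `t.1 =
-- 0` while the leading coefficient of the monomial in `E` is a unit, the multiplier vanishes.
theorem graph_eq_zero (n : ℕ) {t : LevelRing p A q x × B}
    (ht : DeltaLow ((levelDelta hq hx).prod δB) (graphBase q x v) (dp _ _ 1, β) n t)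
    (h0 : t.1 = 0) : t = 0 := by
  induction n with
  | zero => exact ht
  | succ n ih =>
    refine ih ?_
    obtain ⟨α, hα⟩ := DeltaFilt.exists_digitMon (exists_graph_rel hq hx hu hv hβ)
      (DeltaFilt.low_succ.1 ht)
    have h1 := hα.map (isDeltaHom_fst (levelDelta hq hx) δB)
    have h2 := coeff_of_deltaLow (degLE_iterate hq hx) h1
    rw [map_sub, map_mul, (isDeltaHom_fst (levelDelta hq hx) δB).map_digitMon] at h2
    change coeff n (t.1 - algebraMap A _ α * digitMon (levelDelta hq hx) (dp _ _ 1) 0 n) = 0 at h2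
    rw [h0, zero_sub, ← smul_eq_algebraMap_mul, map_neg, map_smul, smul_eq_mul, neg_eq_zero,
      (coeff_digitMon hq hx hu n).mul_left_eq_zero] at h2
    rw [h2, map_zero, zero_mul, sub_zero] at hα
    exact hα

include hu in
-- Triangular elimination: the top coefficient of `e` is removed by a multiple of the digit monomial
-- of weight `n`, whose leading coefficient is a unit.
theorem exists_graph (v : A →+* B) (β : B) (n : ℕ) {e : LevelRing p A q x} (he : DegLE n e) :
    ∃ t, DeltaFilt ((levelDelta hq hx).prod δB) (graphBase q x v) (dp _ _ 1, β) n t ∧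
      t.1 = e := by
  have step : ∀ n (e : LevelRing p A q x), DegLE n e → ∃ t,
      DeltaFilt ((levelDelta hq hx).prod δB) (graphBase q x v) (dp _ _ 1, β) n t ∧
        DegLE n (e - t.1) ∧ coeff n (e - t.1) = 0 := by
    intro n e he
    obtain ⟨w, hw⟩ := coeff_digitMon hq hx hu n
    have hF := digitMon_filt (δT := (levelDelta hq hx).prod δB) (j := graphBase q x v)
      (b := (dp _ _ 1, β)) 0 n
    rw [pow_zero, one_mul] at hF
    have h1 : (graphBase q x v (coeff n e * (↑w⁻¹ : A)) *
        digitMon ((levelDelta hq hx).prod δB) (dp _ _ 1, β) 0 n).1 =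
        (coeff n e * (↑w⁻¹ : A)) • digitMon (levelDelta hq hx) (dp _ _ 1) 0 n := by
      rw [smul_eq_algebraMap_mul, ← RingHom.coe_fst, map_mul,
        (isDeltaHom_fst (levelDelta hq hx) δB).map_digitMon]
      rfl
    have h2 := (hF.base_mul (coeff n e * (↑w⁻¹ : A))).map (isDeltaHom_fst (levelDelta hq hx) δB)
    have h3 := degLE_of_deltaFilt (degLE_iterate hq hx) h2
    refine ⟨_, hF.base_mul (coeff n e * (↑w⁻¹ : A)), ?_, ?_⟩
    · intro m hm
      rw [map_sub, he m hm, zero_sub, neg_eq_zero]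
      exact h3 m hm
    · rw [h1, map_sub, map_smul, ← hw, smul_eq_mul, mul_assoc, Units.inv_mul, mul_one, sub_self]
  induction n generalizing e with
  | zero =>
    obtain ⟨t, ht, h1, h2⟩ := step 0 e he
    refine ⟨t, ht, (sub_eq_zero.1 (ext_coeff fun m => ?_)).symm⟩
    rw [map_zero]
    rcases Nat.eq_zero_or_pos m with rfl | hm
    · exact h2
    · exact h1 m hm
  | succ n ih =>
    obtain ⟨t, ht, h1, h2⟩ := step (n + 1) e he
    obtain ⟨t', ht', h3⟩ := ih (e := e - t.1) fun m hm => by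
      rcases (Nat.succ_le_of_lt hm).eq_or_lt with rfl | hm
      · exact h2
      · exact h1 m hm
    refine ⟨t + t', ht.add (ht'.mono n.le_succ), ?_⟩
    rw [Prod.fst_add, h3, add_sub_cancel]

end Graph

/-! ### The envelope property -/

section Envelope

variable {p : ℕ} [hp : Fact p.Prime] {R A : Type*} [CommRing R] [CommRing A] [Algebra R A]
  {δA : DeltaStructure p A} {q x : A}

/-- The reason for the choice of `δ ξ`: it cancels the correction term in `δ (x + ξ)`. -/
theorem deltaXi_add : (deltaXi δA x).δ (C x + X) = C (δA.δ x) := by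
  rw [(deltaXi δA x).map_add, deltaXi, polyDelta_C, polyDelta_X, add_sub_cancel_right]

theorem xiMap_C (a : A) : xiMap p R q x (C a) = algebraMap A _ a :=
  aeval_C _ _

theorem xiMap_X : xiMap p R q x X = qNum q p • dp _ _ 1 :=
  aeval_X _

theorem noTorsion_levelRing {d : R} (hd : NoTorsion A d) : NoTorsion (LevelRing p A q x) d := by
  intro e he
  refine ext_coeff fun n => ?_
  rw [map_zero]
  refine hd _ ?_
  rw [← algebraMap_smul A d, smul_eq_mul, ← smul_eq_mul, ← map_smul, algebraMap_smul, he, map_zero]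

theorem algebraMap_levelRing (r : R) :
    algebraMap R (LevelRing p A q x) r = algebraMap A _ (algebraMap R A r) := by
  rw [algebraMap_apply, algebraMap_apply]
  rfl

theorem isDeltaHom_xiMap (hq : δA.δ q = 0) (hx : δA.δ x = 0) :
    IsDeltaHom (deltaXi δA x) (levelDelta hq hx)
      ((xiMap p R q x : A[X] →ₐ[R] LevelRing p A q x) : A[X] →+* LevelRing p A q x) := by
  refine isDeltaHom_polyDelta (fun a => ?_) ?_
  · simp only [RingHom.comp_apply, RingHom.coe_coe, xiMap_C]
    exact levelDelta_algebraMap hq hx a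
  · have h := (levelDelta hq hx).map_add (algebraMap A _ x) (qNum q p • dp _ _ 1)
    rw [levelDelta_z, levelDelta_algebraMap hq hx, hx, map_zero] at h
    rw [map_deltaPoly]
    simp only [RingHom.coe_coe, xiMap_C, xiMap_X]
    linear_combination -h

end Envelope

end QDivPow

open QDivPow in
-- The base `ℤ_p⟦q - 1⟧` enters only through `hu`.
theorem isPrismaticEnvelope_levelRing {p : ℕ} [hp : Fact p.Prime]
    {R : Type u} [CommRing R] {δR : DeltaStructure p R} {q₀ : R}
    {A : Type v} [CommRing A] [Algebra R A]
    {δA : DeltaStructure p A} (hA : IsDeltaHom δR δA (algebraMap R A)) {x : A}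
    (hq : δA.δ (algebraMap R A q₀) = 0) (hx : δA.δ x = 0)
    (hu : ∀ f : ℤ[X], ¬ (p : ℤ) ∣ f.eval 1 → IsUnit (Polynomial.aeval (algebraMap R A q₀) f))
    (hA_tors : NoTorsion A (qNum q₀ p)) :
    IsPrismaticEnvelope.{w} δR (qNum q₀ p) (deltaXi δA x) (Ideal.span {Polynomial.X})
      (levelDelta hq hx) (xiMap p R (algebraMap R A q₀) x) where
  isDeltaAlgebra r := by
    rw [algebraMap_levelRing r, algebraMap_levelRing (δR.δ r), levelDelta_algebraMap hq hx, hA r]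
  noTorsion := noTorsion_levelRing hA_tors
  isDeltaPairHom := by
    refine ⟨isDeltaHom_xiMap hq hx, ?_⟩
    rw [Ideal.span_singleton_le_iff_mem, Ideal.mem_comap, xiMap_X, Ideal.mem_span_singleton]
    refine ⟨dp _ _ 1, ?_⟩
    rw [algebraMap_levelRing, map_qNum (algebraMap R A), smul_eq_algebraMap_mul]
  existsUnique_lift := by
    intro B _ _ δB hB hB_tors u hu'
    obtain ⟨hδ, hI⟩ := hu'
    rw [Ideal.span_singleton_le_iff_mem, Ideal.mem_comap, Ideal.mem_span_singleton] at hI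
    -- `β` is the intended image of `ω`.
    obtain ⟨β, hβ⟩ := hI
    set q : A := algebraMap R A q₀ with hq_def
    have huC : ∀ r : R, u (Polynomial.C (algebraMap R A r)) = algebraMap R B r :=
      fun r => u.commutes r
    let v : A →+* B := (u : A[X] →+* B).comp Polynomial.C
    have hv : IsDeltaHom δA δB v := hδ.comp fun a => polyDelta_C _ _ a
    have hvd : v (qNum q p) = algebraMap R B (qNum q₀ p) := by
      rw [← huC, map_qNum (algebraMap R A)]
      rfl
    have hz : δB.δ (v x + v (qNum q p) * β) = 0 := by
      rw [hvd, ← hβ]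
      have h := hδ (Polynomial.C x + Polynomial.X)
      rw [deltaXi_add, hx, map_zero, map_zero, map_add] at h
      exact h
    set δT := (levelDelta hq hx).prod δB with hδT
    set j := graphBase (p := p) q x v with hj
    set b : LevelRing p A q x × B := (dp _ _ 1, β) with hb
    have hjR : ∀ r : R, algebraMap R (LevelRing p A q x × B) r = j (algebraMap R A r) := fun r =>
      Prod.ext (algebraMap_levelRing r) (huC r).symm
    let Γ : Subalgebra R (LevelRing p A q x × B) :=
      { carrier := {t | ∃ n, DeltaFilt δT j b n t}
        mul_mem' := fun ⟨_, h⟩ ⟨_, h'⟩ => ⟨_, h.mul h'⟩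
        add_mem' := fun ⟨m, h⟩ ⟨n, h'⟩ =>
          ⟨max m n, (h.mono (le_max_left m n)).add (h'.mono (le_max_right m n))⟩
        algebraMap_mem' := fun r => ⟨0, hjR r ▸ DeltaFilt.base _ 0⟩ }
    have hcov : ∀ e : LevelRing p A q x, ∃ t ∈ Γ, t.1 = e := fun e => by
      obtain ⟨n, hn⟩ := exists_degLE e
      obtain ⟨t, ht, rfl⟩ := exists_graph (δB := δB) hq hx hu v β n hn
      exact ⟨t, ⟨n, ht⟩, rfl⟩
    let π : Γ →ₐ[R] LevelRing p A q x := (AlgHom.fst R (LevelRing p A q x) B).comp Γ.val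
    have hπ : Function.Bijective π := by
      constructor
      · rw [injective_iff_map_eq_zero]
        rintro ⟨t, n, ht⟩ h0
        -- Weight at most `n` is weight less than `n + 1`.
        exact Subtype.ext (graph_eq_zero hq hx hu hv hz (n + 1) ht h0)
      · intro e
        obtain ⟨t, ht, rfl⟩ := hcov e
        exact ⟨⟨t, ht⟩, rfl⟩
    let eqv := AlgEquiv.ofBijective π hπ
    -- The homomorphism whose graph is `Γ`; it commutes with `δ` because `Γ` is stable under `δ`.
    let g : LevelRing p A q x →ₐ[R] B :=
      ((AlgHom.snd R (LevelRing p A q x) B).comp Γ.val).comp (eqv.symm : _ →ₐ[R] Γ)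
    have hg : ∀ t ∈ Γ, g t.1 = t.2 := fun t ht => by
      have h1 : eqv.symm t.1 = ⟨t, ht⟩ := by
        rw [AlgEquiv.symm_apply_eq]
        rfl
      change (eqv.symm t.1 : LevelRing p A q x × B).2 = t.2
      rw [h1]
    have hbΓ : b ∈ Γ := ⟨_, DeltaFilt.gen 0⟩
    refine ⟨g, ⟨⟨fun e => ?_, ?_⟩, ?_⟩, ?_⟩
    · obtain ⟨t, ⟨n, ht⟩, rfl⟩ := hcov e
      have h1 := hg t ⟨n, ht⟩
      have h2 := hg (δT.δ t) ⟨_, ht.delta (isDeltaHom_graphBase hq hx hv)⟩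
      exact (congrArg δB.δ h1).trans h2.symm
    · rw [Ideal.span_singleton_le_iff_mem, Ideal.mem_comap, AlgHom.commutes]
      exact Ideal.mem_span_singleton_self _
    · refine AlgHom.coe_ringHom_injective (Polynomial.ringHom_ext (fun a => ?_) ?_)
      · change g (xiMap p R q x (Polynomial.C a)) = u (Polynomial.C a)
        rw [xiMap_C]
        exact hg (j a) ⟨0, DeltaFilt.base a 0⟩
      · change g (xiMap p R q x Polynomial.X) = u Polynomial.X
        rw [xiMap_X, hβ, smul_eq_algebraMap_mul, map_mul, ← hvd]
        exact congrArg₂ (· * ·) (hg (j (qNum q p)) ⟨0, DeltaFilt.base _ 0⟩) (hg b hbΓ)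
    · rintro g' ⟨⟨hg'δ, -⟩, hg'u⟩
      have hg'C : ∀ a, g' (algebraMap A _ a) = v a := fun a => by
        have := DFunLike.congr_fun hg'u (Polynomial.C a)
        rw [AlgHom.comp_apply, xiMap_C] at this
        exact this
      have hg'b : g' (dp _ _ 1) = β := by
        have h := DFunLike.congr_fun hg'u Polynomial.X
        rw [AlgHom.comp_apply, xiMap_X, hβ, smul_eq_algebraMap_mul, map_mul, hg'C, hvd,
          ← sub_eq_zero, ← mul_sub, ← Algebra.smul_def] at h
        -- Both `g' ω` and `β` become `u ξ` after multiplication by `(p)_q`, which is injective on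
        -- `B`.
        exact sub_eq_zero.1 (hB_tors _ h)
      have hg't : ∀ n t, DeltaFilt δT j b n t → g' t.1 = t.2 := by
        intro n t ht
        induction ht with
        | base a n => exact hg'C a
        | gen k =>
          have h1 := (isDeltaHom_fst (levelDelta hq hx) δB).map_iterate k b
          have h2 := (isDeltaHom_snd (levelDelta hq hx) δB).map_iterate k b
          have h3 := hg'δ.map_iterate k (dp _ _ 1)
          rw [RingHom.coe_coe, hg'b] at h3
          exact ((congrArg g' h1).trans h3).trans h2.symm
        | add _ _ h1 h2 => rw [Prod.fst_add, Prod.snd_add, map_add, h1, h2]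
        | mul _ _ h1 h2 => rw [Prod.fst_mul, Prod.snd_mul, map_mul, h1, h2]
        | mono _ _ ih => exact ih
      refine AlgHom.ext fun e => ?_
      obtain ⟨t, ⟨n, ht⟩, rfl⟩ := hcov e
      rw [hg't n t ht, hg t ⟨n, ht⟩]

theorem proposition6p2 (p : ℕ) [Fact p.Prime]
    {R : Type u} [CommRing R] [Algebra (PowerSeries ℤ_[p]) R]
    (δR : DeltaStructure p R) (hq : δR.δ (qElt p R) = 0)
    {A : Type v} [CommRing A] [Algebra R A]
    (δA : DeltaStructure p A) (hA : IsDeltaHom δR δA (algebraMap R A))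
    (x : A) (hx : δA.δ x = 0)
    (hA_tors : NoTorsion A (qNum (qElt p R) p)) :
    ∃ δE : DeltaStructure p (LevelRing p A (algebraMap R A (qElt p R)) x),
      IsPrismaticEnvelope.{w} δR (qNum (qElt p R) p)
        (deltaXi δA x) (Ideal.span {Polynomial.X})
        δE (xiMap p R (algebraMap R A (qElt p R)) x) := by
  have hqA : δA.δ (algebraMap R A (qElt p R)) = 0 := by rw [hA, hq, map_zero]
  refine ⟨QDivPow.levelDelta hqA hx, isPrismaticEnvelope_levelRing hA hqA hx (fun f hf => ?_)
    hA_tors⟩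
  have h := (isUnit_aeval_qElt (R := R) hf).map (algebraMap R A)
  rw [← RingHom.coe_coe (Polynomial.aeval _), ← RingHom.comp_apply] at h
  rw [← RingHom.coe_coe (Polynomial.aeval _)]
  convert h using 1
  refine RingHom.congr_fun (Polynomial.ringHom_ext' (RingHom.ext_int _ _) ?_) f
  simp
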